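/- **Setting.** Let $\mathbb S=\mathbb R^k$, let $\mathcal A$ be a finite non-empty set, let $p(dy\mid x,a)$ be a Markov transition kernel from $\mathbb S\times\mathcal A$ to $\mathbb S$ that is weakly continuous in $x$, let $r:\mathbb S\times\mathcal A\to\mathbb R$ be continuous, and let $0<\alpha\le 1$. Let $Q(x,a;\theta)$, $\theta\in\mathbb R^d$, be the output of a fully connected feedforward network without biases: layers of activations, followed by an output layer that consists of one block of $l(a)$ activations for each action $a$, with $Q(x,a;\theta)=\sum_{i\le l(a)}\mathrm{act}_a(i)\,\theta_a(i)$, where $\theta$ collects all edge weights. All activation functions $\mathbb R\to\mathbb R$ are bounded (squashing) and twice continuously differentiable. Put $$\nabla_\theta\ell(\theta,x,a)=\Big(r(x,a)+\alpha\int\max_{a'}Q(y,a';\theta)\,p(dy\mid x,a)-Q(x,a;\theta)\Big)\nabla_\theta Q(x,a;\theta).$$ Let $\gamma(n)>0$ be eventually monotonic with $\sum_n\gamma(n)=\infty$ and $\sum_n\gamma(n)^2<\infty$. On a probability space let $x_n\in\mathbb S$, $a_n\in\mathcal A$, $\theta_n\in\mathbb R^d$ ($n\ge0$) be random variables such that,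 given $(x_m,a_m,\theta_m)_{m\le n}$, the state $x_{n+1}$ has law $p(\cdot\mid x_n,a_n)$; almost surely $\sup_n\|\theta_n\|<\infty$ and $\sup_n\|x_n\|<\infty$; and almost surely, for all $n$, the iterates follow the deep Q-learning recursion $$\theta_{n+1}=\theta_n+\gamma(n)\Big(r(x_n,a_n)+\alpha\max_{a'}Q(x_{n+1},a';\theta_n)-Q(x_n,a_n;\theta_n)\Big)\nabla_\theta Q(x_n,a_n;\theta_n),$$ or, alternatively, its averaged form $\theta_{n+1}=\theta_n+\gamma(n)\nabla_\theta\ell(\theta_n,x_n,a_n)$. Let $t_n=\sum_{m<n}\gamma(m)$, let $\overline\theta:[0,\infty)\to\mathbb R^d$ be the piecewise linear interpolation with $\overline\theta(t_n)=\theta_n$, let $\mu(t)=\delta_{(x_n,a_n)}$ for $t\in[t_n,t_{n+1})$, and $\mu^n(t)=\mu(t_n+t)$. Let $\mathcal U$ be the space of measurable maps $\nu$ from $[0,\infty)$ to the probability measures on $\mathcal S^k\times\mathcal A$, where the sphere $\mathcal S^k$ is the one-point compactification of $\mathbb S$ by inverse stereographic projection, with the coarsest topology for which $\nu\mapsto\int_0^Tg(t)\int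 f\,d\nu(t)\,dt$ is continuous for all $T>0$, $f\in C(\mathcal S^k\times\mathcal A)$, $g\in L^2([0,T])$; measures on $\mathbb S\times\mathcal A$ are identified with their push-forwards. For a measure process $\nu$, a solution of $$\dot\theta(t)=\int\nabla_\theta\ell(\theta(t),x,a)\,\nu(t,dx,da)\qquad(\ast_\nu)$$ is a continuous $\theta:[0,\infty)\to\mathbb R^d$ for which the right-hand side is well defined for almost every $t$ and locally integrable in $t$, and that satisfies the integrated equation for all $t\ge0$. **Statement.** Almost surely, the following holds. For every $n$ there is a solution $\theta^n$ of $(\ast_{\mu^n})$ with $\theta^n(0)=\overline\theta(t_n)$. For every choice of such solutions $(\theta^n)_{n\ge0}$: 1. $\sup_{t\in[0,T]}\|\overline\theta(t_n+t)-\theta^n(t)\|\to0$ as $n\to\infty$, for every $T>0$. 2. Every subsequence has a further subsequence along which $\theta^n\to\theta^\infty$ uniformly on compacts and $\mu^n\to\mu^\infty$ in $\mathcal U$, for some continuous $\theta^\infty$ and some $\mu^\infty\in\mathcal U$. 3. Whenever, along some subsequence, $\theta^n\to\theta^\infty$ uniformly on compacts and $\mu^n\to\mu^\infty$ in $\mathcal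 U$, then for almost every $t$ the measure $\mu^\infty(t)$ gives no mass to the point at infinity, $\theta^\infty$ is a solution of $(\ast_{\mu^\infty})$, i.e. of $$\dot\theta(t)=\int\nabla_\theta\ell(\theta(t),x,a)\,\mu^\infty(t,dx,da),$$ and along this subsequence $\overline\theta(t_n+\cdot)\to\theta^\infty$ uniformly on compacts. -/

import Mathlib

open MeasureTheory ProbabilityTheory Filter Topology Set
open scoped NNReal ENNReal

noncomputable section

namespace DeepQ

/-- The state space `ℝᵏ`. -/
abbrev State (k : ℕ) : Type := EuclideanSpace ℝ (Fin k)

/-! ### The deep Q-network -/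

/-- A fully connected feedforward architecture without biases, with input in `ℝᵏ` and one
output block per action. There are `depth` layers of activations (input layer and hidden layers)
of widths `width 0, …, width (depth - 1)`; they are followed by the output layer, which is the
union over the actions `a` of blocks of `outWidth a` activations. Every neuron has its own
activation function. (`width j` and `act j` are not used for `j ≥ depth`.) -/
structure Network (k : ℕ) (A : Type*) where
  depth : ℕ
  width : ℕ → ℕ
  act : (j : ℕ) → Fin (width j) → ℝ → ℝ
  outWidth : A → ℕ
  outAct : (a : A) → Fin (outWidth a) → ℝ → ℝ

namespace Network

variable {k : ℕ} {A : Type*}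

/-- Number of values that enter layer `j`: the input dimension for the input layer and the
width of the previous layer otherwise. -/
def fanIn (N : Network k A) : ℕ → ℕ
  | 0 => k
  | j + 1 => N.width j

/-- The edges of the network: the edges into the layers `j < depth`, the edges into the output
layer, and the edges leaving the output layer. -/
abbrev Edge (N : Network k A) : Type _ :=
  (Σ j : Fin N.depth, Fin (N.fanIn j) × Fin (N.width j)) ⊕
    ((Fin (N.fanIn N.depth) × (Σ a : A, Fin (N.outWidth a))) ⊕ (Σ a : A, Fin (N.outWidth a)))

/-- The weight space `ℝᵈ`, with `d` the number of edges. -/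
abbrev Weight (N : Network k A) : Type _ := EuclideanSpace ℝ N.Edge

/-- The values that enter layer `j`, for the weights `w` and the input `x`. -/
def layerInput (N : Network k A) (w : N.Weight) (x : State k) :
    (j : ℕ) → j ≤ N.depth → Fin (N.fanIn j) → ℝ
  | 0, _ => fun i => x i
  | j + 1, h => fun m =>
      N.act j m (∑ i, N.layerInput w x j (Nat.le_of_succ_le h) i * w (Sum.inl ⟨⟨j, h⟩, i, m⟩))

/-- The output of the activation number `m` in the output block of the action `a`. -/
def outputAct (N : Network k A) (w : N.Weight) (x : State k) (a : A) (m : Fin (N.outWidth a)) : ℝ :=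
  N.outAct a m
    (∑ i, N.layerInput w x N.depth le_rfl i * w (Sum.inr (Sum.inl (i, ⟨a, m⟩))))

/-- The network output `Q(x, a; w)`. -/
def Q (N : Network k A) (x : State k) (a : A) (w : N.Weight) : ℝ :=
  ∑ m, N.outputAct w x a m * w (Sum.inr (Sum.inr ⟨a, m⟩))

/-- All activation functions of the network satisfy `p`. -/
def AllActivations (N : Network k A) (p : (ℝ → ℝ) → Prop) : Prop :=
  (∀ j < N.depth, ∀ m, p (N.act j m)) ∧ ∀ a m, p (N.outAct a m)

variable [Fintype A]

/-- `∇_w Q(x, a; w)`. -/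
def gradQ (N : Network k A) (x : State k) (a : A) (w : N.Weight) : N.Weight :=
  gradient (fun w' => N.Q x a w') w

/-- The greedy value `max_{a'} Q(x, a'; w)`. -/
def maxQ (N : Network k A) (x : State k) (w : N.Weight) : ℝ := ⨆ a' : A, N.Q x a' w

/-- The update direction of deep Q-learning computed from the observed next state `y`. -/
def sampledGrad (N : Network k A) (r : State k → A → ℝ) (α : ℝ)
    (w : N.Weight) (x : State k) (a : A) (y : State k) : N.Weight :=
  (r x a + α * N.maxQ y w - N.Q x a w) • N.gradQ x a w

variable [MeasurableSpace A]

/-- The loss gradient `∇ℓ(w, x, a)`, in which the observed next state is averaged out with the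
transition kernel `p`. -/
def lossGrad (N : Network k A) (p : Kernel (State k × A) (State k)) (r : State k → A → ℝ) (α : ℝ)
    (w : N.Weight) (x : State k) (a : A) : N.Weight :=
  (r x a + α * ∫ y, N.maxQ y w ∂(p (x, a)) - N.Q x a w) • N.gradQ x a w

/-- The averaged loss gradient `∫ ∇ℓ(w, x, a) ν(dx, da)`. -/
def avgGrad (N : Network k A) (p : Kernel (State k × A) (State k)) (r : State k → A → ℝ) (α : ℝ)
    (w : N.Weight) (ν : Measure (State k × A)) : N.Weight :=
  ∫ z, N.lossGrad p r α w z.1 z.2 ∂ν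

/-- `ϑ` solves the non-autonomous o.d.e. `ϑ'(t) = ∫ ∇ℓ(ϑ(t), x, a) ν(t, dx, da)` on `[0, ∞)`, in
the sense of Carathéodory: the right-hand side is well defined for almost every `t`, locally
integrable in `t`, and `ϑ` is its indefinite integral. -/
def IsODESolution (N : Network k A) (p : Kernel (State k × A) (State k))
    (r : State k → A → ℝ) (α : ℝ) (ν : ℝ≥0 → Measure (State k × A)) (ϑ : C(ℝ≥0, N.Weight)) : Prop :=
  (∀ᵐ s ∂(volume.restrict (Ici (0 : ℝ))),
      Integrable (fun z : State k × A => N.lossGrad p r α (ϑ s.toNNReal) z.1 z.2)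
        (ν s.toNNReal)) ∧
  ∀ t : ℝ≥0,
    IntervalIntegrable (fun s : ℝ => N.avgGrad p r α (ϑ s.toNNReal) (ν s.toNNReal)) volume 0 t ∧
    ϑ t = ϑ 0 + ∫ s in (0 : ℝ)..t, N.avgGrad p r α (ϑ s.toNNReal) (ν s.toNNReal)

end Network

/-! ### Step sizes, the time axis and interpolation -/

/-- Positive, non-summable, square summable and eventually monotonic step sizes. -/
structure IsStepSize (γ : ℕ → ℝ) : Prop where
  pos : ∀ n, 0 < γ n
  not_summable : ¬ Summable γ
  summable_sq : Summable fun n => γ n ^ 2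
  eventually_monotonic : ∃ n, MonotoneOn γ (Ici n) ∨ AntitoneOn γ (Ici n)

/-- `t_n = γ(0) + … + γ(n-1)`. -/
def stepTime (γ : ℕ → ℝ) (n : ℕ) : ℝ := ∑ m ∈ Finset.range n, γ m

/-- `sup {n | t_n ≤ t}`: the index `n` with `t ∈ [t_n, t_{n+1})`. -/
def stepIndex (γ : ℕ → ℝ) (t : ℝ) : ℕ := sSup {n | stepTime γ n ≤ t}

/-- The piecewise linear interpolation of the sequence `w`, with value `w n` at time `t_n`. -/
def interpolate {E : Type*} [AddCommGroup E] [Module ℝ E] (γ : ℕ → ℝ) (w : ℕ → E) (t : ℝ) : E :=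
  w (stepIndex γ t) + ((t - stepTime γ (stepIndex γ t)) / γ (stepIndex γ t)) •
    (w (stepIndex γ t + 1) - w (stepIndex γ t))

theorem measurable_stepIndex (γ : ℕ → ℝ) : Measurable (stepIndex γ) := by
  classical
  refine measurable_to_countable' fun m => ?_
  have hs : ∀ n, MeasurableSet {t : ℝ | stepTime γ n ≤ t} := fun n => measurableSet_Ici
  have hU : ∀ m, MeasurableSet {t : ℝ | ∀ n, stepTime γ n ≤ t → n ≤ m} := by
    intro m
    have : {t : ℝ | ∀ n, stepTime γ n ≤ t → n ≤ m}
        = ⋂ n, ({t : ℝ | stepTime γ n ≤ t}ᶜ ∪ {_t | n ≤ m}) := by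
      ext t
      simp only [mem_ofPred_eq, mem_iInter, mem_union, mem_compl_iff]
      exact forall_congr' fun n => imp_iff_not_or
    rw [this]
    exact MeasurableSet.iInter fun n => (hs n).compl.union (MeasurableSet.const _)
  have key : stepIndex γ ⁻¹' {m} =
      ({t : ℝ | ∀ n, stepTime γ n ≤ t → n ≤ m} ∩
        ⋂ j, ({_t | ¬ j < m} ∪ {t : ℝ | ∀ n, stepTime γ n ≤ t → n ≤ j}ᶜ)) ∪
      ({_t | m = 0} ∩ (⋃ j, {t : ℝ | ∀ n, stepTime γ n ≤ t → n ≤ j})ᶜ) := by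
    ext t
    simp only [mem_preimage, mem_singleton_iff, mem_union, mem_inter_iff, mem_iInter,
      mem_compl_iff, mem_iUnion, mem_ofPred_eq]
    by_cases h : ∃ j, ∀ n ∈ {n | stepTime γ n ≤ t}, n ≤ j
    · have h' : ∃ j, ∀ n, stepTime γ n ≤ t → n ≤ j := h
      rw [stepIndex, Nat.sSup_def h, Nat.find_eq_iff]
      simp only [mem_ofPred_eq, h', not_true_eq_false, and_false, or_false]
      exact and_congr_right fun _ => forall_congr' fun j => imp_iff_not_or
    · have h' : ¬ ∃ j, ∀ n, stepTime γ n ≤ t → n ≤ j := h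
      have h0 : stepIndex γ t = 0 := by
        rw [stepIndex]
        exact Nat.sSup_of_not_bddAbove fun ⟨j, hj⟩ => h ⟨j, fun n hn => hj hn⟩
      have h2 : ¬ ∀ n, stepTime γ n ≤ t → n ≤ m := fun hm => h' ⟨m, hm⟩
      simp only [h0, h2, h', false_and, false_or, not_false_eq_true, and_true]
      exact eq_comm
  rw [key]
  exact ((hU m).inter (MeasurableSet.iInter fun j =>
    (MeasurableSet.const _).union (hU j).compl)).union
      ((MeasurableSet.const _).inter (MeasurableSet.iUnion hU).compl)

/-! ### Measure processes -/

section MeasureProcesses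

variable {k : ℕ} {A : Type*} [MeasurableSpace A]

/-- The left-shifted measure process `μⁿ(t) = μ(t_n + t)`, `t ≥ 0`, where
`μ(t) = δ_{(x_m, a_m)}` for `t ∈ [t_m, t_{m+1})`. -/
def shiftedProcess (γ : ℕ → ℝ) (x : ℕ → State k) (a : ℕ → A) (n : ℕ) :
    Kernel ℝ≥0 (State k × A) :=
  Kernel.deterministic
    (fun t => (x (stepIndex γ (stepTime γ n + t)), a (stepIndex γ (stepTime γ n + t))))
    ((measurable_from_top.comp
        ((measurable_stepIndex γ).comp (measurable_const.add measurable_coe_nnreal_real))).prodMk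
      (measurable_from_top.comp
        ((measurable_stepIndex γ).comp (measurable_const.add measurable_coe_nnreal_real))))

instance (γ : ℕ → ℝ) (x : ℕ → State k) (a : ℕ → A) (n : ℕ) :
    IsMarkovKernel (shiftedProcess γ x a n) :=
  Kernel.isMarkovKernel_deterministic _

/-- The unit sphere of `ℝ^{k+1}`, the one-point compactification of `ℝᵏ`. -/
abbrev Sphere (k : ℕ) : Type := Metric.sphere (0 : EuclideanSpace ℝ (Fin (k + 1))) 1

/-- The north pole `(0, …, 0, 1)`. -/
def northPole (k : ℕ) : Sphere k := ⟨EuclideanSpace.single (Fin.last k) 1, by simp⟩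

instance finrank_fact (k : ℕ) :
    Fact (Module.finrank ℝ (EuclideanSpace ℝ (Fin (k + 1))) = k + 1) := ⟨by simp⟩

/-- Inverse stereographic projection from the north pole, which embeds `ℝᵏ` into the sphere, times
the identity of the action space. -/
def embed (k : ℕ) (A : Type*) (z : State k × A) : Sphere k × A :=
  ((stereographic' k (northPole k)).symm z.1, z.2)

theorem measurable_embed : Measurable (embed k A) := by
  have h : Continuous (stereographic' k (northPole k)).symm := by
    rw [← continuousOn_univ]
    simpa using (stereographic' k (northPole k)).continuousOn_symm
  exact (h.measurable.comp measurable_fst).prodMk measurable_snd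

/-- The space `𝒰` of measurable maps from `[0, ∞)` to the probability measures on
`𝒮ᵏ × A`. -/
def ProcessSpace (k : ℕ) (A : Type*) [MeasurableSpace A] : Type _ :=
  {ν : Kernel ℝ≥0 (Sphere k × A) // IsMarkovKernel ν}

/-- The topology of `𝒰`: the coarsest one for which
`ν ↦ ∫_0^T g(t) ∫ f dν(t) dt` is continuous for all `T`, all `f ∈ C(𝒮ᵏ × A)` and all
`g ∈ L²([0, T])`. (It does not separate processes that agree for almost every `t`.) -/
instance [TopologicalSpace A] : TopologicalSpace (ProcessSpace k A) :=
  ⨅ (T : ℝ≥0) (f : C(Sphere k × A, ℝ)) (g : ℝ → ℝ)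
    (_ : MemLp g 2 (volume.restrict (Icc (0 : ℝ) T))),
    TopologicalSpace.induced
      (fun ν => ∫ t in (0 : ℝ)..T, g t * ∫ z, f z ∂(ν.1 t.toNNReal)) inferInstance

/-- The element of `𝒰` obtained from a process of probability measures on `ℝᵏ × A` by
push-forward. -/
def toProcessSpace (κ : Kernel ℝ≥0 (State k × A)) [IsMarkovKernel κ] : ProcessSpace k A :=
  ⟨κ.map (embed k A), Kernel.IsMarkovKernel.map κ measurable_embed⟩

/-- `ν(t)` seen as a measure on `ℝᵏ × A` (its restriction to `ℝᵏ × A` as a subset of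
`𝒮ᵏ × A`). -/
def ProcessSpace.onState (ν : ProcessSpace k A) (t : ℝ≥0) : Measure (State k × A) :=
  (ν.1 t).comap (embed k A)

/-- For almost every `t`, `ν(t)` gives mass `0` to the pole, that is, it comes from a probability
measure on `ℝᵏ × A`. -/
def ProcessSpace.NoMassAtPole (ν : ProcessSpace k A) : Prop :=
  ∀ᵐ t ∂(volume.restrict (Ici (0 : ℝ))), ν.1 t.toNNReal {z | z.1 = northPole k} = 0

end MeasureProcesses

/-- `p(· | x, a)` is weakly continuous (continuous in distribution) in the state `x`. -/
def WeaklyContinuous {k : ℕ} {A : Type*} [MeasurableSpace A]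
    (p : Kernel (State k × A) (State k)) [IsMarkovKernel p] : Prop :=
  ∀ a : A, Continuous (Y := ProbabilityMeasure (State k)) fun x => ⟨p (x, a), inferInstance⟩

/-- The `σ`-algebra generated by the states, actions and weights up to time `n`. -/
@[reducible] def history {Ω X A E : Type*} [MeasurableSpace X] [MeasurableSpace A] [MeasurableSpace E]
    (x : ℕ → Ω → X) (a : ℕ → Ω → A) (θ : ℕ → Ω → E) (n : ℕ) : MeasurableSpace Ω :=
  ⨆ (m : ℕ) (_ : m ≤ n), MeasurableSpace.comap (fun ω => (x m ω, a m ω, θ m ω)) inferInstance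

end DeepQ

end

/-!
The theorem compares three objects: the interpolated iterates, the trajectories that follow the
loss gradient along the observed states and actions, and the limits of the latter.

*The loss gradient.* The activations are bounded and `C²`, so `Q` and its gradient are `C¹` jointly
in weight and state, and `∇ℓ` is continuous (`Network.continuous_lossGrad`). It need not be locally
Lipschitz in the weight, because the expectation of the greedy value runs over an unbounded state
space. It is Lipschitz up to a multiple of the probability `p(x, a)(Kᶜ)` of jumping out of a ball
`K` (`Network.exists_norm_lossGrad_sub_le`). If the trajectory stays in `K`, then by the conditional
Borel–Cantelli lemma these probabilities are summable, hence tend to `0`, along the trajectory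
(`ae_tendsto_kernel_compl`).

*Tracking.* In the sampled variant the noise is a martingale difference sequence, bounded as long as
the iterates and states are, so its series with square summable coefficients converges almost surely
(`ae_exists_tendsto_noise`). The iteration is an Euler scheme for the piecewise autonomous equation
along the observed states, and Grönwall's inequality, with the vanishing error terms of the
near-Lipschitz bound, gives the tracking statement for every choice of solutions
(`tendstoUniformlyOn_interpolate_sub`).

*Existence of solutions.* Since `∇ℓ` is merely continuous in the weight, and its growth is not
controlled, existence uses its special form: a scalar factor times the `C¹` field `∇Q`. The equation
is solved by a time change of the gradient flow of `Q`, and the time change solves a scalar equation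
with continuous right-hand side (`exists_eq_add_integral_smul_gradient`,
`Network.exists_eq_add_integral_lossGrad`). There is no blow-up, because `Q` is linear with bounded
coefficients in the weights that leave the output layer, and so these weights and `Q` grow at most
linearly along the flow. The pieces are then concatenated (`IsStepSize.exists_isStepSolution`).

*Compactness and limits.* Tracking makes the solutions eventually bounded and so equi-Lipschitz on
compacts, and the Arzelà–Ascoli theorem applies. The space of measure processes is sequentially
compact (`ProcessSpace.exists_subseq_tendsto`), and its convergence can be tested with integrable
functions of time with values in the continuous functions
(`ProcessSpace.tendsto_integral_of_tendsto`).
Because the states stay in a ball, so do the limit measures, which therefore do not charge the pole.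
The integrated equation passes to the limit: the near-Lipschitz bound lets the limit path replace the
converging paths, and convergence in `𝒰` handles the rest (`Network.isODESolution_of_tendsto`).
-/

namespace DeepQ.Network

variable {k : ℕ} {A : Type*} {N : Network k A}

/-! ### Regularity of the network -/

theorem exists_abs_outAct_le [Finite A]
    (hN : N.AllActivations fun σ => Bornology.IsBounded (range σ)) :
    ∃ B, 0 ≤ B ∧ ∀ a m s, |N.outAct a m s| ≤ B := by
  have : ∀ i : Σ a : A, Fin (N.outWidth a), ∃ B, ∀ s, |N.outAct i.1 i.2 s| ≤ B := fun i => by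
    obtain ⟨B, hB⟩ := (hN.2 i.1 i.2).exists_norm_le
    exact ⟨B, fun s => hB _ (mem_range_self s)⟩
  choose B hB using this
  obtain ⟨C, hC⟩ := (finite_range B).bddAbove
  exact ⟨max C 0, le_max_right _ _, fun a m s =>
    (hB ⟨a, m⟩ s).trans ((hC (mem_range_self _)).trans (le_max_left _ _))⟩

variable [Fintype A]

theorem contDiff_weight (e : N.Edge) :
    ContDiff ℝ 2 fun v : N.Weight × State k => v.1 e :=
  (EuclideanSpace.proj (𝕜 := ℝ) e).contDiff.comp contDiff_fst

theorem contDiff_layerInput (hN : N.AllActivations fun σ => ContDiff ℝ 2 σ) (j : ℕ)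
    (h : j ≤ N.depth) (m : Fin (N.fanIn j)) :
    ContDiff ℝ 2 fun v : N.Weight × State k => N.layerInput v.1 v.2 j h m := by
  induction j with
  | zero =>
    exact (EuclideanSpace.proj (𝕜 := ℝ) (show Fin k from m)).contDiff.comp contDiff_snd
  | succ j ih =>
    exact (hN.1 j h m).comp (ContDiff.sum fun i _ => (ih _ i).mul (contDiff_weight _))

theorem contDiff_Q (hN : N.AllActivations fun σ => ContDiff ℝ 2 σ) (a : A) :
    ContDiff ℝ 2 fun v : N.Weight × State k => N.Q v.2 a v.1 :=
  ContDiff.sum fun m _ => ((hN.2 a m).comp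
    (ContDiff.sum fun i _ => (contDiff_layerInput hN _ _ i).mul (contDiff_weight _))).mul
      (contDiff_weight _)

theorem contDiff_Q_weight (hN : N.AllActivations fun σ => ContDiff ℝ 2 σ) (x : State k) (a : A) :
    ContDiff ℝ 2 fun w : N.Weight => N.Q x a w :=
  (contDiff_Q hN a).comp (contDiff_id.prodMk contDiff_const)

theorem contDiff_gradQ (hN : N.AllActivations fun σ => ContDiff ℝ 2 σ) (a : A) :
    ContDiff ℝ 1 fun v : N.Weight × State k => N.gradQ v.2 a v.1 := by
  have h : ContDiff ℝ 1 fun v : N.Weight × State k =>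
      fderiv ℝ (fun w' => N.Q v.2 a w') v.1 := by
    refine ContDiff.fderiv (m := 2) (f := fun (v : N.Weight × State k) w' => N.Q v.2 a w') ?_
      contDiff_fst (by norm_num)
    exact (contDiff_Q hN a).comp (contDiff_snd.prodMk (contDiff_snd.comp contDiff_fst))
  exact (InnerProductSpace.toDual ℝ N.Weight).symm.contDiff.comp h

theorem continuous_gradQ (hN : N.AllActivations fun σ => ContDiff ℝ 2 σ) (a : A) :
    Continuous fun v : N.Weight × State k => N.gradQ v.2 a v.1 :=
  (contDiff_gradQ hN a).continuous

theorem hasGradientAt_Q (hN : N.AllActivations fun σ => ContDiff ℝ 2 σ) (x : State k) (a : A)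
    (w : N.Weight) : HasGradientAt (fun w => N.Q x a w) (N.gradQ x a w) w :=
  ((contDiff_Q_weight hN x a).differentiable (by norm_num) w).hasGradientAt

omit [Fintype A] in
/-- The network output is bounded by a multiple of the weights that leave the output layer. -/
theorem abs_Q_le_sum {B : ℝ} (hB : ∀ a m s, |N.outAct a m s| ≤ B) (x : State k) (a : A)
    (w : N.Weight) : |N.Q x a w| ≤ ∑ m, B * |w (Sum.inr (Sum.inr ⟨a, m⟩))| := by
  refine (Finset.abs_sum_le_sum_abs _ _).trans (Finset.sum_le_sum fun m _ => ?_)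
  rw [abs_mul]
  exact mul_le_mul_of_nonneg_right (hB _ _ _) (abs_nonneg _)

theorem exists_abs_Q_le (hN : N.AllActivations fun σ => Bornology.IsBounded (range σ)) :
    ∃ C, 0 ≤ C ∧ ∀ x a (w : N.Weight), |N.Q x a w| ≤ C * ‖w‖ := by
  obtain ⟨B, hB0, hB⟩ := exists_abs_outAct_le hN
  refine ⟨∑ a, (N.outWidth a : ℝ) * B, Finset.sum_nonneg fun a _ => by positivity,
    fun x a w => (abs_Q_le_sum hB x a w).trans ?_⟩
  calc ∑ m, B * |w (Sum.inr (Sum.inr ⟨a, m⟩))| ≤ ∑ _m : Fin (N.outWidth a), B * ‖w‖ :=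
        Finset.sum_le_sum fun m _ =>
          mul_le_mul_of_nonneg_left (PiLp.norm_apply_le w _) hB0
    _ = (N.outWidth a * B) * ‖w‖ := by simp [mul_assoc]
    _ ≤ _ := mul_le_mul_of_nonneg_right
        (Finset.single_le_sum (f := fun a => (N.outWidth a : ℝ) * B)
          (fun a _ => by positivity) (Finset.mem_univ a)) (norm_nonneg _)

/-! ### The greedy value -/

theorem continuous_Q (hN : N.AllActivations fun σ => ContDiff ℝ 2 σ) (a : A) :
    Continuous fun v : N.Weight × State k => N.Q v.2 a v.1 :=
  (contDiff_Q hN a).continuous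

variable [Nonempty A]

theorem continuous_maxQ (hN : N.AllActivations fun σ => ContDiff ℝ 2 σ) :
    Continuous fun v : N.Weight × State k => N.maxQ v.2 v.1 := by
  simp only [maxQ, ← Finset.sup'_univ_eq_ciSup]
  exact Continuous.finset_sup'_apply _ fun a _ => continuous_Q hN a

theorem abs_maxQ_sub_maxQ_le {x x' : State k} {w w' : N.Weight} {c : ℝ}
    (h : ∀ a, |N.Q x a w - N.Q x' a w'| ≤ c) : |N.maxQ x w - N.maxQ x' w'| ≤ c := by
  have key : ∀ {x x' : State k} {w w' : N.Weight}, (∀ a, |N.Q x a w - N.Q x' a w'| ≤ c) →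
      N.maxQ x w - N.maxQ x' w' ≤ c := by
    intro x x' w w' h
    rw [sub_le_iff_le_add]
    refine ciSup_le fun a => ?_
    have h1 : N.Q x' a w' ≤ N.maxQ x' w' :=
      le_ciSup (f := fun a => N.Q x' a w') (finite_range _).bddAbove a
    linarith [(abs_le.1 (h a)).2]
  refine abs_sub_le_iff.2 ⟨key h, key fun a => ?_⟩
  rw [abs_sub_comm]
  exact h a

theorem abs_maxQ_le {x : State k} {w : N.Weight} {c : ℝ} (h : ∀ a, |N.Q x a w| ≤ c) :
    |N.maxQ x w| ≤ c := by
  refine abs_le.2 ⟨?_, ciSup_le fun a => (abs_le.1 (h a)).2⟩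
  obtain ⟨a⟩ := ‹Nonempty A›
  exact (abs_le.1 (h a)).1.trans (le_ciSup (f := fun a => N.Q x a w) (finite_range _).bddAbove a)

theorem continuous_maxQ_state (hN : N.AllActivations fun σ => ContDiff ℝ 2 σ) (w : N.Weight) :
    Continuous fun y => N.maxQ y w := by
  have h := (continuous_maxQ hN).comp (Continuous.prodMk_right w)
  exact h

theorem integrable_maxQ (hsquash : N.AllActivations fun σ => Bornology.IsBounded (range σ))
    (hN : N.AllActivations fun σ => ContDiff ℝ 2 σ) (w : N.Weight) (μ : Measure (State k))
    [IsFiniteMeasure μ] : Integrable (fun y => N.maxQ y w) μ := by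
  obtain ⟨C, -, hC⟩ := exists_abs_Q_le hsquash
  exact Integrable.of_bound (continuous_maxQ_state hN w).aestronglyMeasurable (C * ‖w‖)
    (ae_of_all _ fun y => abs_maxQ_le fun a => hC y a w)

/-! ### The loss gradient -/

variable [MeasurableSpace A] {p : Kernel (State k × A) (State k)} [IsMarkovKernel p]
  {r : State k → A → ℝ} {α : ℝ}

/-- Joint continuity in the weights and the state of the expected greedy value. The measures
`p(· | x, a) ⊗ δ_w` depend continuously on `(w, x)`, and the greedy value is bounded when `w`
stays in a ball. -/
theorem continuous_integral_maxQ
    (hsquash : N.AllActivations fun σ => Bornology.IsBounded (range σ))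
    (hN : N.AllActivations fun σ => ContDiff ℝ 2 σ) (hp : WeaklyContinuous p) (a : A) :
    Continuous fun v : N.Weight × State k => ∫ y, N.maxQ y v.1 ∂(p (v.2, a)) := by
  obtain ⟨C, hC0, hC⟩ := exists_abs_Q_le hsquash
  refine continuous_iff_continuousAt.2 fun v₀ => ?_
  set c : ℝ := C * (‖v₀.1‖ + 1) with hc
  have hc0 : 0 ≤ c := by positivity
  have hmax : Continuous fun u : State k × N.Weight => N.maxQ u.1 u.2 := by
    have h := (continuous_maxQ hN).comp (continuous_swap (X := State k) (Y := N.Weight))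
    exact h
  let G : BoundedContinuousFunction (State k × N.Weight) ℝ :=
    BoundedContinuousFunction.ofNormedAddCommGroup
      (fun u => max (-c) (min c (N.maxQ u.1 u.2)))
      (continuous_const.max (continuous_const.min hmax)) c (fun u => by
          rw [Real.norm_eq_abs, abs_le]
          exact ⟨le_max_left _ _, max_le (by linarith) (min_le_left _ _)⟩)
  let Φ : N.Weight × State k → ProbabilityMeasure (State k × N.Weight) := fun v =>
    ProbabilityMeasure.prod ⟨p (v.2, a), inferInstance⟩ (diracProba v.1)
  have hΦ : Continuous Φ :=
    ProbabilityMeasure.continuous_prod.comp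
      (((hp a).comp continuous_snd).prodMk (continuous_diracProba.comp continuous_fst))
  have hcont : Continuous fun v => ∫ u, G u ∂(Φ v : Measure (State k × N.Weight)) :=
    (ProbabilityMeasure.continuous_integral_boundedContinuousFunction (f := G)).comp hΦ
  refine hcont.continuousAt.congr ?_
  have hball : ∀ᶠ v : N.Weight × State k in 𝓝 v₀, ‖v.1‖ < ‖v₀.1‖ + 1 :=
    (continuous_fst.norm.tendsto v₀).eventually_lt_const (by simp)
  filter_upwards [hball] with v hv
  have h1 : (Φ v : Measure (State k × N.Weight)) = (p (v.2, a)).prod (Measure.dirac v.1) := rfl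
  rw [h1, Measure.prod_dirac, integral_map (by fun_prop) G.continuous.aestronglyMeasurable]
  refine integral_congr_ae (ae_of_all _ fun y => ?_)
  have h2 : |N.maxQ y v.1| ≤ c := abs_maxQ_le fun a => (hC y a v.1).trans
    (mul_le_mul_of_nonneg_left hv.le hC0)
  change max (-c) (min c (N.maxQ y v.1)) = _
  rw [min_eq_right (abs_le.1 h2).2, max_eq_right (abs_le.1 h2).1]

theorem continuous_tdError (hsquash : N.AllActivations fun σ => Bornology.IsBounded (range σ))
    (hN : N.AllActivations fun σ => ContDiff ℝ 2 σ) (hp : WeaklyContinuous p)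
    (hr : ∀ a, Continuous fun x => r x a) (a : A) :
    Continuous fun v : N.Weight × State k =>
      r v.2 a + α * ∫ y, N.maxQ y v.1 ∂(p (v.2, a)) - N.Q v.2 a v.1 :=
  (((hr a).comp continuous_snd).add
    (continuous_const.mul (continuous_integral_maxQ hsquash hN hp a))).sub (continuous_Q hN a)

theorem continuous_lossGrad (hsquash : N.AllActivations fun σ => Bornology.IsBounded (range σ))
    (hN : N.AllActivations fun σ => ContDiff ℝ 2 σ) (hp : WeaklyContinuous p)
    (hr : ∀ a, Continuous fun x => r x a) (a : A) :
    Continuous fun v : N.Weight × State k => N.lossGrad p r α v.1 v.2 a :=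
  (continuous_tdError hsquash hN hp hr a).smul (continuous_gradQ hN a)

omit [Nonempty A] [MeasurableSpace A] in
/-- A function of weight, state and action that is continuous in the weight and the state is
bounded on bounded sets. -/
theorem exists_norm_le_of_continuous {F : Type*} [NormedAddCommGroup F]
    {f : N.Weight → State k → A → F}
    (hf : ∀ a, Continuous fun v : N.Weight × State k => f v.1 v.2 a) (ρ R : ℝ) :
    ∃ C, 0 ≤ C ∧ ∀ w x a, ‖w‖ ≤ ρ → ‖x‖ ≤ R → ‖f w x a‖ ≤ C := by
  have hK : IsCompact (Metric.closedBall (0 : N.Weight) ρ ×ˢ Metric.closedBall (0 : State k) R) :=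
    (isCompact_closedBall _ _).prod (isCompact_closedBall _ _)
  choose c hc using fun a => hK.exists_bound_of_continuousOn (hf a).continuousOn
  obtain ⟨C, hC⟩ := (finite_range c).bddAbove
  refine ⟨max C 0, le_max_right _ _, fun w x a hw hx => ?_⟩
  exact (hc a (w, x) ⟨by simpa using hw, by simpa using hx⟩).trans
    ((hC (mem_range_self a)).trans (le_max_left _ _))

theorem exists_norm_lossGrad_le
    (hsquash : N.AllActivations fun σ => Bornology.IsBounded (range σ))
    (hN : N.AllActivations fun σ => ContDiff ℝ 2 σ) (hp : WeaklyContinuous p)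
    (hr : ∀ a, Continuous fun x => r x a) (ρ R : ℝ) :
    ∃ C, 0 ≤ C ∧ ∀ (w : N.Weight) x a, ‖w‖ ≤ ρ → ‖x‖ ≤ R → ‖N.lossGrad p r α w x a‖ ≤ C :=
  exists_norm_le_of_continuous (continuous_lossGrad hsquash hN hp hr) ρ R

omit [Nonempty A] [MeasurableSpace A] in
theorem exists_norm_sub_le_of_contDiff {F : Type*} [NormedAddCommGroup F] [NormedSpace ℝ F]
    {f : N.Weight → State k → A → F}
    (hf : ∀ a, ContDiff ℝ 1 fun v : N.Weight × State k => f v.1 v.2 a) (ρ R : ℝ) :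
    ∃ L, 0 ≤ L ∧ ∀ w w' x a, ‖w‖ ≤ ρ → ‖w'‖ ≤ ρ → ‖x‖ ≤ R →
      ‖f w x a - f w' x a‖ ≤ L * ‖w - w'‖ := by
  have hcv : Convex ℝ
      (Metric.closedBall (0 : N.Weight) ρ ×ˢ Metric.closedBall (0 : State k) R) :=
    (convex_closedBall _ _).prod (convex_closedBall _ _)
  have hK : IsCompact (Metric.closedBall (0 : N.Weight) ρ ×ˢ Metric.closedBall (0 : State k) R) :=
    (isCompact_closedBall _ _).prod (isCompact_closedBall _ _)
  choose c hc using fun a => hK.exists_bound_of_continuousOn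
    ((hf a).continuous_fderiv (by norm_num)).continuousOn
  obtain ⟨C, hC⟩ := (finite_range c).bddAbove
  refine ⟨max C 0, le_max_right _ _, fun w w' x a hw hw' hx => ?_⟩
  have h := hcv.norm_image_sub_le_of_norm_fderiv_le (𝕜 := ℝ)
    (fun v _ => (hf a).differentiable (by norm_num) v)
    (fun v hv => (hc a v hv).trans ((hC (mem_range_self a)).trans (le_max_left C 0)))
    (x := (w', x)) (y := (w, x)) ⟨by simpa using hw', by simpa using hx⟩
    ⟨by simpa using hw, by simpa using hx⟩
  simpa [Prod.norm_def] using h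

omit [MeasurableSpace A] in
/-- The greedy value need not be Lipschitz in the weights uniformly in the state. Its expectation
under a kernel is Lipschitz up to an error that is proportional to the mass of the kernel outside
a given ball. -/
theorem exists_abs_integral_maxQ_sub_le
    (hsquash : N.AllActivations fun σ => Bornology.IsBounded (range σ))
    (hN : N.AllActivations fun σ => ContDiff ℝ 2 σ) (ρ R : ℝ) :
    ∃ L C, 0 ≤ L ∧ 0 ≤ C ∧ ∀ (μ : Measure (State k)) [IsProbabilityMeasure μ] (w w' : N.Weight),
      ‖w‖ ≤ ρ → ‖w'‖ ≤ ρ →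
      |∫ y, N.maxQ y w ∂μ - ∫ y, N.maxQ y w' ∂μ| ≤
        L * ‖w - w'‖ + C * μ.real (Metric.closedBall 0 R)ᶜ := by
  obtain ⟨C, hC0, hC⟩ := exists_abs_Q_le hsquash
  obtain ⟨L, hL0, hL⟩ := exists_norm_sub_le_of_contDiff (N := N)
    (f := fun w x a => N.Q x a w) (fun a => (contDiff_Q hN a).of_le (by norm_num)) ρ R
  refine ⟨L, 2 * C * |ρ|, hL0, by positivity, fun μ _ w w' hw hw' => ?_⟩
  have hs : MeasurableSet (Metric.closedBall (0 : State k) R)ᶜ := measurableSet_closedBall.compl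
  rw [← integral_sub (integrable_maxQ hsquash hN w μ) (integrable_maxQ hsquash hN w' μ)]
  have hint : Integrable (fun y => L * ‖w - w'‖ +
      (Metric.closedBall (0 : State k) R)ᶜ.indicator (fun _ => 2 * C * |ρ|) y) μ :=
    (integrable_const _).add ((integrable_const _).indicator hs)
  have h1 := norm_integral_le_of_norm_le hint (f := fun y => N.maxQ y w - N.maxQ y w')
    (ae_of_all _ fun y => ?_)
  · rw [integral_add (integrable_const _) ((integrable_const _).indicator hs),
      integral_indicator_const _ hs] at h1
    simpa [mul_comm] using h1
  · rw [Real.norm_eq_abs]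
    by_cases hy : ‖y‖ ≤ R
    · rw [indicator_of_notMem (by simpa using hy), add_zero]
      exact abs_maxQ_sub_maxQ_le fun a => hL w w' y a hw hw' hy
    · rw [indicator_of_mem (by simpa using hy)]
      have h2 : |N.maxQ y w| ≤ C * |ρ| := abs_maxQ_le fun a => (hC y a w).trans
        (mul_le_mul_of_nonneg_left (hw.trans (le_abs_self _)) hC0)
      have h3 : |N.maxQ y w'| ≤ C * |ρ| := abs_maxQ_le fun a => (hC y a w').trans
        (mul_le_mul_of_nonneg_left (hw'.trans (le_abs_self _)) hC0)
      have h4 : 0 ≤ L * ‖w - w'‖ := by positivity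
      have := abs_sub (N.maxQ y w) (N.maxQ y w')
      linarith

/-- On bounded sets the loss gradient is Lipschitz in the weights up to an error that is proportional
to the probability of leaving a ball. -/
theorem exists_norm_lossGrad_sub_le
    (hsquash : N.AllActivations fun σ => Bornology.IsBounded (range σ))
    (hN : N.AllActivations fun σ => ContDiff ℝ 2 σ) (hp : WeaklyContinuous p)
    (hr : ∀ a, Continuous fun x => r x a) (ρ R : ℝ) :
    ∃ L C, 0 ≤ L ∧ 0 ≤ C ∧ ∀ (w w' : N.Weight) x a, ‖w‖ ≤ ρ → ‖w'‖ ≤ ρ → ‖x‖ ≤ R →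
      ‖N.lossGrad p r α w x a - N.lossGrad p r α w' x a‖ ≤
        L * ‖w - w'‖ + C * (p (x, a)).real (Metric.closedBall 0 R)ᶜ := by
  obtain ⟨L₁, C₁, hL₁, hC₁, h₁⟩ := exists_abs_integral_maxQ_sub_le hsquash hN ρ R
  obtain ⟨L₂, hL₂, h₂⟩ := exists_norm_sub_le_of_contDiff (N := N)
    (f := fun w x a => N.Q x a w) (fun a => (contDiff_Q hN a).of_le (by norm_num)) ρ R
  obtain ⟨L₃, hL₃, h₃⟩ := exists_norm_sub_le_of_contDiff (N := N)
    (f := fun w x a => N.gradQ x a w) (contDiff_gradQ hN) ρ R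
  obtain ⟨G, hG, hGb⟩ := exists_norm_le_of_continuous (N := N)
    (f := fun w x a => N.gradQ x a w) (continuous_gradQ hN) ρ R
  obtain ⟨D, hD, hDb⟩ := exists_norm_le_of_continuous (N := N)
    (f := fun w x a => r x a + α * ∫ y, N.maxQ y w ∂(p (x, a)) - N.Q x a w)
    (continuous_tdError hsquash hN hp hr) ρ R
  refine ⟨(|α| * L₁ + L₂) * G + D * L₃, |α| * C₁ * G, by positivity, by positivity,
    fun w w' x a hw hw' hx => ?_⟩
  set g := fun w : N.Weight => r x a + α * ∫ y, N.maxQ y w ∂(p (x, a)) - N.Q x a w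
  have hsplit : N.lossGrad p r α w x a - N.lossGrad p r α w' x a =
      (g w - g w') • N.gradQ x a w + g w' • (N.gradQ x a w - N.gradQ x a w') := by
    simp only [lossGrad, g]
    module
  set t := (p (x, a)).real (Metric.closedBall 0 R)ᶜ
  have ht : 0 ≤ t := measureReal_nonneg
  have hg : ‖g w - g w'‖ ≤ (|α| * L₁ + L₂) * ‖w - w'‖ + |α| * C₁ * t := by
    have e : g w - g w' = α * (∫ y, N.maxQ y w ∂(p (x, a)) - ∫ y, N.maxQ y w' ∂(p (x, a)))
        - (N.Q x a w - N.Q x a w') := by simp only [g]; ring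
    rw [e]
    refine (norm_sub_le _ _).trans ?_
    rw [norm_mul, Real.norm_eq_abs, Real.norm_eq_abs]
    have e1 := mul_le_mul_of_nonneg_left (h₁ (p (x, a)) w w' hw hw') (abs_nonneg α)
    have e2 := h₂ w w' x a hw hw' hx
    calc _ ≤ |α| * (L₁ * ‖w - w'‖ + C₁ * t) + L₂ * ‖w - w'‖ := add_le_add e1 e2
      _ = _ := by ring
  rw [hsplit]
  refine (norm_add_le _ _).trans ?_
  rw [norm_smul, norm_smul]
  have e1 : ‖g w - g w'‖ * ‖N.gradQ x a w‖ ≤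
      ((|α| * L₁ + L₂) * ‖w - w'‖ + |α| * C₁ * t) * G :=
    mul_le_mul hg (hGb w x a hw hx) (norm_nonneg _) (by positivity)
  have e2 : ‖g w'‖ * ‖N.gradQ x a w - N.gradQ x a w'‖ ≤ D * (L₃ * ‖w - w'‖) :=
    mul_le_mul (hDb w' x a hw' hx) (h₃ w w' x a hw hw' hx) (norm_nonneg _) hD
  calc _ ≤ _ := add_le_add e1 e2
    _ = _ := by ring

end DeepQ.Network

namespace DeepQ

/-! ### Martingale noise -/

section MartingaleSeries

variable {Ω : Type*} {mΩ : MeasurableSpace Ω} {P : Measure Ω} [IsProbabilityMeasure P]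

/-- A series of bounded martingale differences with square summable coefficients converges almost
surely: the increments are orthogonal, so the partial sums form an `L²`-bounded martingale. -/
theorem ae_exists_tendsto_sum_of_condExp_eq_zero {ℱ : Filtration ℕ mΩ} {ξ : ℕ → Ω → ℝ}
    (hξ : ∀ n, StronglyMeasurable[ℱ (n + 1)] (ξ n)) {C : ℝ} (hC : ∀ n ω, |ξ n ω| ≤ C)
    (hzero : ∀ n, P[ξ n | ℱ n] =ᵐ[P] 0) {γ : ℕ → ℝ} (hγ : Summable fun n => γ n ^ 2) :
    ∀ᵐ ω ∂P, ∃ l, Tendsto (fun n => ∑ m ∈ Finset.range n, γ m * ξ m ω) atTop (𝓝 l) := by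
  set M : ℕ → Ω → ℝ := fun n ω => ∑ m ∈ Finset.range n, γ m * ξ m ω with hM
  have hMsucc : ∀ n ω, M (n + 1) ω = M n ω + γ n * ξ n ω := fun n ω => Finset.sum_range_succ _ _
  have hξm : ∀ n, StronglyMeasurable (ξ n) := fun n => (hξ n).mono (ℱ.le _)
  have hξi : ∀ n, Integrable (ξ n) P := fun n =>
    Integrable.of_bound (hξm n).aestronglyMeasurable C (ae_of_all _ (hC n))
  have hMm : ∀ n, StronglyMeasurable[ℱ n] (M n) := fun n =>
    Finset.stronglyMeasurable_fun_sum _ fun m hm =>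
      ((hξ m).mono (ℱ.mono (Nat.succ_le_of_lt (Finset.mem_range.1 hm)))).const_mul (γ m)
  have hMb : ∀ n, ∃ K, ∀ ω, |M n ω| ≤ K := fun n =>
    ⟨∑ m ∈ Finset.range n, |γ m| * C, fun ω => (Finset.abs_sum_le_sum_abs _ _).trans
      (Finset.sum_le_sum fun m _ => by
        rw [abs_mul]; exact mul_le_mul_of_nonneg_left (hC m ω) (abs_nonneg _))⟩
  choose K hK using hMb
  have hMm' : ∀ n, StronglyMeasurable (M n) := fun n => (hMm n).mono (ℱ.le _)
  have hMi : ∀ n, Integrable (M n) P := fun n =>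
    Integrable.of_bound (hMm' n).aestronglyMeasurable (K n) (ae_of_all _ (hK n))
  have hMξi : ∀ n, Integrable (M n * ξ n) P := fun n =>
    (hξi n).bdd_mul (hMm' n).aestronglyMeasurable (ae_of_all _ (hK n))
  have hM2i : ∀ n, Integrable (fun ω => M n ω ^ 2) P := fun n => by
    simp only [pow_two]
    exact (hMi n).bdd_mul (hMm' n).aestronglyMeasurable (ae_of_all _ (hK n))
  have hξ2i : ∀ n, Integrable (fun ω => ξ n ω ^ 2) P := fun n => by
    simp only [pow_two]
    exact (hξi n).bdd_mul (hξm n).aestronglyMeasurable (ae_of_all _ (hC n))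
  have hmart : Martingale M ℱ P := by
    refine martingale_of_condExp_sub_eq_zero_nat hMm hMi fun n => ?_
    have e : M (n + 1) - M n = γ n • ξ n := by
      ext ω; simp [hMsucc]
    rw [e]
    filter_upwards [condExp_smul (μ := P) (m := ℱ n) (γ n) (ξ n), hzero n] with ω h1 h2
    rw [h1, Pi.smul_apply, h2, Pi.zero_apply, smul_zero]
  have horth : ∀ n, ∫ ω, M n ω * ξ n ω ∂P = 0 := fun n => by
    have h1 : P[M n * ξ n | ℱ n] =ᵐ[P] 0 := by
      filter_upwards [condExp_mul_of_stronglyMeasurable_left (hMm n) (hMξi n) (hξi n), hzero n]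
        with ω h1 h2
      rw [h1, Pi.mul_apply, h2, Pi.zero_apply, mul_zero]
    have h2 := integral_condExp (μ := P) (ℱ.le n) (f := M n * ξ n)
    rw [integral_congr_ae h1] at h2
    simpa using h2.symm
  have hC2 : ∀ n, ∫ ω, ξ n ω ^ 2 ∂P ≤ C ^ 2 := fun n => by
    have h := integral_mono (hξ2i n) (integrable_const (C ^ 2)) fun ω =>
      sq_le_sq' (abs_le.1 (hC n ω)).1 (abs_le.1 (hC n ω)).2
    simpa using h
  have hL2 : ∀ n, ∫ ω, M n ω ^ 2 ∂P ≤ ∑ m ∈ Finset.range n, γ m ^ 2 * C ^ 2 := fun n => by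
    induction n with
    | zero => simp [hM]
    | succ n ih =>
      have e : ∀ ω, M (n + 1) ω ^ 2 =
          M n ω ^ 2 + (2 * γ n) * (M n ω * ξ n ω) + γ n ^ 2 * ξ n ω ^ 2 := fun ω => by
        rw [hMsucc]; ring
      have i1 : Integrable (fun ω => (2 * γ n) * (M n ω * ξ n ω)) P := (hMξi n).const_mul _
      have i2 : Integrable (fun ω => M n ω ^ 2 + (2 * γ n) * (M n ω * ξ n ω)) P := (hM2i n).add i1
      simp only [e]
      rw [integral_add i2 ((hξ2i n).const_mul _), integral_add (hM2i n) i1,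
        integral_const_mul, integral_const_mul, horth, mul_zero, add_zero,
        Finset.sum_range_succ]
      exact add_le_add ih (mul_le_mul_of_nonneg_left (hC2 n) (sq_nonneg _))
  set S : ℝ := 1 + ∑' m, γ m ^ 2 * C ^ 2 with hS
  have hS0 : 0 ≤ S := add_nonneg zero_le_one (tsum_nonneg fun m => by positivity)
  have hbdd : ∀ n, eLpNorm (M n) 1 P ≤ (S.toNNReal : ℝ≥0∞) := fun n => by
    rw [eLpNorm_one_eq_lintegral_enorm, ← ofReal_integral_norm_eq_lintegral_enorm (hMi n)]
    refine ENNReal.ofReal_le_ofReal ?_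
    calc ∫ ω, ‖M n ω‖ ∂P ≤ ∫ ω, (1 + M n ω ^ 2) ∂P := by
          refine integral_mono (hMi n).norm ((integrable_const _).add (hM2i n)) fun ω => ?_
          change |M n ω| ≤ 1 + M n ω ^ 2
          nlinarith [sq_abs (M n ω), sq_nonneg (|M n ω| - 1), abs_nonneg (M n ω)]
      _ = 1 + ∫ ω, M n ω ^ 2 ∂P := by
          rw [integral_add (integrable_const _) (hM2i n)]; simp
      _ ≤ S := by
          refine add_le_add le_rfl ((hL2 n).trans ?_)
          exact (hγ.mul_right _).sum_le_tsum _ fun m _ => by positivity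
  filter_upwards [hmart.submartingale.ae_tendsto_limitProcess hbdd] with ω hω
  exact ⟨_, hω⟩

end MartingaleSeries

section Transition

variable {Ω X A E : Type*} {mΩ : MeasurableSpace Ω} [MeasurableSpace X] [MeasurableSpace A]
  [MeasurableSpace E] {P : Measure Ω} [IsProbabilityMeasure P]
  {x : ℕ → Ω → X} {a : ℕ → Ω → A} {θ : ℕ → Ω → E}

/-- The filtration of the histories. -/
def historyFiltration (hx : ∀ n, Measurable (x n)) (ha : ∀ n, Measurable (a n))
    (hθ : ∀ n, Measurable (θ n)) : Filtration ℕ mΩ where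
  seq := history x a θ
  mono' := fun _ _ h => iSup₂_mono' fun m hm => ⟨m, hm.trans h, le_rfl⟩
  le' := fun _ => iSup₂_le fun m _ => ((hx m).prodMk ((ha m).prodMk (hθ m))).comap_le

theorem measurable_history {m n : ℕ} (h : m ≤ n) :
    Measurable[history x a θ n] fun ω => (x m ω, a m ω, θ m ω) :=
  (comap_measurable _).mono (le_iSup₂_of_le m h le_rfl) le_rfl

variable {p : Kernel (X × A) X}

/-- If the next state has conditional law `p(· | x_n, a_n)` given the history, then conditional
expectations of functions of the present and the next state are integrals against `p`. -/
theorem condExp_next_state [IsMarkovKernel p] (hx : ∀ n, Measurable (x n))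
    (ha : ∀ n, Measurable (a n))
    (hθ : ∀ n, Measurable (θ n)) (n : ℕ)
    (htrans : ∀ B : Set X, MeasurableSet B →
      P[(x (n + 1) ⁻¹' B).indicator (fun _ => (1 : ℝ)) | history x a θ n]
        =ᵐ[P] fun ω => (p (x n ω, a n ω)).real B)
    {f : (X × A × E) × X → ℝ} (hf : Measurable f) {C : ℝ} (hC : ∀ z, |f z| ≤ C) :
    P[fun ω => f ((x n ω, a n ω, θ n ω), x (n + 1) ω) | history x a θ n]
      =ᵐ[P] fun ω => ∫ y, f ((x n ω, a n ω, θ n ω), y) ∂(p (x n ω, a n ω)) := by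
  have hle : history x a θ n ≤ mΩ := (historyFiltration hx ha hθ).le n
  set H : Ω → X × A × E := fun ω => (x n ω, a n ω, θ n ω) with hH
  have hHm : Measurable[history x a θ n] H := measurable_history le_rfl
  have hHm' : Measurable H := hHm.mono hle le_rfl
  let κ : Kernel (X × A × E) X :=
    p.comap (fun h => (h.1, h.2.1)) (measurable_fst.prodMk (measurable_fst.comp measurable_snd))
  have hκ : ∀ ω, κ (H ω) = p (x n ω, a n ω) := fun ω => rfl
  have hfi : ∀ (μ : Measure ((X × A × E) × X)) [IsFiniteMeasure μ], Integrable f μ := fun μ _ =>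
    Integrable.of_bound hf.aestronglyMeasurable C (ae_of_all _ hC)
  have hgm : StronglyMeasurable fun h => ∫ y, f (h, y) ∂(κ h) :=
    hf.stronglyMeasurable.integral_kernel_prod_right'
  have hgm' : StronglyMeasurable[history x a θ n] fun ω => ∫ y, f (H ω, y) ∂(κ (H ω)) :=
    hgm.comp_measurable hHm
  have hgb : ∀ h, ‖∫ y, f (h, y) ∂(κ h)‖ ≤ C := fun h => by
    refine (norm_integral_le_of_norm_le (integrable_const C) (ae_of_all _ fun y => hC _)).trans ?_
    simp
  refine (ae_eq_condExp_of_forall_setIntegral_eq hle ?_ ?_ ?_ hgm'.aestronglyMeasurable).symm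
  · exact Integrable.of_bound
      (hf.comp (hHm'.prodMk (hx (n + 1)))).aestronglyMeasurable C (ae_of_all _ fun ω => hC _)
  · intro G _ _
    exact (Integrable.of_bound (hgm'.mono hle).aestronglyMeasurable C
      (ae_of_all _ fun ω => hgb _)).integrableOn
  · intro G hG _
    -- On `G`, the joint law of the present and the next state is a composition product.
    have hlaw : (P.restrict G).map (fun ω => (H ω, x (n + 1) ω)) =
        ((P.restrict G).map H) ⊗ₘ κ := by
      refine Measure.ext_prod fun {S B} hS hB => ?_
      have hSG : MeasurableSet[history x a θ n] (H ⁻¹' S ∩ G) := (hHm hS).inter hG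
      have hSG' : MeasurableSet (H ⁻¹' S ∩ G) := hle _ hSG
      rw [Measure.map_apply (hHm'.prodMk (hx (n + 1))) (hS.prod hB),
        Measure.compProd_apply_prod hS hB, ← lintegral_indicator hS,
        lintegral_map ((κ.measurable_coe hB).indicator hS) hHm',
        Measure.restrict_apply ((hHm'.prodMk (hx (n + 1))) (hS.prod hB))]
      have e1 : (fun ω => (H ω, x (n + 1) ω)) ⁻¹' S ×ˢ B ∩ G =
          x (n + 1) ⁻¹' B ∩ (H ⁻¹' S ∩ G) := by
        ext ω
        simp only [mem_inter_iff, mem_preimage, mem_prod]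
        tauto
      have e2 : ∫⁻ ω in G, S.indicator (fun h => κ h B) (H ω) ∂P =
          ∫⁻ ω in H ⁻¹' S ∩ G, p (x n ω, a n ω) B ∂P := by
        rw [← Measure.restrict_restrict (hHm' hS), ← lintegral_indicator (hHm' hS)]
        rfl
      have hpm : Measurable fun ω => p (x n ω, a n ω) B :=
        (p.measurable_coe hB).comp ((hx n).prodMk (ha n))
      rw [e1, e2, ← ENNReal.toReal_eq_toReal_iff' (measure_ne_top _ _)
        ((lintegral_mono fun ω => prob_le_one).trans_lt (by simp)).ne,
        ← integral_toReal hpm.aemeasurable (ae_of_all _ fun ω => measure_lt_top _ _)]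
      calc (P (x (n + 1) ⁻¹' B ∩ (H ⁻¹' S ∩ G))).toReal
          = ∫ ω in H ⁻¹' S ∩ G, (x (n + 1) ⁻¹' B).indicator (fun _ => (1 : ℝ)) ω ∂P := by
            rw [integral_indicator_const _ (hx (n + 1) hB), measureReal_def,
              Measure.restrict_apply (hx (n + 1) hB)]
            simp
        _ = ∫ ω in H ⁻¹' S ∩ G,
              (P[(x (n + 1) ⁻¹' B).indicator (fun _ => (1 : ℝ)) | history x a θ n]) ω ∂P :=
            (setIntegral_condExp hle ((integrable_const _).indicator (hx (n + 1) hB)) hSG).symm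
        _ = _ := integral_congr_ae (ae_restrict_of_ae (htrans B hB))
    calc ∫ ω in G, ∫ y, f (H ω, y) ∂(p (x n ω, a n ω)) ∂P
        = ∫ h, ∫ y, f (h, y) ∂(κ h) ∂((P.restrict G).map H) :=
          (integral_map hHm'.aemeasurable hgm.aestronglyMeasurable).symm
      _ = ∫ z, f z ∂(((P.restrict G).map H) ⊗ₘ κ) := (Measure.integral_compProd (hfi _)).symm
      _ = ∫ ω in G, f (H ω, x (n + 1) ω) ∂P := by
          rw [← hlaw, integral_map (hHm'.prodMk (hx (n + 1))).aemeasurable hf.aestronglyMeasurable]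

/-- By Lévy's conditional Borel–Cantelli lemma, if the states stay in `K`, then the transition
probabilities out of `K` tend to zero along the trajectory. -/
theorem ae_tendsto_kernel_compl (hx : ∀ n, Measurable (x n)) (ha : ∀ n, Measurable (a n))
    (hθ : ∀ n, Measurable (θ n))
    (htrans : ∀ n, ∀ B : Set X, MeasurableSet B →
      P[(x (n + 1) ⁻¹' B).indicator (fun _ => (1 : ℝ)) | history x a θ n]
        =ᵐ[P] fun ω => (p (x n ω, a n ω)).real B) {K : Set X} (hK : MeasurableSet K) :
    ∀ᵐ ω ∂P, (∀ n, x n ω ∈ K) →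
      Tendsto (fun n => (p (x n ω, a n ω)).real Kᶜ) atTop (𝓝 0) := by
  have h := ae_mem_limsup_atTop_iff (ℱ := historyFiltration hx ha hθ) P
    (s := fun n => x n ⁻¹' Kᶜ)
    (fun n => measurable_fst.comp (measurable_history (x := x) (a := a) (θ := θ) le_rfl) hK.compl)
  filter_upwards [h, ae_all_iff.2 fun n => htrans n Kᶜ hK.compl] with ω hω htr hmem
  have h1 : ω ∉ limsup (fun n => x n ⁻¹' Kᶜ) atTop := by
    rw [mem_limsup_iff_frequently_mem]
    simp [hmem]
  rw [hω] at h1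
  have h2 : Summable fun n => (p (x n ω, a n ω)).real Kᶜ := by
    by_contra hs
    refine h1 ?_
    rw [not_summable_iff_tendsto_nat_atTop_of_nonneg fun n => measureReal_nonneg] at hs
    refine hs.congr fun n => Finset.sum_congr rfl fun m _ => ?_
    exact (htr m).symm
  exact h2.tendsto_atTop_zero

end Transition

/-! ### The noise of deep Q-learning -/

section Noise

variable {k : ℕ} {A : Type*} [Fintype A] [MeasurableSpace A]
  [MeasurableSingletonClass A] {Ω : Type*} {mΩ : MeasurableSpace Ω} {P : Measure Ω}
  [IsProbabilityMeasure P] {N : Network k A} {p : Kernel (State k × A) (State k)}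
  [IsMarkovKernel p] {r : State k → A → ℝ} {α : ℝ}

theorem measurable_of_continuous_weight_state {F : Type*} [TopologicalSpace F]
    [TopologicalSpace.PseudoMetrizableSpace F] [MeasurableSpace F] [BorelSpace F]
    {f : N.Weight → State k → A → F}
    (hf : ∀ a, Continuous fun v : N.Weight × State k => f v.1 v.2 a) :
    Measurable fun h : State k × A × N.Weight => f h.2.2 h.1 h.2.1 := by
  have h1 : Measurable fun q : (N.Weight × State k) × A => f q.1.1 q.1.2 q.2 :=
    measurable_from_prod_countable_left fun a => (hf a).measurable
  exact h1.comp (((measurable_snd.comp measurable_snd).prodMk measurable_fst).prodMk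
    (measurable_fst.comp measurable_snd))

/-- On bounded trajectories the accumulated noise of the iteration converges. -/
theorem ae_exists_tendsto_noise [Nonempty A]
    (hsquash : N.AllActivations fun σ => Bornology.IsBounded (range σ))
    (hN : N.AllActivations fun σ => ContDiff ℝ 2 σ) (hp : WeaklyContinuous p)
    {x : ℕ → Ω → State k} {a : ℕ → Ω → A} {θ : ℕ → Ω → N.Weight}
    (hx : ∀ n, Measurable (x n)) (ha : ∀ n, Measurable (a n)) (hθ : ∀ n, Measurable (θ n))
    (htrans : ∀ n, ∀ B : Set (State k), MeasurableSet B →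
      P[(x (n + 1) ⁻¹' B).indicator (fun _ => (1 : ℝ)) | history x a θ n]
        =ᵐ[P] fun ω => (p (x n ω, a n ω)).real B)
    {γ : ℕ → ℝ} (hγ : Summable fun n => γ n ^ 2) {R : ℝ} (hR : 0 ≤ R) :
    ∀ᵐ ω ∂P, (∀ n, ‖θ n ω‖ ≤ R) → (∀ n, ‖x n ω‖ ≤ R) → ∃ l : N.Weight,
      Tendsto (fun n => ∑ m ∈ Finset.range n,
        γ m • (N.sampledGrad r α (θ m ω) (x m ω) (a m ω) (x (m + 1) ω) -
          N.lossGrad p r α (θ m ω) (x m ω) (a m ω))) atTop (𝓝 l) := by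
  obtain ⟨C, hC0, hC⟩ := Network.exists_abs_Q_le hsquash
  obtain ⟨G, hG, hGb⟩ := Network.exists_norm_le_of_continuous (N := N)
    (f := fun w x a => N.gradQ x a w) (Network.continuous_gradQ hN) R R
  set S : Set (State k × A × N.Weight) := {h | ‖h.2.2‖ ≤ R ∧ ‖h.1‖ ≤ R} with hS
  have hSm : MeasurableSet S :=
    (measurableSet_le (measurable_snd.comp measurable_snd).norm measurable_const).inter
      (measurableSet_le measurable_fst.norm measurable_const)
  have hmaxm : Measurable fun z : (State k × A × N.Weight) × State k =>
      N.maxQ z.2 z.1.2.2 := by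
    have h1 := (Network.continuous_maxQ hN).measurable.comp
      (((measurable_snd.comp measurable_snd).comp measurable_fst).prodMk measurable_snd :
        Measurable fun z : (State k × A × N.Weight) × State k => (z.1.2.2, z.2))
    exact h1
  have hVm : Measurable fun h : State k × A × N.Weight =>
      ∫ y, N.maxQ y h.2.2 ∂(p (h.1, h.2.1)) :=
    measurable_of_continuous_weight_state (N := N)
      (f := fun w x a => ∫ y, N.maxQ y w ∂(p (x, a)))
      (Network.continuous_integral_maxQ hsquash hN hp)
  have hgradm : Measurable fun h : State k × A × N.Weight => N.gradQ h.1 h.2.1 h.2.2 :=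
    measurable_of_continuous_weight_state (N := N)
      (f := fun w x a => N.gradQ x a w) (Network.continuous_gradQ hN)
  -- one coordinate of the noise, truncated to bounded states and weights
  let f : N.Edge → (State k × A × N.Weight) × State k → ℝ := fun e z =>
    S.indicator (fun h => α * (N.gradQ h.1 h.2.1 h.2.2) e) z.1 *
      (N.maxQ z.2 z.1.2.2 - ∫ y, N.maxQ y z.1.2.2 ∂(p (z.1.1, z.1.2.1)))
  have hfm : ∀ e, Measurable (f e) := fun e => by
    have h1 : Measurable fun h : State k × A × N.Weight => (N.gradQ h.1 h.2.1 h.2.2) e :=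
      (EuclideanSpace.proj (𝕜 := ℝ) e).continuous.measurable.comp hgradm
    exact (((h1.const_mul α).indicator hSm).comp measurable_fst).mul
      (hmaxm.sub (hVm.comp measurable_fst))
  have hfb : ∀ e z, |f e z| ≤ (|α| * G) * (C * R + C * R) := fun e z => by
    by_cases hz : z.1 ∈ S
    · have hmax : ∀ y, |N.maxQ y z.1.2.2| ≤ C * R := fun y => Network.abs_maxQ_le fun a =>
        (hC y a _).trans (mul_le_mul_of_nonneg_left hz.1 hC0)
      have hint : |∫ y, N.maxQ y z.1.2.2 ∂(p (z.1.1, z.1.2.1))| ≤ C * R := by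
        have := norm_integral_le_of_norm_le (f := fun y => N.maxQ y z.1.2.2)
          (integrable_const (μ := p (z.1.1, z.1.2.1)) (C * R)) (ae_of_all _ hmax)
        simpa using this
      simp only [f, indicator_of_mem hz, abs_mul]
      have hg : |(N.gradQ z.1.1 z.1.2.1 z.1.2.2) e| ≤ G :=
        (PiLp.norm_apply_le (N.gradQ z.1.1 z.1.2.1 z.1.2.2) e).trans (hGb _ _ _ hz.1 hz.2)
      exact mul_le_mul (mul_le_mul_of_nonneg_left hg (abs_nonneg _))
        ((abs_sub _ _).trans (add_le_add (hmax _) hint)) (abs_nonneg _) (by positivity)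
    · simp only [f, indicator_of_notMem hz, zero_mul, abs_zero]
      positivity
  have hconv : ∀ e, ∀ᵐ ω ∂P, ∃ l, Tendsto (fun n => ∑ m ∈ Finset.range n,
      γ m * f e ((x m ω, a m ω, θ m ω), x (m + 1) ω)) atTop (𝓝 l) := fun e => by
    refine ae_exists_tendsto_sum_of_condExp_eq_zero (ℱ := historyFiltration hx ha hθ)
      (fun n => ?_) (fun n ω => hfb e _) (fun n => ?_) hγ
    · have h1 : Measurable[history x a θ (n + 1)] fun ω => x (n + 1) ω :=
        measurable_fst.comp (measurable_history (x := x) (a := a) (θ := θ) le_rfl)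
      have h2 : Measurable[history x a θ (n + 1)] fun ω => (x n ω, a n ω, θ n ω) :=
        measurable_history (Nat.le_succ n)
      exact ((hfm e).comp (h2.prodMk h1)).stronglyMeasurable
    · filter_upwards [condExp_next_state hx ha hθ n (htrans n) (hfm e) (hfb e)] with ω hω
      refine hω.trans ?_
      simp only [f]
      rw [integral_const_mul, integral_sub (Network.integrable_maxQ hsquash hN _ _)
        (integrable_const _)]
      simp
  filter_upwards [ae_all_iff.2 hconv] with ω hω hθb hxb
  choose l hl using hω
  refine ⟨WithLp.toLp 2 l, ?_⟩
  have h1 := ((PiLp.continuous_toLp 2 (fun _ : N.Edge => ℝ)).tendsto l).comp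
    (tendsto_pi_nhds.2 hl)
  refine h1.congr fun n => ?_
  ext e
  simp only [Function.comp_apply, WithLp.ofLp_sum, Finset.sum_apply]
  refine Finset.sum_congr rfl fun m _ => ?_
  have hmem : (x m ω, a m ω, θ m ω) ∈ S := ⟨hθb m, hxb m⟩
  simp only [f, indicator_of_mem hmem, Network.sampledGrad, Network.lossGrad]
  simp only [PiLp.smul_apply, PiLp.sub_apply, smul_eq_mul]
  ring

end Noise

/-! ### The time axis -/

section TimeAxis

variable {γ : ℕ → ℝ}

theorem stepTime_zero (γ : ℕ → ℝ) : stepTime γ 0 = 0 := Finset.sum_range_zero _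

theorem stepTime_succ (γ : ℕ → ℝ) (n : ℕ) : stepTime γ (n + 1) = stepTime γ n + γ n :=
  Finset.sum_range_succ _ _

namespace IsStepSize

theorem strictMono (hγ : IsStepSize γ) : StrictMono (stepTime γ) :=
  strictMono_nat_of_lt_succ fun n => by rw [stepTime_succ]; linarith [hγ.pos n]

theorem stepTime_nonneg (hγ : IsStepSize γ) (n : ℕ) : 0 ≤ stepTime γ n :=
  Finset.sum_nonneg fun m _ => (hγ.pos m).le

theorem tendsto_stepTime (hγ : IsStepSize γ) : Tendsto (stepTime γ) atTop atTop :=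
  (not_summable_iff_tendsto_nat_atTop_of_nonneg fun n => (hγ.pos n).le).1 hγ.not_summable

theorem tendsto_zero (hγ : IsStepSize γ) : Tendsto γ atTop (𝓝 0) := by
  have h := hγ.summable_sq.tendsto_atTop_zero.sqrt
  simpa [Real.sqrt_sq_eq_abs, abs_of_pos (hγ.pos _)] using h

theorem stepIndex_eq (hγ : IsStepSize γ) {n : ℕ} {t : ℝ}
    (ht : t ∈ Ico (stepTime γ n) (stepTime γ (n + 1))) : stepIndex γ t = n := by
  have h : {m | stepTime γ m ≤ t} = Iic n := by
    ext m
    refine ⟨fun hm => ?_, fun hm => (hγ.strictMono.monotone hm).trans ht.1⟩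
    exact Nat.lt_succ_iff.1 (hγ.strictMono.lt_iff_lt.1 (lt_of_le_of_lt hm ht.2))
  rw [stepIndex, h, csSup_Iic]

theorem exists_mem_Ico (hγ : IsStepSize γ) {t : ℝ} (ht : 0 ≤ t) :
    ∃ n, t ∈ Ico (stepTime γ n) (stepTime γ (n + 1)) := by
  classical
  have hex : ∃ n, t < stepTime γ n := (hγ.tendsto_stepTime.eventually_gt_atTop t).exists
  have h0 : Nat.find hex ≠ 0 := fun h => by
    have := Nat.find_spec hex
    rw [h, stepTime_zero] at this
    exact absurd this (not_lt.2 ht)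
  obtain ⟨m, hm⟩ := Nat.exists_eq_succ_of_ne_zero h0
  refine ⟨m, not_lt.1 (Nat.find_min hex (by omega)), ?_⟩
  rw [← Nat.succ_eq_add_one, ← hm]
  exact Nat.find_spec hex

theorem mem_Ico_stepIndex (hγ : IsStepSize γ) {t : ℝ} (ht : 0 ≤ t) :
    t ∈ Ico (stepTime γ (stepIndex γ t)) (stepTime γ (stepIndex γ t + 1)) := by
  obtain ⟨n, hn⟩ := hγ.exists_mem_Ico ht
  rwa [hγ.stepIndex_eq hn]

theorem le_stepIndex (hγ : IsStepSize γ) {n : ℕ} {t : ℝ} (ht : stepTime γ n ≤ t) :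
    n ≤ stepIndex γ t :=
  Nat.lt_succ_iff.1 (hγ.strictMono.lt_iff_lt.1
    (ht.trans_lt (hγ.mem_Ico_stepIndex ((hγ.stepTime_nonneg n).trans ht)).2))

theorem stepIndex_ae_eq {E : Type*} (hγ : IsStepSize γ) (f : ℕ → ℝ → E) {j : ℕ} {t : ℝ}
    (ht : t ∈ Icc (stepTime γ j) (stepTime γ (j + 1))) :
    (fun u => f (stepIndex γ u) u) =ᵐ[volume.restrict (uIoc (stepTime γ j) t)] f j := by
  have h1 : ∀ᵐ u ∂(volume : Measure ℝ), u ≠ stepTime γ (j + 1) := by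
    simp [ae_iff]
  rw [EventuallyEq, ae_restrict_iff' measurableSet_uIoc]
  filter_upwards [h1] with u hu hmem
  rw [uIoc_of_le ht.1] at hmem
  rw [hγ.stepIndex_eq ⟨hmem.1.le, lt_of_le_of_ne (hmem.2.trans ht.2) hu⟩]

theorem intervalIntegrable_of_forall_piece {E : Type*} [NormedAddCommGroup E]
    (hγ : IsStepSize γ) {D : ℝ → E}
    (hD : ∀ j, IntervalIntegrable D volume (stepTime γ j) (stepTime γ (j + 1))) {s t : ℝ}
    (hs : 0 ≤ s) (ht : 0 ≤ t) : IntervalIntegrable D volume s t := by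
  obtain ⟨n, hn⟩ := (hγ.tendsto_stepTime.eventually_ge_atTop (max s t)).exists
  have h := IntervalIntegrable.trans_iterate (n := n) fun j _ => hD j
  refine h.mono_set ?_
  rw [stepTime_zero, uIcc_of_le (hγ.stepTime_nonneg n)]
  exact fun u hu => ⟨(le_min hs ht).trans hu.1, hu.2.trans hn⟩

variable {E : Type*} [NormedAddCommGroup E] [NormedSpace ℝ E]

/-- Indefinite integrals over the intervals `[t_j, t_{j+1}]` combine to an indefinite integral
over `[0, ∞)`. -/
theorem eq_add_integral_of_forall_piece (hγ : IsStepSize γ) {D Y : ℝ → E}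
    (hD : ∀ j, IntervalIntegrable D volume (stepTime γ j) (stepTime γ (j + 1)))
    (hY : ∀ j, ∀ t ∈ Icc (stepTime γ j) (stepTime γ (j + 1)),
      Y t = Y (stepTime γ j) + ∫ u in stepTime γ j..t, D u) {t : ℝ} (ht : 0 ≤ t) :
    Y t = Y 0 + ∫ u in (0 : ℝ)..t, D u := by
  have hint : ∀ {s t : ℝ}, 0 ≤ s → 0 ≤ t → IntervalIntegrable D volume s t :=
    fun hs ht => hγ.intervalIntegrable_of_forall_piece hD hs ht
  have hj : ∀ j, Y (stepTime γ j) = Y 0 + ∫ u in (0 : ℝ)..stepTime γ j, D u := fun j => by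
    induction j with
    | zero => simp [stepTime_zero]
    | succ j ih =>
      rw [hY j _ ⟨hγ.strictMono.monotone (Nat.le_succ j), le_rfl⟩, ih, add_assoc,
        intervalIntegral.integral_add_adjacent_intervals
          (hint le_rfl (hγ.stepTime_nonneg j)) (hD j)]
  obtain ⟨n, hn⟩ := hγ.exists_mem_Ico ht
  rw [hY n t ⟨hn.1, hn.2.le⟩, hj, add_assoc, intervalIntegral.integral_add_adjacent_intervals
    (hint le_rfl (hγ.stepTime_nonneg n)) (hint (hγ.stepTime_nonneg n) ht)]

theorem interpolate_eq (hγ : IsStepSize γ) (w : ℕ → E) {n : ℕ} {t : ℝ}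
    (ht : t ∈ Ico (stepTime γ n) (stepTime γ (n + 1))) :
    interpolate γ w t = w n + ((t - stepTime γ n) / γ n) • (w (n + 1) - w n) := by
  rw [interpolate, hγ.stepIndex_eq ht]

theorem interpolate_stepTime (hγ : IsStepSize γ) (w : ℕ → E) (n : ℕ) :
    interpolate γ w (stepTime γ n) = w n := by
  rw [hγ.interpolate_eq w ⟨le_rfl, hγ.strictMono (Nat.lt_succ_self n)⟩]
  simp

theorem interpolate_eq_add_integral (hγ : IsStepSize γ) [CompleteSpace E] {v c : ℕ → E}
    (hv : ∀ j, v (j + 1) = v j + γ j • c j) {t : ℝ} (ht : 0 ≤ t) :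
    interpolate γ v t = v 0 + ∫ u in (0 : ℝ)..t, c (stepIndex γ u) := by
  have key := hγ.eq_add_integral_of_forall_piece (Y := interpolate γ v)
    (D := fun u => c (stepIndex γ u)) (fun j => ?_) (fun j t ht => ?_) ht
  · rw [key, ← stepTime_zero γ, hγ.interpolate_stepTime]
  · have h := hγ.stepIndex_ae_eq (fun j _ => c j) (j := j)
      ⟨hγ.strictMono.monotone (Nat.le_succ j), le_rfl⟩
    exact (intervalIntegrable_congr_ae h).2 intervalIntegrable_const
  · have h := hγ.stepIndex_ae_eq (fun j _ => c j) ht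
    rw [intervalIntegral.integral_congr_ae_restrict h, intervalIntegral.integral_const,
      hγ.interpolate_stepTime]
    rcases ht.2.lt_or_eq with h1 | h1
    · rw [hγ.interpolate_eq v ⟨ht.1, h1⟩, hv, add_sub_cancel_left, smul_smul,
        div_mul_cancel₀ _ (hγ.pos j).ne']
    · rw [h1, hγ.interpolate_stepTime, hv, stepTime_succ, add_sub_cancel_left]

end IsStepSize

end TimeAxis

/-! ### Tracking -/

section Tracking

/-- **Grönwall's inequality**, integral form. -/
theorem le_mul_exp_of_le_add_integral {φ : ℝ → ℝ} (hφ : Continuous φ) {K L t : ℝ} (hL : 0 ≤ L)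
    (ht : 0 ≤ t) (h : ∀ s ∈ Icc 0 t, φ s ≤ K + L * ∫ u in (0 : ℝ)..s, φ u) :
    φ t ≤ K * Real.exp (L * t) := by
  have hder : ∀ s, HasDerivAt (fun s => K + L * ∫ u in (0 : ℝ)..s, φ u) (L * φ s) s := fun s =>
    ((intervalIntegral.integral_hasDerivAt_right (hφ.intervalIntegrable _ _)
      hφ.stronglyMeasurable.stronglyMeasurableAtFilter hφ.continuousAt).const_mul L).const_add K
  have := le_gronwallBound_of_liminf_deriv_right_le
    (f := fun s => K + L * ∫ u in (0 : ℝ)..s, φ u) (f' := fun s => L * φ s)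
    (δ := K) (K := L) (ε := 0) (a := 0) (b := t)
    (fun s _ => (hder s).continuousAt.continuousWithinAt)
    (fun s _ _ hr => (hder s).hasDerivWithinAt.liminf_right_slope_le hr)
    (by simp)
    (fun s hs => by
      rw [add_zero]
      exact mul_le_mul_of_nonneg_left (h s ⟨hs.1, hs.2.le⟩) hL) t ⟨ht, le_rfl⟩
  rw [gronwallBound_ε0, sub_zero] at this
  exact (h t ⟨ht, le_rfl⟩).trans this

/-- Grönwall's inequality when the integral inequality is known only as long as the function is
at most one, but implies a smaller bound. -/
theorem le_mul_exp_of_le_add_integral_of_le_one {φ : ℝ → ℝ} (hφ : Continuous φ) (hφ0 : φ 0 = 0)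
    {K L T : ℝ} (hK : 0 ≤ K) (hL : 0 ≤ L) (hsmall : K * Real.exp (L * T) < 1)
    (h : ∀ t ∈ Icc 0 T, (∀ s ∈ Icc 0 t, φ s ≤ 1) → φ t ≤ K + L * ∫ s in (0 : ℝ)..t, φ s) :
    ∀ t ∈ Icc 0 T, φ t ≤ K * Real.exp (L * T) := by
  have hgron : ∀ t ∈ Icc 0 T, (∀ s ∈ Icc 0 t, φ s ≤ 1) → φ t ≤ K * Real.exp (L * T) :=
    fun t ht h1 => (le_mul_exp_of_le_add_integral hφ hL ht.1 fun s hs =>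
      h s ⟨hs.1, hs.2.trans ht.2⟩ fun u hu => h1 u ⟨hu.1, hu.2.trans hs.2⟩).trans
        (mul_le_mul_of_nonneg_left
          (Real.exp_le_exp.2 (mul_le_mul_of_nonneg_left ht.2 hL)) hK)
  have hlt : ∀ t ∈ Icc 0 T, φ t < 1 := by
    by_contra! hcon
    set S : Set ℝ := {t | t ∈ Icc 0 T ∧ 1 ≤ φ t} with hS
    have hSc : IsClosed S := isClosed_Icc.inter (isClosed_le continuous_const hφ)
    have hSb : BddBelow S := ⟨0, fun t ht => ht.1.1⟩
    have hτ : sInf S ∈ S := hSc.csInf_mem hcon hSb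
    have hbelow : ∀ s, 0 ≤ s → s < sInf S → φ s < 1 := fun s h0 hs => by
      by_contra! h1
      exact absurd (csInf_le hSb ⟨⟨h0, hs.le.trans hτ.1.2⟩, h1⟩) (not_le.2 hs)
    have hpos : 0 < sInf S := by
      refine lt_of_le_of_ne hτ.1.1 fun h0 => ?_
      have := hτ.2
      rw [← h0, hφ0] at this
      linarith
    have hle : φ (sInf S) ≤ K * Real.exp (L * T) := by
      refine le_of_tendsto (hφ.continuousWithinAt (s := Iio (sInf S)) (x := sInf S)) ?_
      filter_upwards [self_mem_nhdsWithin,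
        mem_nhdsWithin_of_mem_nhds (lt_mem_nhds hpos)] with t ht ht0
      exact hgron t ⟨ht0.le, (le_of_lt ht).trans hτ.1.2⟩
        fun s hs => (hbelow s hs.1 (hs.2.trans_lt ht)).le
    exact absurd (hτ.2.trans hle) (not_le.2 hsmall)
  exact fun t ht => hgron t ht fun s hs => (hlt s ⟨hs.1, hs.2.trans ht.2⟩).le

variable {E : Type*} [NormedAddCommGroup E] [NormedSpace ℝ E] {γ : ℕ → ℝ}

/-- `Θ` is an indefinite integral of `t ↦ f_m(Θ(t))`, where `m` is the index of the step that is
active at time `t_n + t`. -/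
def IsStepSolution (γ : ℕ → ℝ) (f : ℕ → E → E) (n : ℕ) (Θ : ℝ≥0 → E) : Prop :=
  ∀ t : ℝ≥0,
    IntervalIntegrable (fun s : ℝ => f (stepIndex γ (stepTime γ n + s)) (Θ s.toNNReal))
      volume 0 t ∧
    Θ t = Θ 0 + ∫ s in (0 : ℝ)..t, f (stepIndex γ (stepTime γ n + s)) (Θ s.toNNReal)

/-- The stochastic approximation scheme `w_{m+1} = w_m + γ_m (f_m(w_m) + D_m)` with convergent
accumulated noise tracks the solutions of the o.d.e. that start at its iterates, if the vector
fields `f_m` are Lipschitz up to errors that tend to zero. -/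
theorem tendstoUniformlyOn_interpolate_sub [CompleteSpace E] (hγ : IsStepSize γ)
    {f : ℕ → E → E} {w D : ℕ → E}
    (hw : ∀ m, w (m + 1) = w m + γ m • (f m (w m) + D m)) {R : ℝ} (hR : ∀ m, ‖w m‖ ≤ R)
    {l : E} (hD : Tendsto (fun n => ∑ m ∈ Finset.range n, γ m • D m) atTop (𝓝 l))
    {C : ℝ} (hC : ∀ m, ‖f m (w m)‖ ≤ C) {L : ℝ} (hL : 0 ≤ L) {δ : ℕ → ℝ}
    (hδ : Tendsto δ atTop (𝓝 0))
    (hlip : ∀ m θ θ', ‖θ‖ ≤ R + 2 → ‖θ'‖ ≤ R + 2 → ‖f m θ - f m θ'‖ ≤ L * ‖θ - θ'‖ + δ m)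
    {Θ : ℕ → C(ℝ≥0, E)} (hΘ0 : ∀ n, Θ n 0 = w n) (hΘ : ∀ n, IsStepSolution γ f n (Θ n))
    (T : ℝ≥0) :
    TendstoUniformlyOn
      (fun n (t : ℝ≥0) => interpolate γ w (stepTime γ n + t) - Θ n t)
      (fun _ => 0) atTop (Iic T) := by
  set M : ℕ → E := fun n => ∑ m ∈ Finset.range n, γ m • D m with hM
  have hMsucc : ∀ n, M (n + 1) = M n + γ n • D n := fun n => Finset.sum_range_succ _ _
  set v : ℕ → E := fun m => w m - M m with hv
  set c : ℕ → E := fun m => f m (w m) with hc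
  have hvsucc : ∀ j, v (j + 1) = v j + γ j • c j := fun j => by
    simp only [hv, hw, hMsucc, hc, smul_add]; abel
  have hC0 : 0 ≤ C := (norm_nonneg _).trans (hC 0)
  have hcint : ∀ n (a b : ℝ), IntervalIntegrable
      (fun u => c (stepIndex γ (stepTime γ n + u))) volume a b := fun n a b => by
    have hsm : StronglyMeasurable fun u => c (stepIndex γ (stepTime γ n + u)) :=
      (StronglyMeasurable.of_discrete (f := c)).comp_measurable
        ((measurable_stepIndex γ).comp (measurable_const.add measurable_id))
    exact (intervalIntegrable_const (c := C)).mono_fun hsm.aestronglyMeasurable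
      (ae_of_all _ fun u => (hC _).trans (le_abs_self C))
  have hY : ∀ n, ∀ t : ℝ, 0 ≤ t → interpolate γ v (stepTime γ n + t) =
      v n + ∫ u in (0 : ℝ)..t, c (stepIndex γ (stepTime γ n + u)) := fun n t ht => by
    have h0 := hγ.stepTime_nonneg n
    have h1 := hγ.interpolate_eq_add_integral hvsucc (add_nonneg h0 ht)
    have h2 := hγ.interpolate_eq_add_integral hvsucc h0
    have hi : ∀ a b : ℝ, IntervalIntegrable (fun u => c (stepIndex γ u)) volume a b := by
      simpa [stepTime_zero] using hcint 0
    rw [hγ.interpolate_stepTime] at h2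
    rw [h1, h2, add_assoc, ← intervalIntegral.integral_add_adjacent_intervals (hi 0 (stepTime γ n))
      (hi _ _)]
    congr 2
    rw [intervalIntegral.integral_comp_add_left (fun u => c (stepIndex γ u)), add_zero]
  rw [Metric.tendstoUniformlyOn_iff]
  intro ε₀ hε₀
  -- tolerance for the noise, the step sizes and the Lipschitz defect
  set B : ℝ := (L + 1) * T * Real.exp (L * T) with hB
  have hB0 : 0 ≤ B := by positivity
  obtain ⟨ε, hε, hε1, hεB, hεε₀⟩ : ∃ ε : ℝ, 0 < ε ∧ ε ≤ 1 ∧ ε * B < 1 ∧ ε + ε * B < ε₀ := by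
    refine ⟨min 1 (min 1 ε₀ / (2 * (1 + B))), by positivity, min_le_left _ _, ?_, ?_⟩
    · have h1 : min 1 (min 1 ε₀ / (2 * (1 + B))) ≤ 1 / (2 * (1 + B)) :=
        (min_le_right _ _).trans (by gcongr; exact min_le_left _ _)
      calc _ ≤ 1 / (2 * (1 + B)) * B := mul_le_mul_of_nonneg_right h1 hB0
        _ < 1 := by rw [div_mul_eq_mul_div, div_lt_one (by positivity)]; linarith
    · have h1 : min 1 (min 1 ε₀ / (2 * (1 + B))) ≤ ε₀ / (2 * (1 + B)) :=
        (min_le_right _ _).trans (by gcongr; exact min_le_right _ _)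
      have h2 : min 1 (min 1 ε₀ / (2 * (1 + B))) * (1 + B) ≤ ε₀ / 2 := by
        calc _ ≤ ε₀ / (2 * (1 + B)) * (1 + B) := mul_le_mul_of_nonneg_right h1 (by positivity)
          _ = ε₀ / 2 := by field_simp
      linarith
  have hcau := Metric.cauchySeq_iff.1 hD.cauchySeq (ε / 3) (by positivity)
  obtain ⟨n₁, hn₁⟩ := hcau
  have hγC : ∀ᶠ m in atTop, γ m * C < ε / 3 := by
    have := hγ.tendsto_zero.mul_const C
    rw [zero_mul] at this
    exact this.eventually_lt_const (by positivity)
  obtain ⟨n₂, hn₂⟩ := eventually_atTop.1 hγC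
  obtain ⟨n₃, hn₃⟩ := eventually_atTop.1 (hδ.eventually_lt_const hε)
  filter_upwards [eventually_ge_atTop (max n₁ (max n₂ n₃))] with n hn
  have hn1 : n₁ ≤ n := (le_max_left _ _).trans hn
  have hn2 : n₂ ≤ n := (le_max_left _ _).trans ((le_max_right _ _).trans hn)
  have hn3 : n₃ ≤ n := (le_max_right _ _).trans ((le_max_right _ _).trans hn)
  -- the noise-free interpolated iteration
  set y : ℝ → E := fun t => w n + ∫ u in (0 : ℝ)..t, c (stepIndex γ (stepTime γ n + u)) with hy
  have hyv : ∀ t, 0 ≤ t → y t = interpolate γ v (stepTime γ n + t) + M n := fun t ht => by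
    rw [hY n t ht]; simp only [hy, hv]; abel
  have hMle : ∀ m, n ≤ m → ‖M m - M n‖ ≤ ε / 3 := fun m hm => by
    rw [← dist_eq_norm]
    exact (hn₁ m (hn1.trans hm) n hn1).le
  have herr : ∀ t : ℝ, 0 ≤ t →
      ‖interpolate γ w (stepTime γ n + t) - y t‖ ≤ ε ∧
      ‖w (stepIndex γ (stepTime γ n + t)) - y t‖ ≤ ε := fun t ht => by
    set m := stepIndex γ (stepTime γ n + t) with hm
    have hge : stepTime γ n ≤ stepTime γ n + t := by linarith
    have hnm : n ≤ m := hγ.le_stepIndex hge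
    have hmem := hγ.mem_Ico_stepIndex ((hγ.stepTime_nonneg n).trans hge)
    rw [← hm] at hmem
    set q : ℝ := (stepTime γ n + t - stepTime γ m) / γ m with hq
    have hq0 : 0 ≤ q := div_nonneg (by linarith [hmem.1]) (hγ.pos m).le
    have hq1 : q ≤ 1 := by
      rw [hq, div_le_one (hγ.pos m)]
      have := hmem.2
      rw [stepTime_succ] at this
      linarith
    have e1 := hMle m hnm
    have e2 := hMle (m + 1) (hnm.trans (Nat.le_succ m))
    rw [hyv t ht, hγ.interpolate_eq w hmem, hγ.interpolate_eq v hmem, ← hq]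
    constructor
    · have : w m + q • (w (m + 1) - w m) - (v m + q • (v (m + 1) - v m) + M n) =
          (M m - M n) + q • ((M (m + 1) - M n) - (M m - M n)) := by
        simp only [hv]; module
      rw [this]
      refine (norm_add_le _ _).trans ?_
      rw [norm_smul, Real.norm_of_nonneg hq0]
      have e3 := norm_sub_le (M (m + 1) - M n) (M m - M n)
      have e4 : q * ‖(M (m + 1) - M n) - (M m - M n)‖ ≤
          1 * ‖(M (m + 1) - M n) - (M m - M n)‖ :=
        mul_le_mul_of_nonneg_right hq1 (norm_nonneg _)
      linarith
    · have : w m - (v m + q • (v (m + 1) - v m) + M n) = (M m - M n) - q • (γ m • c m) := by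
        rw [hvsucc, add_sub_cancel_left]; simp only [hv]; abel
      rw [this]
      refine (norm_sub_le _ _).trans ?_
      rw [norm_smul, norm_smul, Real.norm_of_nonneg hq0, Real.norm_of_nonneg (hγ.pos m).le]
      have e3 : γ m * ‖c m‖ ≤ γ m * C := mul_le_mul_of_nonneg_left (hC m) (hγ.pos m).le
      have e4 : q * (γ m * ‖c m‖) ≤ 1 * (γ m * ‖c m‖) :=
        mul_le_mul_of_nonneg_right hq1 (mul_nonneg (hγ.pos m).le (norm_nonneg _))
      have e5 := hn₂ m (hn2.trans hnm)
      linarith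
  -- the distance between the solution and the noise-free iteration
  have hycont : Continuous y :=
    continuous_const.add (intervalIntegral.continuous_primitive (hcint n) 0)
  set d : ℝ → E := fun t => Θ n t.toNNReal - y t with hd
  have hdcont : Continuous d :=
    ((Θ n).continuous.comp continuous_real_toNNReal).sub hycont
  have hd0 : d 0 = 0 := by simp [hd, hy, hΘ0]
  have hdle : ∀ t ∈ Icc (0 : ℝ) T, ‖d t‖ ≤ (ε * ((L + 1) * T)) * Real.exp (L * T) := by
    refine le_mul_exp_of_le_add_integral_of_le_one hdcont.norm (by simp [hd0]) (by positivity) hL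
      (by rw [mul_assoc]; exact hεB) fun t ht hle => ?_
    have hdt : d t = ∫ s in (0 : ℝ)..t, (f (stepIndex γ (stepTime γ n + s)) (Θ n s.toNNReal) -
        c (stepIndex γ (stepTime γ n + s))) := by
      have h1 := hΘ n t.toNNReal
      rw [Real.coe_toNNReal t ht.1] at h1
      rw [intervalIntegral.integral_sub h1.1 (hcint n _ _)]
      simp only [hd, hy]
      rw [h1.2, hΘ0]
      abel
    have hbound : ∀ s ∈ Ioc (0 : ℝ) t,
        ‖f (stepIndex γ (stepTime γ n + s)) (Θ n s.toNNReal) -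
          c (stepIndex γ (stepTime γ n + s))‖ ≤ L * ‖d s‖ + ε * (L + 1) := fun s hs => by
      set m := stepIndex γ (stepTime γ n + s) with hm
      have hnm : n ≤ m := hγ.le_stepIndex (by linarith [hs.1])
      have e1 := (herr s hs.1.le).2
      rw [← hm] at e1
      have e2 : ‖Θ n s.toNNReal - w m‖ ≤ ‖d s‖ + ε := by
        have : Θ n s.toNNReal - w m = d s - (w m - y s) := by simp only [hd]; abel
        rw [this]
        exact (norm_sub_le _ _).trans (add_le_add le_rfl e1)
      have e3 : ‖Θ n s.toNNReal‖ ≤ R + 2 := by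
        have h1 : Θ n s.toNNReal = (Θ n s.toNNReal - w m) + w m := by abel
        rw [h1]
        have h2 := norm_add_le (Θ n s.toNNReal - w m) (w m)
        have h3 := hle s ⟨hs.1.le, hs.2⟩
        linarith [hR m]
      refine (hlip m _ _ e3 ((hR m).trans (by linarith))).trans ?_
      have e4 := hn₃ m (hn3.trans hnm)
      have e5 := mul_le_mul_of_nonneg_left e2 hL
      nlinarith
    rw [hdt]
    have hi1 : IntervalIntegrable (fun s => L * ‖d s‖) volume 0 t :=
      (continuous_const.mul hdcont.norm).intervalIntegrable _ _
    have hint : IntervalIntegrable (fun s => L * ‖d s‖ + ε * (L + 1)) volume 0 t :=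
      hi1.add intervalIntegrable_const
    refine (intervalIntegral.norm_integral_le_of_norm_le ht.1
      (ae_of_all _ hbound) hint).trans ?_
    rw [intervalIntegral.integral_add hi1 intervalIntegrable_const,
      intervalIntegral.integral_const_mul, intervalIntegral.integral_const, sub_zero, smul_eq_mul]
    have : t * (ε * (L + 1)) ≤ T * (ε * (L + 1)) :=
      mul_le_mul_of_nonneg_right ht.2 (by positivity)
    linarith
  intro t ht
  rw [dist_eq_norm, zero_sub, norm_neg]
  have e1 := (herr t t.2).1
  have e2 := hdle t ⟨t.2, ht⟩
  have e3 : interpolate γ w (stepTime γ n + t) - Θ n t =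
      (interpolate γ w (stepTime γ n + t) - y t) - d t := by
    simp only [hd, Real.toNNReal_coe]; abel
  rw [e3]
  refine (norm_sub_le _ _).trans_lt ?_
  have e4 : (ε * ((L + 1) * T)) * Real.exp (L * T) = ε * B := by rw [hB]; ring
  rw [e4] at e2
  have e2' : ‖d (t : ℝ)‖ ≤ ε * B := e2
  linarith

end Tracking

/-! ### Scalar autonomous differential equations -/

section ScalarODE

/-- Separation of variables for `τ' = h(τ)` when `h` is bounded and bounded away from zero. -/
theorem exists_hasDerivAt_of_le_of_le {h : ℝ → ℝ} (hc : Continuous h) {ε C : ℝ} (hε : 0 < ε)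
    (hεh : ∀ s, ε ≤ h s) (hC : ∀ s, h s ≤ C) :
    ∃ τ : ℝ → ℝ, (∀ t, ∫ s in (0 : ℝ)..τ t, (h s)⁻¹ = t) ∧ ∀ t, HasDerivAt τ (h (τ t)) t := by
  have hpos : ∀ s, 0 < h s := fun s => hε.trans_le (hεh s)
  have hC0 : 0 < C := (hpos 0).trans_le (hC 0)
  have hci : Continuous fun s => (h s)⁻¹ := hc.inv₀ fun s => (hpos s).ne'
  set T : ℝ → ℝ := fun s => ∫ u in (0 : ℝ)..s, (h u)⁻¹ with hT
  have hder : ∀ s, HasDerivAt T (h s)⁻¹ s := fun s =>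
    intervalIntegral.integral_hasDerivAt_right (hci.intervalIntegrable _ _)
      hci.stronglyMeasurable.stronglyMeasurableAtFilter hci.continuousAt
  have hT0 : T 0 = 0 := intervalIntegral.integral_same
  have hmono : StrictMono T := strictMono_of_hasDerivAt_pos hder fun s => inv_pos.2 (hpos s)
  have hmono' : Monotone fun s => T s - C⁻¹ * s := by
    refine monotone_of_hasDerivAt_nonneg (f' := fun s => (h s)⁻¹ - C⁻¹ * 1)
      (fun s => (hder s).sub ((hasDerivAt_id s).const_mul C⁻¹)) fun s => ?_
    change 0 ≤ (h s)⁻¹ - C⁻¹ * 1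
    rw [mul_one, sub_nonneg]
    exact inv_anti₀ (hpos s) (hC s)
  have hcont : Continuous T := continuous_iff_continuousAt.2 fun s => (hder s).continuousAt
  have htop : Tendsto T atTop atTop := by
    refine tendsto_atTop_mono' _ ?_ (tendsto_id.const_mul_atTop (inv_pos.2 hC0))
    filter_upwards [eventually_ge_atTop 0] with s hs
    have := hmono' hs
    simp only [hT0] at this
    simpa using this
  have hbot : Tendsto T atBot atBot := by
    refine tendsto_atBot_mono' _ ?_ (tendsto_id.const_mul_atBot (inv_pos.2 hC0))
    filter_upwards [eventually_le_atBot 0] with s hs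
    have := hmono' hs
    simp only [hT0] at this
    simpa using this
  let e : ℝ ≃o ℝ := hmono.orderIsoOfSurjective T (hcont.surjective htop hbot)
  have he : ∀ t, T (e.symm t) = t := fun t => e.apply_symm_apply t
  refine ⟨e.symm, he, fun t => ?_⟩
  have := HasDerivAt.of_local_left_inverse (f := T) (g := e.symm) (a := t)
    e.symm.continuous.continuousAt (hder _) (inv_pos.2 (hpos _)).ne'
    (Eventually.of_forall he)
  rwa [inv_inv] at this

/-- For bounded continuous `h ≥ 0` the equation `τ' = h(τ)`, `τ(0) = 0`, has a solution: the
solutions for the right-hand sides `h + ε` decrease to one as `ε` decreases to zero. -/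
theorem exists_eq_integral_of_nonneg {h : ℝ → ℝ} (hc : Continuous h) {C : ℝ} (h0 : ∀ s, 0 ≤ h s)
    (hC : ∀ s, h s ≤ C) :
    ∃ τ : ℝ → ℝ, Continuous τ ∧ ∀ t, 0 ≤ t → τ t = ∫ s in (0 : ℝ)..t, h (τ s) := by
  set ε : ℕ → ℝ := fun n => 1 / ((n : ℝ) + 1) with hε
  have hεpos : ∀ n, 0 < ε n := fun n => by positivity
  have hεle : ∀ n, ε n ≤ 1 := fun n => by
    rw [hε]; exact div_le_one_of_le₀ (by linarith [Nat.cast_nonneg (α := ℝ) n]) (by positivity)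
  have hεanti : Antitone ε := fun m n hmn => by
    simp only [hε]
    exact one_div_le_one_div_of_le (by positivity) (by gcongr)
  have hc' : ∀ n, Continuous fun s => h s + ε n := fun n => hc.add continuous_const
  choose τ hT hder using fun n => exists_hasDerivAt_of_le_of_le (hc' n) (hεpos n)
    (fun s => le_add_of_nonneg_left (h0 s)) fun s => add_le_add (hC s) (hεle n)
  have hτcont : ∀ n, Continuous (τ n) := fun n =>
    continuous_iff_continuousAt.2 fun s => (hder n s).continuousAt
  have hτ0 : ∀ n, τ n 0 = 0 := fun n => by
    have hpos : ∀ s, 0 < (h s + ε n)⁻¹ := fun s =>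
      inv_pos.2 (add_pos_of_nonneg_of_pos (h0 s) (hεpos n))
    have hi : ∀ a b : ℝ, IntervalIntegrable (fun s => (h s + ε n)⁻¹) volume a b := fun a b =>
      ((hc' n).inv₀ fun s => (inv_pos.1 (hpos s)).ne').intervalIntegrable _ _
    rcases lt_trichotomy (τ n 0) 0 with hlt | heq | hgt
    · have h1 := intervalIntegral.intervalIntegral_pos_of_pos (hi _ _) hpos hlt
      rw [intervalIntegral.integral_symm, hT] at h1
      simp at h1
    · exact heq
    · have h1 := intervalIntegral.intervalIntegral_pos_of_pos (hi _ _) hpos hgt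
      rw [hT] at h1
      exact absurd h1 (lt_irrefl _)
  have hint : ∀ n t, τ n t = ∫ s in (0 : ℝ)..t, (h (τ n s) + ε n) := fun n t => by
    have := intervalIntegral.integral_eq_sub_of_hasDerivAt (a := 0) (b := t)
      (fun s _ => hder n s) (((hc' n).comp (hτcont n)).intervalIntegrable _ _)
    rw [hτ0, sub_zero] at this
    exact this.symm
  have hnonneg : ∀ n t, 0 ≤ t → 0 ≤ τ n t := fun n t ht => by
    rw [hint]
    exact intervalIntegral.integral_nonneg ht fun s _ => add_nonneg (h0 _) (hεpos n).le
  -- the solution with the larger `ε` reaches any given point earlier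
  have hanti : ∀ t, 0 ≤ t → Antitone fun n => τ n t := fun t ht m n hmn => by
    by_contra! hlt
    have hpos : ∀ k s, 0 < h s + ε k := fun k s => add_pos_of_nonneg_of_pos (h0 s) (hεpos k)
    have hi : ∀ k (a b : ℝ), IntervalIntegrable (fun s => (h s + ε k)⁻¹) volume a b :=
      fun k a b => ((hc' k).inv₀ fun s => (hpos k s).ne').intervalIntegrable _ _
    have h1 : ∫ s in (0 : ℝ)..τ m t, (h s + ε m)⁻¹ ≤ ∫ s in (0 : ℝ)..τ m t, (h s + ε n)⁻¹ :=
      intervalIntegral.integral_mono_on (hnonneg m t ht) (hi _ _ _) (hi _ _ _) fun s _ =>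
        inv_anti₀ (hpos n s) (add_le_add le_rfl (hεanti hmn))
    have h2 := intervalIntegral.integral_add_adjacent_intervals (hi n 0 (τ m t)) (hi n _ (τ n t))
    have h3 := intervalIntegral.intervalIntegral_pos_of_pos (hi n _ _)
      (fun s => inv_pos.2 (hpos n s)) hlt
    rw [hT] at h1 h2
    linarith
  set τ' : ℝ → ℝ := fun t => ⨅ n, τ n (max t 0) with hτ'
  have hlim : ∀ t, Tendsto (fun n => τ n (max t 0)) atTop (𝓝 (τ' t)) := fun t =>
    tendsto_atTop_ciInf (hanti _ (le_max_right _ _))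
      ⟨0, by rintro _ ⟨n, rfl⟩; exact hnonneg n _ (le_max_right _ _)⟩
  have hlimt : ∀ t, 0 ≤ t → Tendsto (fun n => τ n t) atTop (𝓝 (τ' t)) := fun t ht => by
    simpa [max_eq_left ht] using hlim t
  have hε0 : Tendsto ε atTop (𝓝 0) := tendsto_one_div_add_atTop_nhds_zero_nat
  have heq : ∀ t, 0 ≤ t → τ' t = ∫ s in (0 : ℝ)..t, h (τ' s) := fun t ht => by
    refine tendsto_nhds_unique (hlimt t ht) ?_
    rw [show (fun n => τ n t) = fun n => ∫ s in (0 : ℝ)..t, (h (τ n s) + ε n) from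
      funext fun n => hint n t]
    refine intervalIntegral.tendsto_integral_filter_of_dominated_convergence (fun _ => C + 1)
      (Eventually.of_forall fun n => ((hc' n).comp (hτcont n)).aestronglyMeasurable)
      (Eventually.of_forall fun n => ae_of_all _ fun s _ => ?_) intervalIntegrable_const
      (ae_of_all _ fun s hs => ?_)
    · rw [Real.norm_of_nonneg (add_nonneg (h0 _) (hεpos n).le)]
      exact add_le_add (hC _) (hεle n)
    · rw [uIoc_of_le ht] at hs
      have := ((hc.tendsto _).comp (hlimt s hs.1.le)).add hε0
      rwa [add_zero] at this
  refine ⟨τ', ?_, heq⟩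
  have hC0 : 0 ≤ C := (h0 0).trans (hC 0)
  have hlip : LipschitzWith (C + 1).toNNReal τ' := by
    refine LipschitzWith.of_dist_le_mul fun s t => ?_
    rw [Real.coe_toNNReal _ (by linarith)]
    refine le_of_tendsto ((hlim s).dist (hlim t)) (Eventually.of_forall fun n => ?_)
    have h1 : ‖τ n (max s 0) - τ n (max t 0)‖ ≤ (C + 1) * ‖max s 0 - max t 0‖ :=
      convex_univ.norm_image_sub_le_of_norm_hasDerivWithin_le
        (fun u _ => (hder n u).hasDerivWithinAt) (fun u _ => by
          rw [Real.norm_of_nonneg (add_nonneg (h0 _) (hεpos n).le)]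
          exact add_le_add (hC _) (hεle n)) (mem_univ _) (mem_univ _)
    rw [dist_eq_norm, dist_eq_norm]
    refine h1.trans (mul_le_mul_of_nonneg_left ?_ (by linarith))
    exact abs_max_sub_max_le_abs s t 0
  exact hlip.continuous

/-- Peano's theorem for bounded scalar autonomous equations. A solution of `τ' = h⁺(τ)` never
enters the set where `h` is negative when it does not start in it. -/
theorem exists_eq_integral_comp {h : ℝ → ℝ} (hc : Continuous h) {C : ℝ} (hC : ∀ s, |h s| ≤ C) :
    ∃ τ : ℝ → ℝ, Continuous τ ∧ ∀ t, 0 ≤ t → τ t = ∫ s in (0 : ℝ)..t, h (τ s) := by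
  have key : ∀ {h : ℝ → ℝ}, Continuous h → (∀ s, |h s| ≤ C) → 0 ≤ h 0 →
      ∃ τ : ℝ → ℝ, Continuous τ ∧ ∀ t, 0 ≤ t → τ t = ∫ s in (0 : ℝ)..t, h (τ s) := by
    intro h hc hC h0
    have hC0 : 0 ≤ C := (abs_nonneg _).trans (hC 0)
    have hpc : Continuous fun s => max (h s) 0 := hc.max continuous_const
    obtain ⟨τ, hτc, hτ⟩ := exists_eq_integral_of_nonneg hpc (fun s => le_max_right _ _)
      fun s => max_le ((le_abs_self _).trans (hC s)) hC0
    have hτ0 : τ 0 = 0 := by rw [hτ 0 le_rfl, intervalIntegral.integral_same]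
    have hi : ∀ a b : ℝ, IntervalIntegrable (fun s => max (h (τ s)) 0) volume a b :=
      fun a b => (hpc.comp hτc).intervalIntegrable _ _
    have hsign : ∀ t, 0 ≤ t → 0 ≤ h (τ t) := fun t ht => by
      by_contra! hneg
      -- the last time before `t` at which `h ∘ τ` is nonnegative
      set S : Set ℝ := {s | s ∈ Icc 0 t ∧ 0 ≤ h (τ s)} with hS
      have hSc : IsClosed S := isClosed_Icc.inter (isClosed_le continuous_const (hc.comp hτc))
      have hSb : BddAbove S := ⟨t, fun s hs => hs.1.2⟩
      have hSn : S.Nonempty := ⟨0, ⟨le_rfl, ht⟩, by rwa [hτ0]⟩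
      have hmem : sSup S ∈ S := hSc.csSup_mem hSn hSb
      have hzero : ∫ s in sSup S..t, max (h (τ s)) 0 = 0 := by
        refine intervalIntegral.integral_zero_ae (ae_of_all _ fun s hs => ?_)
        rw [uIoc_of_le hmem.1.2] at hs
        refine max_eq_right (le_of_not_ge fun h1 => ?_)
        exact absurd (le_csSup hSb ⟨⟨hmem.1.1.trans hs.1.le, hs.2⟩, h1⟩) (not_le.2 hs.1)
      have h1 := hτ t ht
      rw [← intervalIntegral.integral_add_adjacent_intervals (hi 0 (sSup S)) (hi _ _), hzero,
        add_zero, ← hτ _ hmem.1.1] at h1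
      rw [h1] at hneg
      exact absurd hmem.2 (not_le.2 hneg)
    refine ⟨τ, hτc, fun t ht => (hτ t ht).trans (intervalIntegral.integral_congr fun s hs => ?_)⟩
    rw [uIcc_of_le ht] at hs
    exact max_eq_left (hsign s hs.1)
  rcases le_total 0 (h 0) with h0 | h0
  · exact key hc hC h0
  · obtain ⟨τ, hτc, hτ⟩ := key (h := fun s => -h (-s)) (hc.comp continuous_neg).neg
      (fun s => by rw [abs_neg]; exact hC _) (by simpa using h0)
    refine ⟨fun t => -τ t, hτc.neg, fun t ht => ?_⟩
    have h1 := hτ t ht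
    rw [intervalIntegral.integral_neg] at h1
    simp only [h1, neg_neg]

end ScalarODE

/-! ### Autonomous equations in a gradient direction -/

section GradientDirection

variable {E F : Type*} [NormedAddCommGroup E] [InnerProductSpace ℝ E] [FiniteDimensional ℝ E]
  [NormedAddCommGroup F] [NormedSpace ℝ F]

/-- The gradient flow of `f` exists on every bounded time interval, if `f` is controlled by a
linear image `π w` of its argument along which the gradient is bounded. Indeed, `π w` grows at most
linearly along the flow, so `f` stays bounded, and the length of the flow line is controlled by
the increase of `f`. -/
theorem exists_gradient_flow {f : E → ℝ} {f' : E → E} (hf : ∀ w, HasGradientAt f (f' w) w)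
    (hf' : ContDiff ℝ 1 f') {π : E →L[ℝ] F} {B : ℝ} (hπ : ∀ w, ‖π (f' w)‖ ≤ B)
    (hfπ : ∀ w, |f w| ≤ B * ‖π w‖) (w₀ : E) {M : ℝ} (hM : 0 ≤ M) :
    ∃ u : ℝ → E, u 0 = w₀ ∧
      (∀ t ∈ Icc (-M) M, HasDerivWithinAt u (f' (u t)) (Icc (-M) M) t) ∧
      ∀ t ∈ Icc (-M) M, ‖π (u t)‖ ≤ ‖π w₀‖ + B * |t| := by
  have hB : 0 ≤ B := (norm_nonneg _).trans (hπ 0)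
  have := FiniteDimensional.complete ℝ E
  set K : ℝ := B * (‖π w₀‖ + B * M) with hK
  have hK0 : 0 ≤ K := by positivity
  set R : ℝ := ‖w₀‖ + M + 2 * K + 1 with hR
  have hRpos : 0 < R := by positivity
  let χ : ContDiffBump (0 : E) := ⟨R, R + 1, hRpos, by linarith⟩
  -- the gradient field, cut off outside a ball that the flow cannot leave
  set V : E → E := fun w => χ w • f' w with hV
  have hVc : ContDiff ℝ 1 V := χ.contDiff.smul hf'
  have hVs : HasCompactSupport V := χ.hasCompactSupport.smul_right
  obtain ⟨Lip, hLip⟩ := hVc.lipschitzWith_of_hasCompactSupport hVs (by norm_num)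
  obtain ⟨Bd, hBd⟩ := hVs.exists_bound_of_continuous hVc.continuous
  have hBd0 : 0 ≤ Bd := (norm_nonneg _).trans (hBd 0)
  have hmem0 : (0 : ℝ) ∈ Icc (-M) M := ⟨by linarith, hM⟩
  have hPL : IsPicardLindelof (fun _ => V) (⟨0, hmem0⟩ : Icc (-M) M) w₀
      (Bd.toNNReal * M.toNNReal) 0 Bd.toNNReal Lip := by
    refine IsPicardLindelof.of_time_independent (fun w _ => ?_) hLip.lipschitzOnWith ?_
    · rw [Real.coe_toNNReal _ hBd0]; exact hBd w
    · simp [Real.coe_toNNReal _ hM]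
  obtain ⟨u, hu0, hu⟩ := hPL.exists_eq_forall_mem_Icc_hasDerivWithinAt₀
  simp only at hu0
  have hχ0 : ∀ w, 0 ≤ χ w := fun w => χ.nonneg
  have hχ1 : ∀ w, χ w ≤ 1 := fun w => χ.le_one
  have hπu : ∀ t ∈ Icc (-M) M, ‖π (u t)‖ ≤ ‖π w₀‖ + B * |t| := fun t ht => by
    have h1 := (convex_Icc (-M) M).norm_image_sub_le_of_norm_hasDerivWithin_le
      (f := fun t => π (u t)) (f' := fun t => π (V (u t))) (C := B)
      (fun s hs => π.hasFDerivAt.comp_hasDerivWithinAt s (hu s hs)) (fun s _ => ?_) hmem0 ht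
    · rw [hu0, sub_zero, Real.norm_eq_abs] at h1
      have h2 := norm_add_le (π (u t) - π w₀) (π w₀)
      rw [sub_add_cancel] at h2
      linarith
    · simp only [hV, map_smul, norm_smul, Real.norm_of_nonneg (hχ0 _)]
      exact (mul_le_of_le_one_left (norm_nonneg _) (hχ1 _)).trans (hπ _)
  have hfu : ∀ t ∈ Icc (-M) M, |f (u t)| ≤ K := fun t ht =>
    (hfπ _).trans (mul_le_mul_of_nonneg_left ((hπu t ht).trans
      (add_le_add le_rfl (mul_le_mul_of_nonneg_left (abs_le.2 ht) hB))) hB)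
  -- `‖V‖ ≤ 1 + ⟪∇f, V⟫` bounds the length of the flow line by time plus increase of `f`
  have hlen : ∀ s ∈ Icc (-M) M, ∀ t ∈ Icc (-M) M, s ≤ t → ‖u t - u s‖ ≤ (t - s) + 2 * K := by
    intro s hs t ht hst
    have hsub : ∀ r ∈ Icc s t, r ∈ Icc (-M) M := fun r hr => ⟨hs.1.trans hr.1, hr.2.trans ht.2⟩
    have hder : ∀ r ∈ Icc s t, HasDerivWithinAt u (V (u r)) (Icc s t) r := fun r hr =>
      (hu r (hsub r hr)).mono hsub
    have hder' : ∀ r ∈ Icc s t, HasDerivWithinAt (fun r => (r - s) + (f (u r) - f (u s)))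
        (1 + inner ℝ (f' (u r)) (V (u r))) (Icc s t) r := fun r hr =>
      ((hasDerivWithinAt_id r _).sub_const s).add
        (((hf (u r)).hasFDerivAt.comp_hasDerivWithinAt r (hder r hr)).sub_const _)
    have hIci : ∀ r ∈ Ico s t, Icc s t ∈ 𝓝[≥] r := fun r hr =>
      mem_of_superset (Icc_mem_nhdsGE hr.2) (Icc_subset_Icc_left hr.1)
    have h1 := image_norm_le_of_norm_deriv_right_le_deriv_boundary'
      (f := fun r => u r - u s) (f' := fun r => V (u r))
      (B := fun r => (r - s) + (f (u r) - f (u s)))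
      (B' := fun r => 1 + inner ℝ (f' (u r)) (V (u r)))
      (fun r hr => ((hder r hr).continuousWithinAt.sub continuousWithinAt_const))
      (fun r hr => ((hder r ⟨hr.1, hr.2.le⟩).mono_of_mem_nhdsWithin (hIci r hr)).sub_const _)
      (by simp)
      (fun r hr => (hder' r hr).continuousWithinAt)
      (fun r hr => (hder' r ⟨hr.1, hr.2.le⟩).mono_of_mem_nhdsWithin (hIci r hr))
      (fun r _ => by
        simp only [hV, norm_smul, inner_smul_right, real_inner_self_eq_norm_sq,
          Real.norm_of_nonneg (hχ0 _)]
        nlinarith [hχ0 (u r), hχ1 (u r), sq_nonneg (‖f' (u r)‖ - 1), norm_nonneg (f' (u r)),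
          mul_nonneg (hχ0 (u r)) (sq_nonneg (‖f' (u r)‖ - 1)),
          mul_nonneg (hχ0 (u r)) (sq_nonneg ‖f' (u r)‖)])
      ⟨hst, le_rfl⟩
    have h2 := abs_le.1 (hfu s hs)
    have h3 := abs_le.1 (hfu t ht)
    linarith [h2.1, h3.2]
  have hball : ∀ t ∈ Icc (-M) M, ‖u t‖ ≤ R := fun t ht => by
    have h1 : ‖u t - w₀‖ ≤ M + 2 * K := by
      rw [← hu0]
      rcases le_total 0 t with h0 | h0
      · exact (hlen 0 hmem0 t ht h0).trans (by linarith [ht.2])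
      · rw [norm_sub_rev]
        exact (hlen t ht 0 hmem0 h0).trans (by linarith [ht.1])
    have h2 := norm_add_le (u t - w₀) w₀
    rw [sub_add_cancel] at h2
    linarith
  refine ⟨u, hu0, fun t ht => ?_, hπu⟩
  have h1 : V (u t) = f' (u t) := by
    simp only [hV]
    rw [χ.one_of_mem_closedBall (by simpa using hball t ht), one_smul]
  rw [← h1]
  exact hu t ht

/-- The equation `ϑ' = g(ϑ) ∇f(ϑ)` with merely continuous `g` has global solutions. They are
time changes of the gradient flow of `f`, and the time change solves a scalar equation. -/
theorem exists_eq_add_integral_smul_gradient {f : E → ℝ} {f' : E → E}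
    (hf : ∀ w, HasGradientAt f (f' w) w) (hf' : ContDiff ℝ 1 f') {π : E →L[ℝ] F} {B : ℝ}
    (hπ : ∀ w, ‖π (f' w)‖ ≤ B) (hfπ : ∀ w, |f w| ≤ B * ‖π w‖) {g : E → ℝ} (hg : Continuous g)
    {G : ℝ} (hgπ : ∀ w, |g w| ≤ G * (1 + ‖π w‖)) (w₀ : E) {T : ℝ} (hT : 0 ≤ T) :
    ∃ ϑ : ℝ → E, Continuous ϑ ∧ ϑ 0 = w₀ ∧
      ∀ t ∈ Icc 0 T, ϑ t = w₀ + ∫ s in (0 : ℝ)..t, g (ϑ s) • f' (ϑ s) := by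
  have hB : 0 ≤ B := (norm_nonneg _).trans (hπ 0)
  have hG : 0 ≤ G := by
    have := (abs_nonneg _).trans (hgπ 0)
    simpa using this
  have := FiniteDimensional.complete ℝ E
  set K : ℝ := G * (1 + ‖π w₀‖ + B) with hK
  have hK0 : 0 ≤ K := by positivity
  -- Grönwall's inequality will keep the time change below `M` on `[0, T]`
  set M : ℝ := K * T * Real.exp (K * T) + 1 with hM
  have hM0 : 0 ≤ M := by positivity
  obtain ⟨u, hu0, hu, hπu⟩ := exists_gradient_flow hf hf' hπ hfπ w₀ hM0
  have hle : -M ≤ M := by linarith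
  have hmem0 : (0 : ℝ) ∈ Icc (-M) M := ⟨by linarith, hM0⟩
  -- the flow line, extended to a continuous function on the real line
  set U : ℝ → E := fun t => u (projIcc (-M) M hle t) with hU
  have hUc : Continuous U :=
    ContinuousOn.comp_continuous (fun t ht => (hu t ht).continuousWithinAt)
      (continuous_subtype_val.comp continuous_projIcc) fun t => (projIcc (-M) M hle t).2
  have hUu : ∀ t ∈ Icc (-M) M, U t = u t := fun t ht => by
    simp only [hU, projIcc_of_mem hle ht]
  have hUder : ∀ t ∈ Ioo (-M) M, HasDerivAt U (f' (U t)) t := fun t ht => by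
    have h1 := (hu t ⟨ht.1.le, ht.2.le⟩).hasDerivAt (Icc_mem_nhds ht.1 ht.2)
    rw [hUu t ⟨ht.1.le, ht.2.le⟩]
    refine h1.congr_of_eventuallyEq ?_
    filter_upwards [Icc_mem_nhds ht.1 ht.2] with s hs using hUu s hs
  have hgU : ∀ t, |g (U t)| ≤ K * (1 + |t|) := fun t => by
    refine (hgπ _).trans ?_
    have h1 := hπu _ (projIcc (-M) M hle t).2
    have h2 : |(projIcc (-M) M hle t : ℝ)| ≤ |t| := by
      have := abs_projIcc_sub_projIcc (a := -M) (b := M) (c := t) (d := 0) hle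
      rwa [projIcc_of_mem hle hmem0, sub_zero, sub_zero] at this
    have h3 := mul_le_mul_of_nonneg_left h2 hB
    rw [hK, mul_assoc]
    refine mul_le_mul_of_nonneg_left ?_ hG
    nlinarith [abs_nonneg t, norm_nonneg (π w₀), mul_nonneg (norm_nonneg (π w₀)) (abs_nonneg t)]
  have hgUM : ∀ t, |g (U t)| ≤ K * (1 + M) := fun t => by
    have h1 := hgU (projIcc (-M) M hle t)
    have h2 : U (projIcc (-M) M hle t) = U t := by
      rw [hUu _ (projIcc (-M) M hle t).2]
    rw [h2] at h1
    exact h1.trans (mul_le_mul_of_nonneg_left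
      (add_le_add le_rfl (abs_le.2 (projIcc (-M) M hle t).2)) hK0)
  obtain ⟨τ, hτc, hτ⟩ := exists_eq_integral_comp (hg.comp hUc) hgUM
  have hc : Continuous fun s => g (U (τ s)) := hg.comp (hUc.comp hτc)
  have hτ0 : τ 0 = 0 := by rw [hτ 0 le_rfl, intervalIntegral.integral_same]
  have hτM : ∀ t ∈ Icc 0 T, |τ t| < M := fun t ht => by
    have h1 := le_mul_exp_of_le_add_integral (φ := fun t => |τ t|) hτc.abs (K := K * T) hK0 ht.1
      fun s hs => ?_
    · refine (h1.trans ?_).trans_lt (lt_add_one _)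
      exact mul_le_mul_of_nonneg_left (Real.exp_le_exp.2 (mul_le_mul_of_nonneg_left ht.2 hK0))
        (by positivity)
    · rw [hτ s hs.1]
      have hi1 : IntervalIntegrable (fun u => K * |τ u|) volume 0 s :=
        (continuous_const.mul hτc.abs).intervalIntegrable _ _
      have hi : IntervalIntegrable (fun u => K + K * |τ u|) volume 0 s :=
        intervalIntegrable_const.add hi1
      have h2 := intervalIntegral.norm_integral_le_of_norm_le hs.1
        (f := fun u => g (U (τ u))) (g := fun u => K + K * |τ u|)
        (ae_of_all _ fun u _ => by
          rw [Real.norm_eq_abs]; exact (hgU _).trans (by rw [mul_add, mul_one])) hi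
      rw [intervalIntegral.integral_add intervalIntegrable_const hi1,
        intervalIntegral.integral_const, intervalIntegral.integral_const_mul, sub_zero,
        smul_eq_mul, Real.norm_eq_abs] at h2
      refine h2.trans (add_le_add ?_ le_rfl)
      rw [mul_comm]
      exact mul_le_mul_of_nonneg_left (hs.2.trans ht.2) hK0
  refine ⟨fun t => U (τ t), hUc.comp hτc, by simp only [hτ0]; rw [hUu 0 hmem0, hu0],
    fun t ht => ?_⟩
  have hτder : ∀ s, 0 < s → HasDerivAt τ (g (U (τ s))) s := fun s hs => by
    have h1 : HasDerivAt (fun t => ∫ s in (0 : ℝ)..t, g (U (τ s))) (g (U (τ s))) s :=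
      intervalIntegral.integral_hasDerivAt_right (hc.intervalIntegrable _ _)
        hc.stronglyMeasurable.stronglyMeasurableAtFilter hc.continuousAt
    refine h1.congr_of_eventuallyEq ?_
    filter_upwards [lt_mem_nhds hs] with r hr using hτ r hr.le
  have hcc : Continuous fun s => g (U (τ s)) • f' (U (τ s)) :=
    hc.smul (hf'.continuous.comp (hUc.comp hτc))
  have hmain := intervalIntegral.integral_eq_sub_of_hasDerivAt_of_le ht.1
    (f := fun t => U (τ t)) (f' := fun s => g (U (τ s)) • f' (U (τ s)))
    (hUc.comp hτc).continuousOn (fun s hs => ?_) (hcc.intervalIntegrable _ _)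
  · rw [hmain, hτ0, hUu 0 hmem0, hu0]
    abel
  · exact (hUder (τ s) (abs_lt.1 (hτM s ⟨hs.1.le, hs.2.le.trans ht.2⟩))).scomp s (hτder s hs.1)

end GradientDirection

/-! ### Existence of trajectories -/

section Gluing

variable {E : Type*} [NormedAddCommGroup E] [NormedSpace ℝ E] {γ : ℕ → ℝ}

/-- Solutions of the autonomous equations on the successive steps combine to a trajectory. -/
theorem IsStepSize.exists_isStepSolution_zero (hγ : IsStepSize γ) {f : ℕ → E → E}
    (hf : ∀ m, Continuous (f m))
    (hex : ∀ m w₀, ∃ ϑ : ℝ → E, Continuous ϑ ∧ ϑ 0 = w₀ ∧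
      ∀ t ∈ Icc 0 (γ m), ϑ t = w₀ + ∫ s in (0 : ℝ)..t, f m (ϑ s)) (w₀ : E) :
    ∃ Y : ℝ → E, Y 0 = w₀ ∧ ∀ t, 0 ≤ t →
      IntervalIntegrable (fun s => f (stepIndex γ s) (Y s)) volume 0 t ∧
      Y t = w₀ + ∫ s in (0 : ℝ)..t, f (stepIndex γ s) (Y s) := by
  choose sol hsolc hsol0 hsol using hex
  let W : ℕ → E := fun j => Nat.rec w₀ (fun j w => sol j w (γ j)) j
  have hWsucc : ∀ j, W (j + 1) = sol j (W j) (γ j) := fun j => rfl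
  set Y : ℝ → E := fun t =>
    sol (stepIndex γ t) (W (stepIndex γ t)) (t - stepTime γ (stepIndex γ t)) with hY
  have hYpiece : ∀ j, ∀ t ∈ Icc (stepTime γ j) (stepTime γ (j + 1)),
      Y t = sol j (W j) (t - stepTime γ j) := fun j t ht => by
    rcases ht.2.lt_or_eq with h1 | h1
    · simp only [hY, hγ.stepIndex_eq ⟨ht.1, h1⟩]
    · have h2 : stepIndex γ t = j + 1 :=
        hγ.stepIndex_eq ⟨h1.ge, h1 ▸ hγ.strictMono (Nat.lt_succ_self _)⟩
      simp only [hY, h2]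
      rw [h1, sub_self, hsol0, hWsucc, stepTime_succ, add_sub_cancel_left]
  have hae : ∀ j, ∀ t ∈ Icc (stepTime γ j) (stepTime γ (j + 1)),
      (fun s => f (stepIndex γ s) (Y s)) =ᵐ[volume.restrict (uIoc (stepTime γ j) t)]
        fun s => f j (sol j (W j) (s - stepTime γ j)) := fun j t ht =>
    hγ.stepIndex_ae_eq
      (fun m s => f m (sol m (W m) (s - stepTime γ m))) ht
  have hcont : ∀ j, Continuous fun s => f j (sol j (W j) (s - stepTime γ j)) := fun j =>
    (hf j).comp ((hsolc j _).comp (continuous_id.sub continuous_const))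
  have hD : ∀ j, IntervalIntegrable (fun s => f (stepIndex γ s) (Y s)) volume
      (stepTime γ j) (stepTime γ (j + 1)) := fun j =>
    (intervalIntegrable_congr_ae (hae j _ ⟨hγ.strictMono.monotone (Nat.le_succ j), le_rfl⟩)).2
      ((hcont j).intervalIntegrable _ _)
  have hY0 : Y 0 = w₀ := by
    have := hYpiece 0 (stepTime γ 0) ⟨le_rfl, hγ.strictMono.monotone (Nat.le_succ 0)⟩
    rw [sub_self, hsol0, stepTime_zero] at this
    exact this
  refine ⟨Y, hY0, fun t ht => ⟨hγ.intervalIntegrable_of_forall_piece hD le_rfl ht, ?_⟩⟩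
  have key := hγ.eq_add_integral_of_forall_piece (Y := Y) hD (fun j t ht => ?_) ht
  · rw [key, hY0]
  · have hle : stepTime γ j ≤ stepTime γ (j + 1) := hγ.strictMono.monotone (Nat.le_succ j)
    rw [hYpiece j t ht, hYpiece j _ ⟨le_rfl, hle⟩, sub_self, hsol0,
      intervalIntegral.integral_congr_ae_restrict (hae j t ht),
      intervalIntegral.integral_comp_sub_right (fun s => f j (sol j (W j) s)), sub_self]
    refine hsol j (W j) _ ⟨by linarith [ht.1], ?_⟩
    have := ht.2
    rw [stepTime_succ] at this
    linarith

/-- The same with the clock started at time `t_n`: the vector fields of the earlier steps are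
replaced by zero. -/
theorem IsStepSize.exists_isStepSolution (hγ : IsStepSize γ) {f : ℕ → E → E}
    (hf : ∀ m, Continuous (f m))
    (hex : ∀ m w₀, ∃ ϑ : ℝ → E, Continuous ϑ ∧ ϑ 0 = w₀ ∧
      ∀ t ∈ Icc 0 (γ m), ϑ t = w₀ + ∫ s in (0 : ℝ)..t, f m (ϑ s)) (n : ℕ) (w₀ : E) :
    ∃ Θ : C(ℝ≥0, E), Θ 0 = w₀ ∧ IsStepSolution γ f n Θ := by
  classical
  set f₀ : ℕ → E → E := fun m => if m < n then 0 else f m with hf₀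
  have hf₀c : ∀ m, Continuous (f₀ m) := fun m => by
    simp only [hf₀]; split_ifs
    · exact continuous_const
    · exact hf m
  obtain ⟨Y, hY0, hY⟩ := hγ.exists_isStepSolution_zero hf₀c (fun m w₀ => by
    by_cases hm : m < n
    · exact ⟨fun _ => w₀, continuous_const, rfl, fun t _ => by simp [hf₀, hm]⟩
    · simpa [hf₀, hm] using hex m w₀) w₀
  set D : ℝ → E := fun s => f₀ (stepIndex γ s) (Y s) with hD
  have hn0 := hγ.stepTime_nonneg n
  have hint : ∀ s t, 0 ≤ s → 0 ≤ t → IntervalIntegrable D volume s t := fun s t hs ht =>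
    (hY s hs).1.symm.trans (hY t ht).1
  have hYn : Y (stepTime γ n) = w₀ := by
    have h1 : ∫ s in (0 : ℝ)..stepTime γ n, D s = 0 := by
      have hne : ∀ᵐ u ∂(volume : Measure ℝ), u ≠ stepTime γ n := by simp [ae_iff]
      refine intervalIntegral.integral_zero_ae ?_
      filter_upwards [hne] with s hs1 hs
      rw [uIoc_of_le hn0] at hs
      have h2 := hγ.mem_Ico_stepIndex hs.1.le
      have h3 : stepIndex γ s < n := hγ.strictMono.lt_iff_lt.1
        (h2.1.trans_lt (lt_of_le_of_ne hs.2 hs1))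
      simp [hD, hf₀, h3]
    rw [(hY _ hn0).2, h1, add_zero]
  have hshift : ∀ t : ℝ, 0 ≤ t → Y (stepTime γ n + t) =
      w₀ + ∫ s in (0 : ℝ)..t, D (stepTime γ n + s) := fun t ht => by
    have h1 := (hY _ (add_nonneg hn0 ht)).2
    rw [← intervalIntegral.integral_add_adjacent_intervals (hY _ hn0).1
      (hint _ _ hn0 (add_nonneg hn0 ht)), ← add_assoc, ← (hY _ hn0).2, hYn] at h1
    rw [h1, intervalIntegral.integral_comp_add_left (fun s => D s), add_zero]
  have hintshift : ∀ t : ℝ, 0 ≤ t →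
      IntervalIntegrable (fun s => D (stepTime γ n + s)) volume 0 t := fun t ht => by
    have h := (hint _ _ hn0 (add_nonneg hn0 ht)).comp_add_left (stepTime γ n)
    simpa using h
  have hDf : ∀ s, 0 ≤ s → D (stepTime γ n + s) =
      f (stepIndex γ (stepTime γ n + s)) (Y (stepTime γ n + s)) := fun s hs => by
    have h1 : ¬ stepIndex γ (stepTime γ n + s) < n :=
      not_lt.2 (hγ.le_stepIndex (by linarith))
    simp [hD, hf₀, h1]
  have hcont : Continuous fun t : ℝ≥0 => Y (stepTime γ n + t) := by
    refine continuous_iff_continuousAt.2 fun t => ?_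
    have h1 : ContinuousOn (fun u : ℝ => ∫ s in (0 : ℝ)..u, D (stepTime γ n + s))
        (uIcc 0 ((t : ℝ) + 1)) :=
      intervalIntegral.continuousOn_primitive_interval' (hintshift _ (by positivity)) left_mem_uIcc
    rw [uIcc_of_le (by positivity)] at h1
    have h2 : ContinuousOn (fun u : ℝ≥0 => Y (stepTime γ n + u)) (Iic (t + 1)) := by
      have h3 : ContinuousOn (fun u : ℝ≥0 => w₀ + ∫ s in (0 : ℝ)..u, D (stepTime γ n + s))
          (Iic (t + 1)) :=
        continuousOn_const.add (h1.comp NNReal.continuous_coe.continuousOn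
          fun u hu => ⟨u.2, by exact_mod_cast hu⟩)
      exact h3.congr fun u _ => hshift u u.2
    exact h2.continuousAt (Iic_mem_nhds (by simp))
  refine ⟨⟨fun t => Y (stepTime γ n + t), hcont⟩, by simp [hYn], fun t => ?_⟩
  have hcongr : ∀ s ∈ uIoc (0 : ℝ) t, D (stepTime γ n + s) =
      f (stepIndex γ (stepTime γ n + s)) (Y (stepTime γ n + (s.toNNReal : ℝ))) := fun s hs => by
    rw [uIoc_of_le t.coe_nonneg] at hs
    rw [hDf s hs.1.le, Real.coe_toNNReal s hs.1.le]
  constructor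
  · exact (hintshift t t.2).congr hcongr
  · simp only [ContinuousMap.coe_mk, NNReal.coe_zero, add_zero, hYn]
    rw [hshift t t.2, intervalIntegral.integral_congr_ae (ae_of_all _ hcongr)]

end Gluing

namespace Network

variable {k : ℕ} {A : Type*} {N : Network k A}

/-- The projection to the weights of the edges that leave the output layer. -/
noncomputable def outWeights (N : Network k A) :
    N.Weight →L[ℝ] ((Σ a : A, Fin (N.outWidth a)) → ℝ) :=
  ContinuousLinearMap.pi fun i => EuclideanSpace.proj (Sum.inr (Sum.inr i))

theorem outWeights_apply (w : N.Weight) (i : Σ a : A, Fin (N.outWidth a)) :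
    N.outWeights w i = w (Sum.inr (Sum.inr i)) := rfl

theorem layerInput_congr {w w' : N.Weight} (h : ∀ e, w (Sum.inl e) = w' (Sum.inl e)) (x : State k)
    (j : ℕ) (hj : j ≤ N.depth) (m : Fin (N.fanIn j)) :
    N.layerInput w x j hj m = N.layerInput w' x j hj m := by
  induction j with
  | zero => rfl
  | succ j ih => simp only [layerInput, ih, h]

theorem outputAct_congr {w w' : N.Weight} (h : ∀ e, w (Sum.inl e) = w' (Sum.inl e))
    (h' : ∀ e, w (Sum.inr (Sum.inl e)) = w' (Sum.inr (Sum.inl e))) (x : State k) (a : A)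
    (m : Fin (N.outWidth a)) : N.outputAct w x a m = N.outputAct w' x a m := by
  simp only [outputAct, layerInput_congr h, h']

variable [Fintype A]

/-- The output is linear in the weights that leave the output layer, with bounded coefficients. -/
theorem exists_outWeights_bounds
    (hsquash : N.AllActivations fun σ => Bornology.IsBounded (range σ))
    (hN : N.AllActivations fun σ => ContDiff ℝ 2 σ) :
    ∃ B, 0 ≤ B ∧ (∀ x a w, ‖N.outWeights (N.gradQ x a w)‖ ≤ B) ∧
      ∀ x a w, |N.Q x a w| ≤ B * ‖N.outWeights w‖ := by
  classical
  obtain ⟨B, hB0, hB⟩ := exists_abs_outAct_le hsquash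
  have hcard : ∀ a, (N.outWidth a : ℝ) * B ≤ ∑ a, (N.outWidth a : ℝ) * B := fun a =>
    Finset.single_le_sum (f := fun a => (N.outWidth a : ℝ) * B)
      (fun a _ => by positivity) (Finset.mem_univ a)
  have hsum0 : 0 ≤ ∑ a, (N.outWidth a : ℝ) * B := Finset.sum_nonneg fun a _ => by positivity
  refine ⟨∑ a, (N.outWidth a : ℝ) * B, hsum0, fun x a w => ?_, fun x a w => ?_⟩
  · refine (pi_norm_le_iff_of_nonneg hsum0).2 fun i => ?_
    set v : N.Weight := EuclideanSpace.single (Sum.inr (Sum.inr i)) 1 with hv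
    set κ : ℝ := ∑ m, N.outputAct w x a m * v (Sum.inr (Sum.inr ⟨a, m⟩)) with hκ
    have hline : ∀ s : ℝ, N.Q x a (w + s • v) = N.Q x a w + s * κ := fun s => by
      have h1 : ∀ m, N.outputAct (w + s • v) x a m = N.outputAct w x a m :=
        outputAct_congr (fun e => by simp [hv]) (fun e => by simp [hv]) x a
      simp only [Q, h1, hκ, Finset.mul_sum, ← Finset.sum_add_distrib]
      refine Finset.sum_congr rfl fun m _ => ?_
      simp only [PiLp.add_apply, PiLp.smul_apply, smul_eq_mul]
      ring
    have hd1 : HasDerivAt (fun s : ℝ => N.Q x a (w + s • v)) κ 0 := by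
      simp only [hline]
      simpa using ((hasDerivAt_id (0 : ℝ)).mul_const κ).const_add (N.Q x a w)
    have hd2 : HasDerivAt (fun s : ℝ => N.Q x a (w + s • v)) (inner ℝ (N.gradQ x a w) v) 0 := by
      have h1 : HasDerivAt (fun s : ℝ => w + s • v) v 0 := by
        simpa using ((hasDerivAt_id (0 : ℝ)).smul_const v).const_add w
      have h2 : HasFDerivAt (fun w => N.Q x a w)
          (InnerProductSpace.toDual ℝ N.Weight (N.gradQ x a w)) (w + (0 : ℝ) • v) := by
        rw [zero_smul, add_zero]
        exact (hasGradientAt_Q hN x a w).hasFDerivAt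
      exact h2.comp_hasDerivAt 0 h1
    have heq : N.outWeights (N.gradQ x a w) i = κ := by
      rw [hd1.unique hd2, hv, EuclideanSpace.inner_single_right]
      simp [outWeights_apply]
    rw [heq, Real.norm_eq_abs]
    refine (Finset.abs_sum_le_sum_abs _ _).trans (le_trans ?_ (hcard a))
    calc _ ≤ ∑ _m : Fin (N.outWidth a), B := Finset.sum_le_sum fun m _ => by
          rw [abs_mul]
          have h1 : |v (Sum.inr (Sum.inr ⟨a, m⟩))| ≤ 1 := by
            have := PiLp.norm_apply_le v (Sum.inr (Sum.inr ⟨a, m⟩))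
            simpa [hv] using this
          calc _ ≤ B * 1 := mul_le_mul (hB _ _ _) h1 (abs_nonneg _) hB0
            _ = B := mul_one B
      _ = _ := by simp
  · refine (abs_Q_le_sum hB x a w).trans ?_
    calc ∑ m, B * |w (Sum.inr (Sum.inr ⟨a, m⟩))|
        ≤ ∑ _m : Fin (N.outWidth a), B * ‖N.outWeights w‖ := Finset.sum_le_sum fun m _ =>
          mul_le_mul_of_nonneg_left (norm_le_pi_norm (N.outWeights w) ⟨a, m⟩) hB0
      _ = (N.outWidth a * B) * ‖N.outWeights w‖ := by simp [mul_assoc]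
      _ ≤ _ := mul_le_mul_of_nonneg_right (hcard a) (norm_nonneg _)

variable [Nonempty A] [MeasurableSpace A] {p : Kernel (State k × A) (State k)} [IsMarkovKernel p]
  {r : State k → A → ℝ} {α : ℝ}

theorem exists_eq_add_integral_lossGrad
    (hsquash : N.AllActivations fun σ => Bornology.IsBounded (range σ))
    (hN : N.AllActivations fun σ => ContDiff ℝ 2 σ) (hp : WeaklyContinuous p)
    (hr : ∀ a, Continuous fun x => r x a) (x : State k) (a : A) (w₀ : N.Weight) {T : ℝ}
    (hT : 0 ≤ T) :
    ∃ ϑ : ℝ → N.Weight, Continuous ϑ ∧ ϑ 0 = w₀ ∧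
      ∀ t ∈ Icc 0 T, ϑ t = w₀ + ∫ s in (0 : ℝ)..t, N.lossGrad p r α (ϑ s) x a := by
  obtain ⟨B, hB0, hπ, hQπ⟩ := exists_outWeights_bounds hsquash hN
  have hgrad : ContDiff ℝ 1 fun w : N.Weight => N.gradQ x a w := by
    have h := (contDiff_gradQ hN a).comp (contDiff_prodMk_left x)
    exact h
  have htd : Continuous fun w : N.Weight =>
      r x a + α * ∫ y, N.maxQ y w ∂(p (x, a)) - N.Q x a w := by
    have h := (continuous_tdError (α := α) hsquash hN hp hr a).comp
      (Continuous.prodMk_left (X := N.Weight) x)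
    exact h
  refine exists_eq_add_integral_smul_gradient (hasGradientAt_Q hN x a) hgrad (hπ x a) (hQπ x a)
    htd (G := |r x a| + (|α| + 1) * B) (fun w => ?_) w₀ hT
  have h1 : |∫ y, N.maxQ y w ∂(p (x, a))| ≤ B * ‖N.outWeights w‖ := by
    have := norm_integral_le_of_norm_le (f := fun y => N.maxQ y w)
      (integrable_const (μ := p (x, a)) (B * ‖N.outWeights w‖))
      (ae_of_all _ fun y => abs_maxQ_le fun a => hQπ y a w)
    simpa using this
  have h2 : |r x a + α * ∫ y, N.maxQ y w ∂(p (x, a)) - N.Q x a w| ≤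
      |r x a| + |α| * (B * ‖N.outWeights w‖) + B * ‖N.outWeights w‖ := by
    refine (abs_sub _ _).trans (add_le_add ((abs_add_le _ _).trans (add_le_add le_rfl ?_))
      (hQπ x a w))
    rw [abs_mul]
    exact mul_le_mul_of_nonneg_left h1 (abs_nonneg _)
  refine h2.trans ?_
  have h3 : 0 ≤ |r x a| * ‖N.outWeights w‖ := by positivity
  have h4 : 0 ≤ (|α| + 1) * B := by positivity
  nlinarith

end Network

/-! ### Compactness of the space of measure processes -/

theorem tendsto_of_forall_exists_approx {ι : Type*} {F : Filter ι} {a : ι → ℝ} {l : ℝ}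
    (h : ∀ ε > 0, ∃ (b : ι → ℝ) (m : ℝ), Tendsto b F (𝓝 m) ∧ (∀ n, |a n - b n| ≤ ε) ∧
      |l - m| ≤ ε) : Tendsto a F (𝓝 l) := by
  rw [Metric.tendsto_nhds]
  intro ε hε
  obtain ⟨b, m, hb, hab, hlm⟩ := h (ε / 4) (by positivity)
  filter_upwards [Metric.tendsto_nhds.1 hb (ε / 4) (by positivity)] with n hn
  rw [Real.dist_eq] at hn ⊢
  have h1 : a n - l = (a n - b n) + (b n - m) - (l - m) := by ring
  rw [h1]
  have h2 := abs_sub ((a n - b n) + (b n - m)) (l - m)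
  have h3 := abs_add_le (a n - b n) (b n - m)
  linarith [hab n]

section Pairing

variable {K : Type*} [TopologicalSpace K] [MeasurableSpace K]

theorem integrable_continuousMap [CompactSpace K] [OpensMeasurableSpace K] (f : C(K, ℝ))
    (μ : Measure K) [IsFiniteMeasure μ] :
    Integrable (fun z => f z) μ :=
  (BoundedContinuousFunction.mkOfCompact f).integrable μ

theorem abs_integral_continuousMap_le [CompactSpace K] (f : C(K, ℝ))
    (μ : Measure K) [IsProbabilityMeasure μ] :
    |∫ z, f z ∂μ| ≤ ‖f‖ := by
  have h := norm_integral_le_of_norm_le (integrable_const (μ := μ) ‖f‖)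
    (ae_of_all _ fun z => f.norm_coe_le_norm z)
  simpa using h

theorem measurable_integral_continuousMap [OpensMeasurableSpace K] (κ : Kernel ℝ K)
    [IsMarkovKernel κ] (f : C(K, ℝ)) :
    Measurable fun t => ∫ z, f z ∂(κ t) := by
  have h : StronglyMeasurable fun q : ℝ × K => f q.2 :=
    (f.continuous.measurable.comp measurable_snd).stronglyMeasurable
  exact h.integral_kernel_prod_right'.measurable

variable [CompactSpace K] [OpensMeasurableSpace K]

theorem aestronglyMeasurable_integral_continuousMap
    [TopologicalSpace.PseudoMetrizableSpace K] [SecondCountableTopology K]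
    (κ : Kernel ℝ K) [IsMarkovKernel κ]
    {μ : Measure ℝ} {H : ℝ → C(K, ℝ)} (hH : AEStronglyMeasurable H μ) :
    AEStronglyMeasurable (fun t => ∫ z, H t z ∂(κ t)) μ := by
  obtain ⟨H', hH', hae⟩ := hH
  have h1 : StronglyMeasurable fun q : ℝ × K => (H' q.1, q.2) :=
    (hH'.comp_measurable measurable_fst).prodMk measurable_snd.stronglyMeasurable
  have h2 : StronglyMeasurable fun q : ℝ × K => H' q.1 q.2 :=
    (continuous_eval (F := C(K, ℝ))).comp_stronglyMeasurable h1
  refine ⟨_, StronglyMeasurable.integral_kernel_prod_right' (κ := κ) h2, ?_⟩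
  filter_upwards [hae] with t ht
  rw [ht]

theorem integrable_integral_continuousMap
    [TopologicalSpace.PseudoMetrizableSpace K] [SecondCountableTopology K]
    (κ : Kernel ℝ K) [IsMarkovKernel κ]
    {μ : Measure ℝ} {H : ℝ → C(K, ℝ)} (hH : Integrable H μ) :
    Integrable (fun t => ∫ z, H t z ∂(κ t)) μ :=
  hH.norm.mono' (aestronglyMeasurable_integral_continuousMap κ hH.aestronglyMeasurable)
    (ae_of_all _ fun t => abs_integral_continuousMap_le (H t) (κ t))

theorem integrable_mul_integral_continuousMap (κ : Kernel ℝ K) [IsMarkovKernel κ]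
    {μ : Measure ℝ} {G : ℝ → ℝ} (hG : Integrable G μ) (f : C(K, ℝ)) :
    Integrable (fun t => G t * ∫ z, f z ∂(κ t)) μ :=
  hG.mul_bdd (measurable_integral_continuousMap κ f).aestronglyMeasurable
    (ae_of_all _ fun t => abs_integral_continuousMap_le f (κ t))

/-- Kernels from the time axis to a compact space are sequentially compact for the convergence
tested against products of an integrable function of time and a continuous function on the space.
By Prokhorov's theorem their composition products with a probability measure on the time axis have
a weakly convergent subsequence, and the limit is disintegrated. -/
theorem exists_subseq_tendsto_integral_kernel [T2Space K] [SecondCountableTopology K] [BorelSpace K]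
    [StandardBorelSpace K] [Nonempty K] (ρ : Measure ℝ) [IsProbabilityMeasure ρ]
    (ν : ℕ → Kernel ℝ K) [∀ n, IsMarkovKernel (ν n)] :
    ∃ ψ : ℕ → ℕ, StrictMono ψ ∧ ∃ κ : Kernel ℝ K, IsMarkovKernel κ ∧
      ∀ G : ℝ → ℝ, Integrable G ρ → ∀ f : C(K, ℝ),
        Tendsto (fun n => ∫ t, G t * ∫ z, f z ∂(ν (ψ n) t) ∂ρ) atTop
          (𝓝 (∫ t, G t * ∫ z, f z ∂(κ t) ∂ρ)) := by
  let m : ℕ → ProbabilityMeasure (ℝ × K) := fun n => ⟨ρ ⊗ₘ ν n, inferInstance⟩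
  have htight : IsTightMeasureSet {((μ : ProbabilityMeasure (ℝ × K)) : Measure (ℝ × K)) |
      μ ∈ range m} := by
    rw [isTightMeasureSet_iff_exists_isCompact_measure_compl_le]
    intro ε hε
    obtain ⟨S, hS, hSε⟩ := isTightMeasureSet_iff_exists_isCompact_measure_compl_le.1
      (isTightMeasureSet_singleton (μ := ρ)) ε hε
    refine ⟨S ×ˢ univ, hS.prod isCompact_univ, ?_⟩
    rintro _ ⟨_, ⟨n, rfl⟩, rfl⟩
    have h1 : (S ×ˢ (univ : Set K))ᶜ = Prod.fst ⁻¹' Sᶜ := by ext; simp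
    change (ρ ⊗ₘ ν n) _ ≤ ε
    rw [h1, ← Measure.fst_apply hS.isClosed.measurableSet.compl, Measure.fst_compProd]
    exact hSε ρ rfl
  obtain ⟨μ, -, ψ, hψ, hlim⟩ := (isCompact_closure_of_isTightMeasureSet htight).tendsto_subseq
    (x := m) fun n => subset_closure (mem_range_self n)
  have hfst : (μ : Measure (ℝ × K)).fst = ρ := by
    have h1 := ((ProbabilityMeasure.continuous_map
      (continuous_fst : Continuous (Prod.fst : ℝ × K → ℝ))).tendsto μ).comp hlim
    let ρ' : ProbabilityMeasure ℝ := ⟨ρ, inferInstance⟩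
    have h2 : ∀ n, (m n).map (continuous_fst : Continuous (Prod.fst : ℝ × K → ℝ)).aemeasurable =
        ρ' := fun n => Subtype.ext (Measure.fst_compProd ρ (ν n))
    have h3 := tendsto_nhds_unique h1 ((tendsto_const_nhds (x := ρ')).congr
      fun n => (h2 (ψ n)).symm)
    exact congrArg Subtype.val h3
  set κ := (μ : Measure (ℝ × K)).condKernel with hκ
  have hdis : ρ ⊗ₘ κ = μ := by
    rw [← hfst]; exact Measure.disintegrate _ _
  refine ⟨ψ, hψ, κ, inferInstance, fun G hG f => ?_⟩
  -- bounded continuous functions of time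
  have hbc : ∀ g : BoundedContinuousFunction ℝ ℝ,
      Tendsto (fun n => ∫ t, g t * ∫ z, f z ∂(ν (ψ n) t) ∂ρ) atTop
        (𝓝 (∫ t, g t * ∫ z, f z ∂(κ t) ∂ρ)) := fun g => by
    let F : BoundedContinuousFunction (ℝ × K) ℝ :=
      (g.compContinuous ⟨Prod.fst, continuous_fst⟩) *
        ((BoundedContinuousFunction.mkOfCompact f).compContinuous ⟨Prod.snd, continuous_snd⟩)
    have hF : ∀ (κ' : Kernel ℝ K) [IsMarkovKernel κ'],
        ∫ q, F q ∂(ρ ⊗ₘ κ') = ∫ t, g t * ∫ z, f z ∂(κ' t) ∂ρ := fun κ' _ => by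
      rw [Measure.integral_compProd (F.integrable _)]
      refine integral_congr_ae (ae_of_all _ fun t => ?_)
      exact integral_const_mul (g t) fun z => f z
    have h1 := ProbabilityMeasure.tendsto_iff_forall_integral_tendsto.1 hlim F
    rw [← hdis, hF] at h1
    refine h1.congr fun n => ?_
    exact hF (ν (ψ n))
  refine tendsto_of_forall_exists_approx fun ε hε => ?_
  obtain ⟨g, hgG, hg⟩ := hG.exists_boundedContinuous_integral_sub_le
    (ε := ε / (‖f‖ + 1)) (by positivity)
  have happrox : ∀ (κ' : Kernel ℝ K) [IsMarkovKernel κ'],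
      |∫ t, G t * ∫ z, f z ∂(κ' t) ∂ρ - ∫ t, g t * ∫ z, f z ∂(κ' t) ∂ρ| ≤ ε := fun κ' _ => by
    rw [← integral_sub (integrable_mul_integral_continuousMap κ' hG f)
      (integrable_mul_integral_continuousMap κ' hg f)]
    have h1 := norm_integral_le_of_norm_le (μ := ρ)
      (f := fun t => G t * ∫ z, f z ∂(κ' t) - g t * ∫ z, f z ∂(κ' t))
      ((hG.sub hg).norm.mul_const ‖f‖) (ae_of_all _ fun t => by
        rw [← sub_mul, norm_mul]
        exact mul_le_mul_of_nonneg_left (abs_integral_continuousMap_le f (κ' t)) (norm_nonneg _))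
    rw [integral_mul_const] at h1
    refine h1.trans ((mul_le_mul_of_nonneg_right hgG (norm_nonneg f)).trans ?_)
    rw [div_mul_eq_mul_div, div_le_iff₀ (by positivity)]
    nlinarith [norm_nonneg f]
  exact ⟨_, _, hbc g, fun n => happrox _, happrox κ⟩

end Pairing

namespace ProcessSpace

variable {k : ℕ} {A : Type*} [TopologicalSpace A] [MeasurableSpace A]

theorem tendsto_iff {ι : Type*} {F : Filter ι} {u : ι → ProcessSpace k A} {ν : ProcessSpace k A} :
    Tendsto u F (𝓝 ν) ↔ ∀ (T : ℝ≥0) (f : C(Sphere k × A, ℝ)) (g : ℝ → ℝ),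
      MemLp g 2 (volume.restrict (Icc (0 : ℝ) T)) →
      Tendsto (fun i => ∫ t in (0 : ℝ)..T, g t * ∫ z, f z ∂((u i).1 t.toNNReal)) F
        (𝓝 (∫ t in (0 : ℝ)..T, g t * ∫ z, f z ∂(ν.1 t.toNNReal))) := by
  simp only [nhds_iInf, tendsto_iInf, nhds_induced, tendsto_comap_iff]
  rfl

/-- A measure process on the real line: the process at negative times is its initial value. -/
noncomputable def realKernel (ν : ProcessSpace k A) : Kernel ℝ (Sphere k × A) :=
  ν.1.comap Real.toNNReal measurable_real_toNNReal

instance (ν : ProcessSpace k A) : IsMarkovKernel ν.realKernel := by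
  have := ν.2
  rw [realKernel]
  infer_instance

variable [DiscreteTopology A] [BorelSpace A] [Fintype A]

/-- `𝒰` is sequentially compact. -/
theorem exists_subseq_tendsto [Nonempty A] (u : ℕ → ProcessSpace k A) :
    ∃ ψ : ℕ → ℕ, StrictMono ψ ∧
      ∃ ν : ProcessSpace k A, Tendsto (fun n => u (ψ n)) atTop (𝓝 ν) := by
  have : Nonempty (Sphere k × A) := ⟨⟨northPole k, Classical.arbitrary A⟩⟩
  set vol₀ : Measure ℝ := volume.restrict (Ioi 0) with hvol
  have hne : NeZero vol₀ := ⟨by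
    rw [hvol, Ne, Measure.restrict_eq_zero, Real.volume_Ioi]; simp⟩
  set ρ : Measure ℝ := vol₀.toFinite with hρ
  obtain ⟨ψ, hψ, κ, hκ, hlim⟩ :=
    exists_subseq_tendsto_integral_kernel ρ fun n => (u n).realKernel
  let ν : ProcessSpace k A := ⟨κ.comap (fun t : ℝ≥0 => (t : ℝ)) measurable_coe_nnreal_real,
    inferInstance⟩
  refine ⟨ψ, hψ, ν, tendsto_iff.2 fun T f g hg => ?_⟩
  have hac : vol₀ ≪ ρ := absolutelyContinuous_toFinite vol₀
  have hgi : IntegrableOn g (Ioc (0 : ℝ) T) := by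
    have h1 : Integrable g (volume.restrict (Icc (0 : ℝ) T)) := hg.integrable (by norm_num)
    exact IntegrableOn.mono_set h1 Ioc_subset_Icc_self
  have hgi' : Integrable ((Ioc (0 : ℝ) T).indicator g) vol₀ := by
    rw [hvol]
    exact ((integrable_indicator_iff measurableSet_Ioc).2 hgi).integrableOn
  have hconv : ∀ (φ : ℝ → ℝ), ∫ t in (0 : ℝ)..T, g t * φ t =
      ∫ t, ((vol₀.rnDeriv ρ t).toReal • (Ioc (0 : ℝ) T).indicator g t) * φ t ∂ρ := fun φ => by
    have h1 := integral_rnDeriv_smul hac (f := fun t => (Ioc (0 : ℝ) T).indicator g t * φ t)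
    simp only [smul_eq_mul, mul_assoc] at h1 ⊢
    rw [h1, intervalIntegral.integral_of_le T.coe_nonneg, hvol,
      ← integral_indicator measurableSet_Ioc, ← integral_indicator measurableSet_Ioi]
    congr 1
    ext t
    by_cases ht : t ∈ Ioc (0 : ℝ) T
    · simp [ht, ht.1]
    · rw [indicator_apply (Ioi 0)]
      simp [ht]
  have h2 := hlim _ ((integrable_rnDeriv_smul_iff hac).2 hgi') f
  rw [← hconv fun t => ∫ z, f z ∂(κ t)] at h2
  simp only [← hconv] at h2
  have h3 : ∫ t in (0 : ℝ)..T, g t * ∫ z, f z ∂(ν.1 t.toNNReal) =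
      ∫ t in (0 : ℝ)..T, g t * ∫ z, f z ∂(κ t) := by
    refine intervalIntegral.integral_congr fun t ht => ?_
    rw [uIcc_of_le T.coe_nonneg] at ht
    change _ * ∫ z, f z ∂(κ (t.toNNReal : ℝ)) = _
    rw [Real.coe_toNNReal t ht.1]
  rw [h3]
  exact h2

/-- Convergence in `𝒰` can be tested against integrable functions of time with values in the
continuous functions. -/
theorem tendsto_integral_of_tendsto {ι : Type*} {F : Filter ι} {u : ι → ProcessSpace k A}
    {ν : ProcessSpace k A} (hu : Tendsto u F (𝓝 ν)) (T : ℝ≥0) {H : ℝ → C(Sphere k × A, ℝ)}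
    (hH : Integrable H (volume.restrict (Ioc (0 : ℝ) T))) :
    Tendsto (fun i => ∫ t in (0 : ℝ)..T, ∫ z, H t z ∂((u i).1 t.toNNReal)) F
      (𝓝 (∫ t in (0 : ℝ)..T, ∫ z, H t z ∂(ν.1 t.toNNReal))) := by
  simp only [intervalIntegral.integral_of_le T.coe_nonneg]
  set μ : Measure ℝ := volume.restrict (Ioc (0 : ℝ) T) with hμ
  refine Integrable.induction (μ := μ)
    (fun H : ℝ → C(Sphere k × A, ℝ) => Tendsto (fun i => ∫ t, ∫ z, H t z ∂((u i).realKernel t) ∂μ) F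
      (𝓝 (∫ t, ∫ z, H t z ∂(ν.realKernel t) ∂μ))) ?_ ?_ ?_ ?_ hH
  · intro f s hs _
    have hg : MemLp (s.indicator fun _ => (1 : ℝ)) 2 (volume.restrict (Icc (0 : ℝ) T)) :=
      (memLp_const 1).indicator hs
    have h1 := tendsto_iff.1 hu T f _ hg
    simp only [intervalIntegral.integral_of_le T.coe_nonneg] at h1
    have h2 : ∀ ν' : ProcessSpace k A,
        ∫ t, ∫ z, (s.indicator (fun _ => f) t) z ∂(ν'.realKernel t) ∂μ =
        ∫ t in Ioc (0 : ℝ) T, s.indicator (fun _ => (1 : ℝ)) t * ∫ z, f z ∂(ν'.1 t.toNNReal) :=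
      fun ν' => by
        refine integral_congr_ae (ae_of_all _ fun t => ?_)
        by_cases ht : t ∈ s
        · simp only [indicator_of_mem ht, one_mul]; rfl
        · simp [indicator_of_notMem ht]
    simp only [h2]
    exact h1
  · intro H₁ H₂ _ hH₁ hH₂ h₁ h₂
    have h3 : ∀ ν' : ProcessSpace k A, ∫ t, ∫ z, (H₁ + H₂) t z ∂(ν'.realKernel t) ∂μ =
        ∫ t, ∫ z, H₁ t z ∂(ν'.realKernel t) ∂μ + ∫ t, ∫ z, H₂ t z ∂(ν'.realKernel t) ∂μ :=
      fun ν' => by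
        rw [← integral_add (integrable_integral_continuousMap _ hH₁)
          (integrable_integral_continuousMap _ hH₂)]
        refine integral_congr_ae (ae_of_all _ fun t => ?_)
        exact integral_add (integrable_continuousMap (H₁ t) _) (integrable_continuousMap (H₂ t) _)
    simp only [h3]
    exact h₁.add h₂
  · have happrox : ∀ (ν' : ProcessSpace k A) (H₁ H₂ : ℝ →₁[μ] C(Sphere k × A, ℝ)),
        |∫ t, ∫ z, H₁ t z ∂(ν'.realKernel t) ∂μ - ∫ t, ∫ z, H₂ t z ∂(ν'.realKernel t) ∂μ| ≤
          dist H₁ H₂ := fun ν' H₁ H₂ => by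
      have hi₁ := L1.integrable_coeFn H₁
      have hi₂ := L1.integrable_coeFn H₂
      rw [← integral_sub (integrable_integral_continuousMap _ hi₁)
        (integrable_integral_continuousMap _ hi₂), L1.dist_eq_integral_dist]
      refine norm_integral_le_of_norm_le
        (f := fun t => ∫ z, H₁ t z ∂(ν'.realKernel t) - ∫ z, H₂ t z ∂(ν'.realKernel t))
        (by simpa only [dist_eq_norm, Pi.sub_apply] using (hi₁.sub hi₂).norm)
        (ae_of_all _ fun t => ?_)
      rw [← integral_sub (integrable_continuousMap (H₁ t) _) (integrable_continuousMap (H₂ t) _),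
        dist_eq_norm]
      exact abs_integral_continuousMap_le (H₁ t - H₂ t) _
    refine isClosed_of_closure_subset fun H hH => tendsto_of_forall_exists_approx fun ε hε => ?_
    obtain ⟨H', hH', hd⟩ := Metric.mem_closure_iff.1 hH ε hε
    exact ⟨_, _, hH', fun n => (happrox _ _ _).trans hd.le, (happrox _ _ _).trans hd.le⟩
  · intro H₁ H₂ hae _ h
    have h3 : ∀ ν' : ProcessSpace k A, ∫ t, ∫ z, H₂ t z ∂(ν'.realKernel t) ∂μ =
        ∫ t, ∫ z, H₁ t z ∂(ν'.realKernel t) ∂μ := fun ν' => by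
      refine integral_congr_ae ?_
      filter_upwards [hae] with t ht
      rw [ht]
    simp only [h3]
    exact h

end ProcessSpace

/-! ### Measures supported away from the pole -/

section Embedding

theorem isOpenEmbedding_stereographic_symm (k : ℕ) :
    IsOpenEmbedding (stereographic' k (northPole k)).symm :=
  OpenPartialHomeomorph.isOpenEmbedding _ (by simp)

theorem stereographic_symm_ne_northPole {k : ℕ} (x : State k) :
    (stereographic' k (northPole k)).symm x ≠ northPole k := by
  have h := (stereographic' k (northPole k)).map_target (x := x) (by simp)
  simpa using h

theorem measurableEmbedding_embed (k : ℕ) (A : Type*) [MeasurableSpace A] :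
    MeasurableEmbedding (embed k A) :=
  (isOpenEmbedding_stereographic_symm k).measurableEmbedding.prodMap MeasurableEmbedding.id

/-- The image in the sphere of the closed ball with radius `R`. -/
def ballImage (k : ℕ) (R : ℝ) : Set (Sphere k) :=
  (stereographic' k (northPole k)).symm '' Metric.closedBall (0 : State k) R

theorem isCompact_ballImage (k : ℕ) (R : ℝ) : IsCompact (ballImage k R) :=
  (isCompact_closedBall _ _).image (isOpenEmbedding_stereographic_symm k).continuous

theorem northPole_notMem_ballImage (k : ℕ) (R : ℝ) : northPole k ∉ ballImage k R := by
  rintro ⟨x, -, hx⟩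
  exact stereographic_symm_ne_northPole x hx

/-- A continuous left inverse, on a ball, of the inverse stereographic projection. -/
theorem exists_retraction (k : ℕ) (R : ℝ) : ∃ ρ : C(Sphere k, State k),
    ∀ x : State k, ‖x‖ ≤ R → ρ ((stereographic' k (northPole k)).symm x) = x := by
  have hcont : ContinuousOn (stereographic' k (northPole k)) (ballImage k R) := by
    refine (stereographic' k (northPole k)).continuousOn.mono fun q hq => ?_
    rw [stereographic'_source]
    exact fun h => northPole_notMem_ballImage k R (h ▸ hq)
  obtain ⟨ρ, hρ⟩ := ContinuousMap.exists_restrict_eq (isCompact_ballImage k R).isClosed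
    (⟨_, hcont.domRestrict⟩ : C(ballImage k R, State k))
  refine ⟨ρ, fun x hx => ?_⟩
  have h1 := DFunLike.congr_fun hρ
    ⟨(stereographic' k (northPole k)).symm x, x, by simpa using hx, rfl⟩
  refine h1.trans ?_
  exact (stereographic' k (northPole k)).right_inv (by simp)

end Embedding

namespace ProcessSpace

variable {k : ℕ} {A : Type*} [MeasurableSpace A]

/-- Processes supported in a closed set form a closed subset of `𝒰`. -/
theorem ae_measure_eq_zero_of_tendsto [TopologicalSpace A] [DiscreteTopology A] [BorelSpace A]
    [Fintype A] {ι : Type*} {F : Filter ι} [F.NeBot] {u : ι → ProcessSpace k A}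
    {ν : ProcessSpace k A} (hu : Tendsto u F (𝓝 ν)) {K : Set (Sphere k)} (hK : IsClosed K)
    (hne : K.Nonempty) (hsupp : ∀ i t, (u i).1 t {z | z.1 ∉ K} = 0) :
    ∀ᵐ t ∂(volume.restrict (Ici (0 : ℝ))), ν.1 t.toNNReal {z | z.1 ∉ K} = 0 := by
  -- the distance to `K` is a test function that vanishes exactly on `K`
  let f : C(Sphere k × A, ℝ) :=
    ⟨fun z => Metric.infDist z.1 K, (Metric.continuous_infDist_pt K).comp continuous_fst⟩
  have hset : {z : Sphere k × A | z.1 ∉ K} = {z | f z ≠ 0} := by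
    ext z
    exact not_congr (hK.mem_iff_infDist_zero hne)
  have hf0 : ∀ z, 0 ≤ f z := fun z => Metric.infDist_nonneg
  have hzero : ∀ T : ℝ≥0, ∫ t in (0 : ℝ)..T, ∫ z, f z ∂(ν.1 t.toNNReal) = 0 := fun T => by
    refine tendsto_nhds_unique (tendsto_integral_of_tendsto hu T (H := fun _ => f)
      (integrable_const f)) ?_
    have h1 : ∀ i t, ∫ z, f z ∂((u i).1 t) = 0 := fun i t => by
      refine integral_eq_zero_of_ae ?_
      have h2 := hsupp i t
      rw [hset] at h2
      exact h2
    simp [h1]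
  have hT : ∀ n : ℕ, ∀ᵐ t ∂(volume : Measure ℝ), t ∈ Ioc (0 : ℝ) n →
      ν.1 t.toNNReal {z | z.1 ∉ K} = 0 := fun n => by
    have h1 := hzero n
    rw [intervalIntegral.integral_of_le (NNReal.coe_nonneg _)] at h1
    have h3 : Integrable (fun t => ∫ z, f z ∂(ν.realKernel t))
        (volume.restrict (Ioc (0 : ℝ) (n : ℝ≥0))) :=
      integrable_integral_continuousMap _ (H := fun _ => f) (integrable_const f)
    have h2 := (integral_eq_zero_iff_of_nonneg (fun t => integral_nonneg hf0) h3).1 h1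
    have h4 := (ae_restrict_iff' measurableSet_Ioc).1 h2
    filter_upwards [h4] with t ht hmem
    have h5 : ∫ z, f z ∂(ν.realKernel t) = 0 := ht (by simpa using hmem)
    have h6 := (integral_eq_zero_iff_of_nonneg hf0 (integrable_continuousMap f _)).1 h5
    rw [hset]
    exact h6
  rw [ae_restrict_iff' measurableSet_Ici]
  filter_upwards [ae_all_iff.2 hT, Measure.ae_ne volume (0 : ℝ)] with t ht ht0 hmem
  obtain ⟨n, hn⟩ := exists_nat_ge t
  exact ht n ⟨lt_of_le_of_ne hmem (Ne.symm ht0), hn⟩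

variable {ν : ProcessSpace k A} {t : ℝ≥0} {R : ℝ}

theorem map_onState (h : ν.1 t {z | z.1 ∉ ballImage k R} = 0) :
    (ν.onState t).map (embed k A) = ν.1 t := by
  rw [onState, (measurableEmbedding_embed k A).map_comap, Measure.restrict_eq_self_of_ae_mem]
  refine measure_mono_null (fun z hz => ?_) h
  rintro ⟨x, -, hx⟩
  exact hz ⟨(x, z.2), Prod.ext hx rfl⟩

theorem ae_onState_norm_le (h : ν.1 t {z | z.1 ∉ ballImage k R} = 0) :
    ∀ᵐ z ∂(ν.onState t), ‖z.1‖ ≤ R := by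
  have h1 : (ν.onState t) {z | ¬ ‖z.1‖ ≤ R} = 0 := by
    rw [onState, (measurableEmbedding_embed k A).comap_apply]
    refine measure_mono_null ?_ h
    rintro _ ⟨z, hz, rfl⟩ ⟨x, hx, hxz⟩
    have h2 := (isOpenEmbedding_stereographic_symm k).injective hxz
    exact hz (by simpa [← h2] using hx)
  exact h1

theorem isProbabilityMeasure_onState (h : ν.1 t {z | z.1 ∉ ballImage k R} = 0) :
    IsProbabilityMeasure (ν.onState t) := by
  have := ν.2
  refine ⟨?_⟩
  have h1 := congrArg (fun μ => μ univ) (map_onState h)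
  simpa [Measure.map_apply measurable_embed MeasurableSet.univ] using h1

theorem integral_onState {E : Type*} [NormedAddCommGroup E] [NormedSpace ℝ E]
    (h : ν.1 t {z | z.1 ∉ ballImage k R} = 0) {ρ : Sphere k → State k}
    (hρ : ∀ x : State k, ‖x‖ ≤ R → ρ ((stereographic' k (northPole k)).symm x) = x)
    (f : State k × A → E) :
    ∫ z, f z ∂(ν.onState t) = ∫ z, f (ρ z.1, z.2) ∂(ν.1 t) := by
  rw [← map_onState h, (measurableEmbedding_embed k A).integral_map]
  refine integral_congr_ae ?_
  filter_upwards [ae_onState_norm_le h] with z hz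
  simp only [embed, hρ z.1 hz]

end ProcessSpace

/-! ### The limiting differential equation -/

section ShiftedProcess

variable {k : ℕ} {A : Type*} [MeasurableSpace A]

theorem shiftedProcess_apply (γ : ℕ → ℝ) (x : ℕ → State k) (a : ℕ → A) (n : ℕ) (t : ℝ≥0) :
    shiftedProcess γ x a n t = Measure.dirac
      (x (stepIndex γ (stepTime γ n + t)), a (stepIndex γ (stepTime γ n + t))) :=
  Kernel.deterministic_apply _ _

/-- Along a shifted process the differential equation is piecewise autonomous. -/
theorem Network.isODESolution_shiftedProcess_iff [Fintype A] [MeasurableSingletonClass A]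
    {N : Network k A} {p : Kernel (State k × A) (State k)} {r : State k → A → ℝ} {α : ℝ}
    {γ : ℕ → ℝ} {x : ℕ → State k} {a : ℕ → A} {n : ℕ} {ϑ : C(ℝ≥0, N.Weight)} :
    N.IsODESolution p r α (shiftedProcess γ x a n) ϑ ↔
      IsStepSolution γ (fun m w => N.lossGrad p r α w (x m) (a m)) n ϑ := by
  have h1 : ∀ s : ℝ, 0 ≤ s →
      N.avgGrad p r α (ϑ s.toNNReal) (shiftedProcess γ x a n s.toNNReal) =
      N.lossGrad p r α (ϑ s.toNNReal) (x (stepIndex γ (stepTime γ n + s)))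
        (a (stepIndex γ (stepTime γ n + s))) := fun s hs => by
    rw [Network.avgGrad, shiftedProcess_apply, integral_dirac, Real.coe_toNNReal s hs]
  rw [Network.IsODESolution, IsStepSolution, and_iff_right]
  · refine forall_congr' fun t => and_congr (intervalIntegrable_congr fun s hs => ?_) ?_
    · rw [uIoc_of_le t.coe_nonneg] at hs
      exact h1 s hs.1.le
    · rw [intervalIntegral.integral_congr fun s hs => ?_]
      rw [uIcc_of_le t.coe_nonneg] at hs
      exact h1 s hs.1
  · refine ae_of_all _ fun s => ?_
    rw [shiftedProcess_apply]
    exact integrable_dirac (by simp)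

variable [TopologicalSpace A] [DiscreteTopology A] [BorelSpace A] [Fintype A]
  {γ : ℕ → ℝ} {x : ℕ → State k} {a : ℕ → A} {R : ℝ}
  {ι : Type*} {F : Filter ι} [F.NeBot] {φ : ι → ℕ} {ν : ProcessSpace k A}

theorem ae_measure_notMem_ballImage (hR : 0 ≤ R) (hx : ∀ m, ‖x m‖ ≤ R)
    (hlim : Tendsto (fun i => toProcessSpace (shiftedProcess γ x a (φ i))) F (𝓝 ν)) :
    ∀ᵐ t ∂(volume.restrict (Ici (0 : ℝ))), ν.1 t.toNNReal {z | z.1 ∉ ballImage k R} = 0 := by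
  refine ProcessSpace.ae_measure_eq_zero_of_tendsto hlim (isCompact_ballImage k R).isClosed
    ⟨_, 0, by simpa using hR, rfl⟩ fun i t => ?_
  have hm : MeasurableSet {z : Sphere k × A | z.1 ∉ ballImage k R} :=
    measurable_fst (isCompact_ballImage k R).isClosed.measurableSet.compl
  change ((shiftedProcess γ x a (φ i)).map (embed k A)) t _ = 0
  rw [Kernel.map_apply' _ measurable_embed _ hm, shiftedProcess_apply, Measure.dirac_apply]
  refine indicator_of_notMem (fun h => ?_) _
  exact (mem_ofPred_eq ▸ h : _ ∉ ballImage k R) ⟨_, by simpa using hx _, rfl⟩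

/-- Time integrals along the shifted processes converge to those along the limit process. -/
theorem tendsto_integral_shiftedProcess_real (hR : 0 ≤ R) (hx : ∀ m, ‖x m‖ ≤ R)
    (hlim : Tendsto (fun i => toProcessSpace (shiftedProcess γ x a (φ i))) F (𝓝 ν))
    {h : ℝ → State k → A → ℝ} (hh : ∀ b, Continuous fun v : ℝ × State k => h v.1 v.2 b)
    (T : ℝ≥0) :
    IntervalIntegrable (fun s => ∫ z, h s z.1 z.2 ∂(ν.onState s.toNNReal)) volume 0 T ∧
    Tendsto (fun i => ∫ s in (0 : ℝ)..T, h s (x (stepIndex γ (stepTime γ (φ i) + s)))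
        (a (stepIndex γ (stepTime γ (φ i) + s)))) F
      (𝓝 (∫ s in (0 : ℝ)..T, ∫ z, h s z.1 z.2 ∂(ν.onState s.toNNReal))) := by
  obtain ⟨ρ, hρ⟩ := exists_retraction k R
  have hcont : Continuous fun v : ℝ × (Sphere k × A) => h v.1 (ρ v.2.1) v.2.2 := by
    have h1 : Continuous fun v : (ℝ × Sphere k) × A => h v.1.1 (ρ v.1.2) v.2 :=
      continuous_prod_of_discrete_right.2 fun b => by
        have h2 := (hh b).comp (f := fun v : ℝ × Sphere k => (v.1, ρ v.2)) (by fun_prop)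
        exact h2
    exact h1.comp (f := fun v : ℝ × (Sphere k × A) => ((v.1, v.2.1), v.2.2)) (by fun_prop)
  let H : C(ℝ, C(Sphere k × A, ℝ)) := ContinuousMap.curry ⟨_, hcont⟩
  have hHi : Integrable (fun s => H s) (volume.restrict (Ioc (0 : ℝ) T)) :=
    H.continuous.integrableOn_Ioc
  have key := ProcessSpace.tendsto_integral_of_tendsto hlim T hHi
  have hsupp := ae_measure_notMem_ballImage hR hx hlim
  have hae : ∀ᵐ s ∂(volume.restrict (Ioc (0 : ℝ) T)),
      ∫ z, H s z ∂(ν.1 s.toNNReal) = ∫ z, h s z.1 z.2 ∂(ν.onState s.toNNReal) := by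
    have h1 := ae_restrict_of_ae_restrict_of_subset
      (fun s (hs : s ∈ Ioc (0 : ℝ) T) => hs.1.le) hsupp
    filter_upwards [h1] with s hs
    rw [ProcessSpace.integral_onState hs hρ]
    rfl
  have hleft : ∀ i, ∫ t in (0 : ℝ)..T, ∫ z, H t z
        ∂((toProcessSpace (shiftedProcess γ x a (φ i))).1 t.toNNReal) =
      ∫ s in (0 : ℝ)..T, h s (x (stepIndex γ (stepTime γ (φ i) + s)))
        (a (stepIndex γ (stepTime γ (φ i) + s))) := fun i => by
    refine intervalIntegral.integral_congr fun s hs => ?_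
    rw [uIcc_of_le T.coe_nonneg] at hs
    change ∫ z, H s z ∂(((shiftedProcess γ x a (φ i)).map (embed k A)) s.toNNReal) = _
    rw [Kernel.map_apply _ measurable_embed, (measurableEmbedding_embed k A).integral_map,
      shiftedProcess_apply, integral_dirac, Real.coe_toNNReal s hs.1]
    change h s (ρ ((stereographic' k (northPole k)).symm (x _))) _ = _
    rw [hρ _ (hx _)]
    rfl
  refine ⟨?_, ?_⟩
  · rw [intervalIntegrable_iff_integrableOn_Ioc_of_le T.coe_nonneg]
    exact (integrable_integral_continuousMap ν.realKernel hHi).congr hae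
  · simp only [hleft] at key
    have h1 := integral_congr_ae hae
    rw [← intervalIntegral.integral_of_le T.coe_nonneg,
      ← intervalIntegral.integral_of_le T.coe_nonneg] at h1
    rw [← h1]
    exact key

theorem ae_integrable_onState {E : Type*} [NormedAddCommGroup E] [NormedSpace ℝ E]
    [SecondCountableTopology E]
    (hR : 0 ≤ R) (hx : ∀ m, ‖x m‖ ≤ R)
    (hlim : Tendsto (fun i => toProcessSpace (shiftedProcess γ x a (φ i))) F (𝓝 ν))
    {G : ℝ → State k → A → E} (hG : ∀ b, Continuous fun v : ℝ × State k => G v.1 v.2 b) :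
    ∀ᵐ s ∂(volume.restrict (Ici (0 : ℝ))),
      Integrable (fun z : State k × A => G s z.1 z.2) (ν.onState s.toNNReal) := by
  filter_upwards [ae_measure_notMem_ballImage hR hx hlim] with s hs
  have := ProcessSpace.isProbabilityMeasure_onState hs
  have hc : Continuous fun z : State k × A => G s z.1 z.2 :=
    continuous_prod_of_discrete_right.2 fun b =>
      (hG b).comp (f := fun y : State k => (s, y)) (by fun_prop)
  have hbdd : ∀ b, ∃ C, ∀ y ∈ Metric.closedBall (0 : State k) R, ‖G s y b‖ ≤ C := fun b =>
    (isCompact_closedBall _ _).exists_bound_of_continuousOn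
      (((hG b).comp (f := fun y : State k => (s, y)) (by fun_prop)).continuousOn)
  choose C hC using hbdd
  refine Integrable.of_bound hc.aestronglyMeasurable (∑ b, |C b|) ?_
  filter_upwards [ProcessSpace.ae_onState_norm_le hs] with z hz
  exact ((hC z.2 z.1 (by simpa using hz)).trans (le_abs_self _)).trans
    (Finset.single_le_sum (f := fun b => |C b|) (fun b _ => abs_nonneg _) (Finset.mem_univ z.2))

theorem intervalIntegrable_shiftedProcess {E : Type*} [NormedAddCommGroup E] [NormedSpace ℝ E]
    [SecondCountableTopology E] (hx : ∀ m, ‖x m‖ ≤ R)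
    {G : ℝ → State k → A → E} (hG : ∀ b, Continuous fun v : ℝ × State k => G v.1 v.2 b)
    (n : ℕ) (T : ℝ≥0) :
    IntervalIntegrable (fun s => G s (x (stepIndex γ (stepTime γ n + s)))
      (a (stepIndex γ (stepTime γ n + s)))) volume 0 T := by
  rw [intervalIntegrable_iff_integrableOn_Ioc_of_le T.coe_nonneg]
  have hidx : Measurable fun s : ℝ => stepIndex γ (stepTime γ n + s) :=
    (measurable_stepIndex γ).comp (measurable_const.add measurable_id)
  have hc : Continuous fun v : (ℝ × State k) × A => G v.1.1 v.1.2 v.2 :=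
    continuous_prod_of_discrete_right.2 hG
  have hbdd : ∀ b, ∃ C, ∀ v ∈ Icc (0 : ℝ) T ×ˢ Metric.closedBall (0 : State k) R,
      ‖G v.1 v.2 b‖ ≤ C := fun b =>
    (isCompact_Icc.prod (isCompact_closedBall _ _)).exists_bound_of_continuousOn
      (hG b).continuousOn
  choose C hC using hbdd
  have hmeas : Measurable fun s : ℝ => ((s, x (stepIndex γ (stepTime γ n + s))),
      a (stepIndex γ (stepTime γ n + s))) :=
    (measurable_id.prodMk (measurable_from_top.comp hidx)).prodMk (measurable_from_top.comp hidx)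
  refine Integrable.of_bound
    (hc.stronglyMeasurable.comp_measurable hmeas).aestronglyMeasurable (∑ b, |C b|) ?_
  rw [ae_restrict_iff' measurableSet_Ioc]
  refine ae_of_all _ fun s hs => ?_
  set j := stepIndex γ (stepTime γ n + s)
  exact ((hC (a j) (s, x j) ⟨⟨hs.1.le, hs.2⟩, by simpa using hx j⟩).trans (le_abs_self _)).trans
    (Finset.single_le_sum (f := fun b => |C b|) (fun b _ => abs_nonneg _) (Finset.mem_univ (a j)))

theorem tendsto_integral_shiftedProcess {κ : Type*} [Fintype κ] (hR : 0 ≤ R)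
    (hx : ∀ m, ‖x m‖ ≤ R)
    (hlim : Tendsto (fun i => toProcessSpace (shiftedProcess γ x a (φ i))) F (𝓝 ν))
    {G : ℝ → State k → A → EuclideanSpace ℝ κ}
    (hG : ∀ b, Continuous fun v : ℝ × State k => G v.1 v.2 b) (T : ℝ≥0) :
    IntervalIntegrable (fun s => ∫ z, G s z.1 z.2 ∂(ν.onState s.toNNReal)) volume 0 T ∧
    Tendsto (fun i => ∫ s in (0 : ℝ)..T, G s (x (stepIndex γ (stepTime γ (φ i) + s)))
        (a (stepIndex γ (stepTime γ (φ i) + s)))) F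
      (𝓝 (∫ s in (0 : ℝ)..T, ∫ z, G s z.1 z.2 ∂(ν.onState s.toNNReal))) := by
  have hcoord := fun e => tendsto_integral_shiftedProcess_real (a := a) hR hx hlim
    (h := fun s y b => G s y b e)
    (fun b => (EuclideanSpace.proj (𝕜 := ℝ) e).continuous.comp (hG b)) T
  have hae : ∀ᵐ s ∂(volume.restrict (Ioc (0 : ℝ) T)), ∀ e,
      ∫ z, G s z.1 z.2 e ∂(ν.onState s.toNNReal) =
        (∫ z, G s z.1 z.2 ∂(ν.onState s.toNNReal)) e := by
    filter_upwards [ae_restrict_of_ae_restrict_of_subset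
      (fun s (hs : s ∈ Ioc (0 : ℝ) T) => hs.1.le) (ae_integrable_onState hR hx hlim hG)]
      with s hs e
    exact (EuclideanSpace.proj (𝕜 := ℝ) e).integral_comp_comm hs
  have hint : IntervalIntegrable (fun s => ∫ z, G s z.1 z.2 ∂(ν.onState s.toNNReal))
      volume 0 T := by
    rw [intervalIntegrable_iff_integrableOn_Ioc_of_le T.coe_nonneg]
    refine Integrable.of_eval_piLp fun e => ?_
    have h1 := (hcoord e).1
    rw [intervalIntegrable_iff_integrableOn_Ioc_of_le T.coe_nonneg] at h1
    exact Integrable.congr h1 (hae.mono fun s hs => hs e)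
  refine ⟨hint, ?_⟩
  have hT : Tendsto (fun i => WithLp.ofLp (∫ s in (0 : ℝ)..T,
      G s (x (stepIndex γ (stepTime γ (φ i) + s))) (a (stepIndex γ (stepTime γ (φ i) + s))))) F
      (𝓝 (WithLp.ofLp (∫ s in (0 : ℝ)..T, ∫ z, G s z.1 z.2 ∂(ν.onState s.toNNReal)))) := by
    refine tendsto_pi_nhds.2 fun e => ?_
    have h1 : (∫ s in (0 : ℝ)..T, ∫ z, G s z.1 z.2 ∂(ν.onState s.toNNReal)) e =
        ∫ s in (0 : ℝ)..T, ∫ z, G s z.1 z.2 e ∂(ν.onState s.toNNReal) := by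
      refine ((EuclideanSpace.proj (𝕜 := ℝ) e).intervalIntegral_comp_comm hint).symm.trans ?_
      rw [intervalIntegral.integral_of_le T.coe_nonneg,
        intervalIntegral.integral_of_le T.coe_nonneg]
      exact integral_congr_ae (hae.mono fun s hs => (hs e).symm)
    rw [h1]
    refine (hcoord e).2.congr fun i => ?_
    exact (EuclideanSpace.proj (𝕜 := ℝ) e).intervalIntegral_comp_comm
      (intervalIntegrable_shiftedProcess hx hG (φ i) T)
  have h2 := ((PiLp.continuous_toLp 2 (fun _ : κ => ℝ)).tendsto _).comp hT
  exact h2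

end ShiftedProcess

theorem tendstoUniformlyOn_Iic_of_tendsto {E ι : Type*} [UniformSpace E] {F : Filter ι}
    {Θ : ι → C(ℝ≥0, E)} {ϑ : C(ℝ≥0, E)} (h : Tendsto Θ F (𝓝 ϑ)) (T : ℝ≥0) :
    TendstoUniformlyOn (fun i t => Θ i t) ϑ F (Iic T) := by
  rw [← Icc_bot]
  exact ContinuousMap.tendsto_iff_forall_isCompact_tendstoUniformlyOn.1 h _ isCompact_Icc

/-- Limits of solutions along the shifted processes solve the limiting equation. Replacing the
solutions by their limit inside the loss gradient costs the distance of both plus the probability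
of leaving the ball, and the latter tends to `0` along the trajectory. -/
theorem Network.isODESolution_of_tendsto {k : ℕ} {A : Type*} [Fintype A] [Nonempty A]
    [TopologicalSpace A] [DiscreteTopology A] [MeasurableSpace A] [BorelSpace A]
    {N : Network k A} {p : Kernel (State k × A) (State k)} [IsMarkovKernel p]
    {r : State k → A → ℝ} {α : ℝ}
    (hsquash : N.AllActivations fun σ => Bornology.IsBounded (range σ))
    (hN : N.AllActivations fun σ => ContDiff ℝ 2 σ) (hp : WeaklyContinuous p)
    (hr : ∀ a, Continuous fun x => r x a) {γ : ℕ → ℝ} (hγ : IsStepSize γ)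
    {x : ℕ → State k} {a : ℕ → A} {R : ℝ} (hR : 0 ≤ R) (hx : ∀ m, ‖x m‖ ≤ R)
    (hδ : Tendsto (fun m => (p (x m, a m)).real (Metric.closedBall 0 R)ᶜ) atTop (𝓝 0))
    {Θ : ℕ → C(ℝ≥0, N.Weight)}
    (hΘ : ∀ n, IsStepSolution γ (fun m w => N.lossGrad p r α w (x m) (a m)) n (Θ n))
    {φ : ℕ → ℕ} (hφ : Tendsto φ atTop atTop) {ϑ : C(ℝ≥0, N.Weight)} {ν : ProcessSpace k A}
    (hϑ : Tendsto (fun n => Θ (φ n)) atTop (𝓝 ϑ))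
    (hν : Tendsto (fun n => toProcessSpace (shiftedProcess γ x a (φ n))) atTop (𝓝 ν)) :
    N.IsODESolution p r α ν.onState ϑ := by
  have hcont : ∀ (ϑ' : C(ℝ≥0, N.Weight)) (b : A), Continuous fun v : ℝ × State k =>
      N.lossGrad p r α (ϑ' v.1.toNNReal) v.2 b := fun ϑ' b => by
    have h1 : Continuous fun v : ℝ × State k => (ϑ' v.1.toNNReal, v.2) :=
      (ϑ'.continuous.comp (continuous_real_toNNReal.comp continuous_fst)).prodMk continuous_snd
    have h2 := (continuous_lossGrad (α := α) hsquash hN hp hr b).comp h1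
    exact h2
  refine ⟨ae_integrable_onState hR hx hν (hcont ϑ), fun t => ?_⟩
  obtain ⟨hint, hconv⟩ := tendsto_integral_shiftedProcess hR hx hν
    (G := fun s y b => N.lossGrad p r α (ϑ s.toNNReal) y b) (hcont ϑ) t
  refine ⟨hint, ?_⟩
  have heval : ∀ s : ℝ≥0, Tendsto (fun n => Θ (φ n) s) atTop (𝓝 (ϑ s)) := fun s =>
    ((continuous_eval_const (F := C(ℝ≥0, N.Weight)) s).tendsto ϑ).comp hϑ
  have hunif := tendstoUniformlyOn_Iic_of_tendsto hϑ t
  set I : C(ℝ≥0, N.Weight) → ℕ → N.Weight := fun ϑ' n =>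
    ∫ s in (0 : ℝ)..t, N.lossGrad p r α (ϑ' s.toNNReal)
      (x (stepIndex γ (stepTime γ n + s))) (a (stepIndex γ (stepTime γ n + s))) with hI
  have hdiff : Tendsto (fun n => I (Θ (φ n)) (φ n) - I ϑ (φ n)) atTop (𝓝 0) := by
    obtain ⟨B, hB⟩ := (isCompact_Icc (a := (0 : ℝ≥0)) (b := t)).exists_bound_of_continuousOn
      ϑ.continuous.continuousOn
    obtain ⟨L, C, hL, hC, hlip⟩ := exists_norm_lossGrad_sub_le (p := p) (r := r) (α := α)
      hsquash hN hp hr (B + 1) R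
    rw [Metric.tendsto_nhds]
    intro ε hε
    have hden : 0 < (L + C + 1) * ((t : ℝ) + 1) := by positivity
    set η : ℝ := min 1 (ε / ((L + C + 1) * ((t : ℝ) + 1))) with hη
    have hη0 : 0 < η := lt_min one_pos (div_pos hε hden)
    have h1 := Metric.tendstoUniformlyOn_iff.1 hunif η hη0
    have h2 : ∀ᶠ n in atTop, ∀ m ≥ φ n,
        (p (x m, a m)).real (Metric.closedBall 0 R)ᶜ ≤ η := by
      have h3 : ∀ᶠ m in atTop, (p (x m, a m)).real (Metric.closedBall 0 R)ᶜ ≤ η :=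
        (hδ.eventually_lt_const hη0).mono fun m hm => hm.le
      exact hφ.eventually (eventually_forall_ge_atTop.2 h3)
    filter_upwards [h1, h2] with n hn hn'
    have hbound : ‖I (Θ (φ n)) (φ n) - I ϑ (φ n)‖ ≤ (L * η + C * η) * |(t : ℝ) - 0| := by
      rw [hI]
      beta_reduce
      rw [← intervalIntegral.integral_sub (intervalIntegrable_shiftedProcess hx
          (G := fun s y b => N.lossGrad p r α (Θ (φ n) s.toNNReal) y b) (hcont (Θ (φ n))) _ t)
        (intervalIntegrable_shiftedProcess hx
          (G := fun s y b => N.lossGrad p r α (ϑ s.toNNReal) y b) (hcont ϑ) _ t)]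
      refine intervalIntegral.norm_integral_le_of_norm_le_const fun s hs => ?_
      rw [uIoc_of_le t.coe_nonneg] at hs
      have hst : s.toNNReal ≤ t := Real.toNNReal_le_iff_le_coe.2 hs.2
      have hd : ‖Θ (φ n) s.toNNReal - ϑ s.toNNReal‖ ≤ η := by
        rw [← dist_eq_norm, dist_comm]
        exact (hn _ hst).le
      have hϑB : ‖ϑ s.toNNReal‖ ≤ B := hB _ ⟨zero_le, hst⟩
      have hΘB : ‖Θ (φ n) s.toNNReal‖ ≤ B + 1 := by
        have h4 := norm_le_norm_add_norm_sub' (Θ (φ n) s.toNNReal) (ϑ s.toNNReal)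
        linarith [min_le_left 1 (ε / ((L + C + 1) * ((t : ℝ) + 1)))]
      refine (hlip _ _ _ _ hΘB (hϑB.trans (by linarith)) (hx _)).trans ?_
      have h5 := hn' (stepIndex γ (stepTime γ (φ n) + s))
        (hγ.le_stepIndex (le_add_of_nonneg_right hs.1.le))
      gcongr
    rw [dist_zero_right]
    have h6 : η * ((L + C + 1) * ((t : ℝ) + 1)) ≤ ε :=
      (le_div_iff₀ hden).1 (min_le_right _ _)
    rw [sub_zero, abs_of_nonneg t.coe_nonneg] at hbound
    have h7 : (L * η + C * η) * (t : ℝ) < η * ((L + C + 1) * ((t : ℝ) + 1)) := by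
      have h8 : 0 ≤ η * (t : ℝ) := by positivity
      have h9 : 0 ≤ η * (L + C) := by positivity
      nlinarith
    linarith
  have hsum := ((heval 0).add hconv).add hdiff
  rw [add_zero] at hsum
  refine tendsto_nhds_unique (heval t) (hsum.congr fun n => ?_)
  rw [((hΘ (φ n)) t).2, hI]
  abel

/-! ### Relative compactness of the solutions -/

/-- The Arzelà–Ascoli theorem for sequences of paths. -/
theorem exists_subseq_tendsto_of_equicontinuous {E : Type*} [NormedAddCommGroup E]
    [ProperSpace E] {Θ : ℕ → C(ℝ≥0, E)} (heq : Equicontinuous fun n => (Θ n : ℝ≥0 → E))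
    (hb : ∀ t, ∃ C, ∀ n, ‖Θ n t‖ ≤ C) :
    ∃ ψ : ℕ → ℕ, StrictMono ψ ∧ ∃ ϑ, Tendsto (fun n => Θ (ψ n)) atTop (𝓝 ϑ) := by
  have hemb : IsClosedEmbedding (UniformOnFun.ofFun {K : Set ℝ≥0 | IsCompact K} ∘
      (DFunLike.coe : C(ℝ≥0, E) → ℝ≥0 → E)) := by
    refine ⟨ContinuousMap.isUniformEmbedding_toUniformOnFunIsCompact.isEmbedding, ?_⟩
    have h := ContinuousMap.range_toUniformOnFunIsCompact (α := ℝ≥0) (β := E)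
    change IsClosed (range ContinuousMap.toUniformOnFunIsCompact)
    rw [h]
    exact UniformOnFun.isClosed_setOfPred_continuous CompactlyCoherentSpace.isCoherentWith
  have hcomp : IsCompact (closure (range Θ)) := by
    refine ArzelaAscoli.isCompact_closure_of_isClosedEmbedding (fun K hK => hK) hemb
      (fun K _ => ?_) fun K _ t _ => ?_
    · refine Equicontinuous.equicontinuousOn (fun t => ?_) K
      intro U hU
      filter_upwards [heq t U hU] with s hs
      rintro ⟨_, n, rfl⟩
      exact hs n
    · obtain ⟨C, hC⟩ := hb t
      refine ⟨Metric.closedBall 0 C, isCompact_closedBall _ _, ?_⟩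
      rintro _ ⟨n, rfl⟩
      simpa using hC n
  obtain ⟨ϑ, -, ψ, hψ, hlim⟩ := hcomp.tendsto_subseq fun n => subset_closure (mem_range_self n)
  exact ⟨ψ, hψ, ϑ, hlim⟩

section Solutions

variable {E : Type*} [NormedAddCommGroup E] [NormedSpace ℝ E] {γ : ℕ → ℝ}

theorem IsStepSize.norm_interpolate_le (hγ : IsStepSize γ) {w : ℕ → E} {R : ℝ}
    (hR : ∀ m, ‖w m‖ ≤ R) {t : ℝ} (ht : 0 ≤ t) : ‖interpolate γ w t‖ ≤ 3 * R := by
  obtain ⟨n, hn⟩ := hγ.exists_mem_Ico ht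
  rw [hγ.interpolate_eq w hn]
  have h0 : 0 ≤ (t - stepTime γ n) / γ n := div_nonneg (sub_nonneg.2 hn.1) (hγ.pos n).le
  have h1 : (t - stepTime γ n) / γ n ≤ 1 := by
    rw [div_le_one (hγ.pos n)]
    have := hn.2
    rw [stepTime_succ] at this
    linarith
  have h2 : ‖((t - stepTime γ n) / γ n) • (w (n + 1) - w n)‖ ≤ 1 * (R + R) := by
    rw [norm_smul, Real.norm_of_nonneg h0]
    exact mul_le_mul h1 ((norm_sub_le _ _).trans (add_le_add (hR _) (hR _))) (norm_nonneg _)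
      zero_le_one
  have h3 := norm_add_le (w n) (((t - stepTime γ n) / γ n) • (w (n + 1) - w n))
  linarith [hR n]

theorem IsStepSolution.norm_sub_le {f : ℕ → E → E} {n : ℕ} {Θ : ℝ≥0 → E}
    (h : IsStepSolution γ f n Θ) {C : ℝ} {T : ℝ≥0} (hC : ∀ m, ∀ t ≤ T, ‖f m (Θ t)‖ ≤ C)
    {s t : ℝ≥0} (hs : s ≤ T) (ht : t ≤ T) : ‖Θ t - Θ s‖ ≤ C * |(t : ℝ) - s| := by
  rw [(h t).2, (h s).2, add_sub_add_left_eq_sub,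
    intervalIntegral.integral_interval_sub_left (h t).1 (h s).1]
  refine intervalIntegral.norm_integral_le_of_norm_le_const fun u hu => hC _ _ ?_
  have h1 : u ≤ max (s : ℝ) t := hu.2
  exact Real.toNNReal_le_iff_le_coe.2 (h1.trans (max_le hs ht))

/-- Solutions that are bounded, eventually and locally uniformly, have a subsequence that converges
locally uniformly. -/
theorem exists_subseq_tendsto_of_isStepSolution [ProperSpace E] {f : ℕ → E → E} {C ρ : ℝ}
    (hC : ∀ m w, ‖w‖ ≤ ρ → ‖f m w‖ ≤ C) {Θ : ℕ → C(ℝ≥0, E)} {φ : ℕ → ℕ}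
    (hΘ : ∀ n, IsStepSolution γ f (φ n) (Θ n))
    (hb : ∀ T : ℝ≥0, ∀ᶠ n in atTop, ∀ t ≤ T, ‖Θ n t‖ ≤ ρ) :
    ∃ ψ : ℕ → ℕ, StrictMono ψ ∧ ∃ ϑ, Tendsto (fun n => Θ (ψ n)) atTop (𝓝 ϑ) := by
  refine exists_subseq_tendsto_of_equicontinuous (fun t₀ => ?_) fun t => ?_
  · rw [Metric.equicontinuousAt_iff_right]
    intro ε hε
    obtain ⟨n₀, hn₀⟩ := eventually_atTop.1 (hb (t₀ + 1))
    have h1 : ∀ᶠ t in 𝓝 t₀, ∀ n ∈ Finset.range n₀, dist (Θ n t₀) (Θ n t) < ε := by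
      refine (Finset.range n₀).eventually_all.2 fun n _ => ?_
      have h := Metric.tendsto_nhds.1 ((Θ n).continuous.tendsto t₀) ε hε
      simpa only [dist_comm] using h
    have h2 : ∀ᶠ t in 𝓝 t₀, |C| * dist t₀ t < ε := by
      have h : Tendsto (fun t => |C| * dist t₀ t) (𝓝 t₀) (𝓝 (|C| * dist t₀ t₀)) :=
        Continuous.tendsto (by fun_prop) _
      rw [dist_self, mul_zero] at h
      exact h.eventually_lt_const hε
    have h3 : ∀ᶠ t in 𝓝 t₀, t ≤ t₀ + 1 :=
      Iic_mem_nhds (lt_add_of_pos_right t₀ one_pos)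
    filter_upwards [h1, h2, h3] with t ht1 ht2 ht3 n
    rcases lt_or_ge n n₀ with hn | hn
    · exact ht1 n (Finset.mem_range.2 hn)
    · have h4 := (hΘ n).norm_sub_le (C := |C|) (T := t₀ + 1)
        (fun m s hs => (hC m _ (hn₀ n hn s hs)).trans (le_abs_self C)) ht3
        (le_add_of_nonneg_right zero_le_one)
      rw [← dist_eq_norm] at h4
      exact h4.trans_lt (by rwa [NNReal.dist_eq] at ht2)
  · obtain ⟨n₀, hn₀⟩ := eventually_atTop.1 (hb t)
    refine ⟨max ρ (∑ n ∈ Finset.range n₀, ‖Θ n t‖), fun n => ?_⟩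
    rcases lt_or_ge n n₀ with hn | hn
    · exact le_max_of_le_right (Finset.single_le_sum (f := fun n => ‖Θ n t‖)
        (fun _ _ => norm_nonneg _) (Finset.mem_range.2 hn))
    · exact le_max_of_le_left (hn₀ n hn t le_rfl)

end Solutions

end DeepQ

theorem mainTheorem3
    {k : ℕ} {A : Type*} [Fintype A] [Nonempty A] [TopologicalSpace A] [DiscreteTopology A]
    [MeasurableSpace A] [BorelSpace A]
    {Ω : Type*} [MeasurableSpace Ω] (P : Measure Ω) [IsProbabilityMeasure P]
    -- the network: squashing, twice continuously differentiable activations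
    (N : DeepQ.Network k A)
    (hsquash : N.AllActivations fun σ => Bornology.IsBounded (range σ))
    (hsmooth : N.AllActivations fun σ => ContDiff ℝ 2 σ)
    -- the transition kernel, weakly continuous in the state
    (p : Kernel (DeepQ.State k × A) (DeepQ.State k)) [IsMarkovKernel p]
    (hp : DeepQ.WeaklyContinuous p)
    -- the reward function and the discount factor
    (r : DeepQ.State k → A → ℝ) (hr : ∀ a, Continuous fun x => r x a)
    (α : ℝ) (hα₀ : 0 < α) (hα₁ : α ≤ 1)
    -- the step sizes
    (γ : ℕ → ℝ) (hγ : DeepQ.IsStepSize γ)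
    -- the states, actions and weights
    (x : ℕ → Ω → DeepQ.State k) (a : ℕ → Ω → A) (θ : ℕ → Ω → N.Weight)
    (hx_meas : ∀ n, Measurable (x n)) (ha_meas : ∀ n, Measurable (a n))
    (hθ_meas : ∀ n, Measurable (θ n))
    -- controlled Markov property: given the past, the next state has law `p(· | x_n, a_n)`
    (htrans : ∀ n, ∀ B : Set (DeepQ.State k), MeasurableSet B →
      P[(x (n + 1) ⁻¹' B).indicator (fun _ => (1 : ℝ)) | DeepQ.history x a θ n]
        =ᵐ[P] fun ω => (p (x n ω, a n ω)).real B)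
    -- the deep Q-learning iteration, with the observed next state or with its average
    (hupdate :
      (∀ᵐ ω ∂P, ∀ n, θ (n + 1) ω =
        θ n ω + γ n • N.sampledGrad r α (θ n ω) (x n ω) (a n ω) (x (n + 1) ω)) ∨
      (∀ᵐ ω ∂P, ∀ n, θ (n + 1) ω =
        θ n ω + γ n • N.lossGrad p r α (θ n ω) (x n ω) (a n ω)))
    -- stability
    (hθ_bdd : ∀ᵐ ω ∂P, BddAbove (range fun n => ‖θ n ω‖))
    (hx_bdd : ∀ᵐ ω ∂P, BddAbove (range fun n => ‖x n ω‖)) :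
    ∀ᵐ ω ∂P,
      -- the trajectories `θⁿ` exist
      (∀ n, ∃ ϑ : C(ℝ≥0, N.Weight), ϑ 0 = θ n ω ∧
        N.IsODESolution p r α
          (DeepQ.shiftedProcess γ (fun m => x m ω) (fun m => a m ω) n) ϑ) ∧
      -- and however they are chosen
      ∀ Θ : ℕ → C(ℝ≥0, N.Weight),
        (∀ n, Θ n 0 = θ n ω ∧
          N.IsODESolution p r α
            (DeepQ.shiftedProcess γ (fun m => x m ω) (fun m => a m ω) n) (Θ n)) →
        -- they track the interpolated iterates,
        (∀ T : ℝ≥0, TendstoUniformlyOn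
          (fun n (t : ℝ≥0) =>
            DeepQ.interpolate γ (fun m => θ m ω) (DeepQ.stepTime γ n + t) - Θ n t)
          (fun _ => 0) atTop (Iic T)) ∧
        -- every subsequence has a further one along which `θⁿ` and `μⁿ` converge,
        (∀ φ : ℕ → ℕ, StrictMono φ → ∃ ψ : ℕ → ℕ, StrictMono ψ ∧
          ∃ (ϑ : C(ℝ≥0, N.Weight)) (ν : DeepQ.ProcessSpace k A),
            Tendsto (fun n => Θ (φ (ψ n))) atTop (𝓝 ϑ) ∧
            Tendsto (fun n => DeepQ.toProcessSpace
              (DeepQ.shiftedProcess γ (fun m => x m ω) (fun m => a m ω) (φ (ψ n))))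
              atTop (𝓝 ν)) ∧
        -- and every such limit solves the limiting o.d.e. and is tracked by the algorithm
        (∀ φ : ℕ → ℕ, StrictMono φ →
          ∀ (ϑ : C(ℝ≥0, N.Weight)) (ν : DeepQ.ProcessSpace k A),
            Tendsto (fun n => Θ (φ n)) atTop (𝓝 ϑ) →
            Tendsto (fun n => DeepQ.toProcessSpace
              (DeepQ.shiftedProcess γ (fun m => x m ω) (fun m => a m ω) (φ n)))
              atTop (𝓝 ν) →
            ν.NoMassAtPole ∧
            N.IsODESolution p r α ν.onState ϑ ∧
            ∀ T : ℝ≥0, TendstoUniformlyOn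
              (fun n (t : ℝ≥0) =>
                DeepQ.interpolate γ (fun m => θ m ω) (DeepQ.stepTime γ (φ n) + t))
              ϑ atTop (Iic T)) := by
  have hK := ae_all_iff.2 fun R : ℕ => DeepQ.ae_tendsto_kernel_compl hx_meas ha_meas hθ_meas htrans
    (K := Metric.closedBall 0 (R : ℝ)) Metric.isClosed_closedBall.measurableSet
  -- In both variants the iteration is a noisy Euler scheme whose noise series converges.
  have hiter : ∀ᵐ ω ∂P, ∃ D : ℕ → N.Weight, (∀ m, θ (m + 1) ω = θ m ω + γ m •
      (N.lossGrad p r α (θ m ω) (x m ω) (a m ω) + D m)) ∧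
      ∃ l, Tendsto (fun n => ∑ m ∈ Finset.range n, γ m • D m) atTop (𝓝 l) := by
    rcases hupdate with hup | hup
    · have hnoise := ae_all_iff.2 fun R : ℕ => DeepQ.ae_exists_tendsto_noise (α := α) (r := r)
        hsquash hsmooth hp hx_meas ha_meas hθ_meas htrans hγ.summable_sq
        (Nat.cast_nonneg (α := ℝ) R)
      filter_upwards [hup, hnoise, hθ_bdd, hx_bdd] with ω hω hn ⟨B, hB⟩ ⟨B', hB'⟩
      obtain ⟨R, hR⟩ := exists_nat_ge (max B B')
      obtain ⟨l, hl⟩ := hn R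
        (fun m => (hB (mem_range_self m)).trans ((le_max_left _ _).trans hR))
        (fun m => (hB' (mem_range_self m)).trans ((le_max_right _ _).trans hR))
      exact ⟨_, fun m => by rw [hω m, add_sub_cancel], l, hl⟩
    · filter_upwards [hup] with ω hω
      exact ⟨fun _ => 0, fun m => by rw [hω m, add_zero], 0, by simp⟩
  filter_upwards [hK, hiter, hθ_bdd, hx_bdd] with ω hKω ⟨D, hD, l, hl⟩ ⟨B, hB⟩ ⟨B', hB'⟩
  obtain ⟨R, hR⟩ := exists_nat_ge (max B B')
  have hθR : ∀ m, ‖θ m ω‖ ≤ (R : ℝ) := fun m =>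
    (hB (mem_range_self m)).trans ((le_max_left _ _).trans hR)
  have hxR : ∀ m, ‖x m ω‖ ≤ (R : ℝ) := fun m =>
    (hB' (mem_range_self m)).trans ((le_max_right _ _).trans hR)
  have hR0 : (0 : ℝ) ≤ R := Nat.cast_nonneg R
  have hδ := hKω R fun m => by simpa using hxR m
  simp only [DeepQ.Network.isODESolution_shiftedProcess_iff]
  refine ⟨fun n => ?_, fun Θ hΘ => ?_⟩
  · refine hγ.exists_isStepSolution (fun m => ?_) (fun m w₀ =>
      DeepQ.Network.exists_eq_add_integral_lossGrad hsquash hsmooth hp hr _ _ w₀ (hγ.pos m).le)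
      n (θ n ω)
    exact (DeepQ.Network.continuous_lossGrad (α := α) hsquash hsmooth hp hr (a m ω)).comp
      (f := fun w : N.Weight => (w, x m ω)) (by fun_prop)
  obtain ⟨C, -, hC⟩ := DeepQ.Network.exists_norm_lossGrad_le (α := α) (p := p)
    hsquash hsmooth hp hr R R
  obtain ⟨C', -, hC'⟩ := DeepQ.Network.exists_norm_lossGrad_le (α := α) (p := p)
    hsquash hsmooth hp hr (3 * R + 1) R
  obtain ⟨L, M, hL, -, hlip⟩ := DeepQ.Network.exists_norm_lossGrad_sub_le (α := α) (p := p)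
    hsquash hsmooth hp hr (R + 2) R
  have htrack : ∀ T : ℝ≥0, TendstoUniformlyOn (fun n (t : ℝ≥0) =>
      DeepQ.interpolate γ (fun m => θ m ω) (DeepQ.stepTime γ n + t) - Θ n t)
      (fun _ => 0) atTop (Iic T) := fun T =>
    DeepQ.tendstoUniformlyOn_interpolate_sub hγ
      (f := fun m w => N.lossGrad p r α w (x m ω) (a m ω)) hD hθR hl
      (fun m => hC _ _ _ (hθR m) (hxR m)) hL (by simpa using hδ.const_mul M)
      (fun m w w' hw hw' => hlip w w' _ _ hw hw' (hxR m)) (fun n => (hΘ n).1)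
      (fun n => (hΘ n).2) T
  have hbound : ∀ T : ℝ≥0, ∀ᶠ n in atTop, ∀ t ≤ T, ‖Θ n t‖ ≤ 3 * R + 1 := fun T => by
    filter_upwards [Metric.tendstoUniformlyOn_iff.1 (htrack T) 1 one_pos] with n hn t ht
    have h1 := hn t ht
    rw [dist_zero_left] at h1
    have h2 := hγ.norm_interpolate_le hθR
      (add_nonneg (hγ.stepTime_nonneg n) t.coe_nonneg)
    have h3 := norm_le_norm_add_norm_sub
      (DeepQ.interpolate γ (fun m => θ m ω) (DeepQ.stepTime γ n + t)) (Θ n t)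
    linarith
  refine ⟨htrack, fun φ hφ => ?_, fun φ hφ ϑ ν hϑ hν => ⟨?_, ?_, fun T => ?_⟩⟩
  · obtain ⟨ψ₁, hψ₁, ϑ, hϑ⟩ := DeepQ.exists_subseq_tendsto_of_isStepSolution
      (fun m w hw => hC' w (x m ω) (a m ω) hw (hxR m)) (Θ := fun n => Θ (φ n)) (φ := φ)
      (fun n => (hΘ (φ n)).2) fun T => hφ.tendsto_atTop.eventually (hbound T)
    obtain ⟨ψ₂, hψ₂, ν, hν⟩ := DeepQ.ProcessSpace.exists_subseq_tendsto fun n =>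
      DeepQ.toProcessSpace (DeepQ.shiftedProcess γ (fun m => x m ω) (fun m => a m ω) (φ (ψ₁ n)))
    exact ⟨fun n => ψ₁ (ψ₂ n), hψ₁.comp hψ₂, ϑ, ν, hϑ.comp hψ₂.tendsto_atTop, hν⟩
  · filter_upwards [DeepQ.ae_measure_notMem_ballImage hR0 hxR hν] with t ht
    refine measure_mono_null (fun z hz => ?_) ht
    exact fun h => DeepQ.northPole_notMem_ballImage k R (Eq.subst (motive := (· ∈ _)) hz h)
  · exact DeepQ.Network.isODESolution_of_tendsto hsquash hsmooth hp hr hγ hR0 hxR hδ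
      (fun n => (hΘ n).2) hφ.tendsto_atTop hϑ hν
  · have h1 : TendstoUniformlyOn (fun n (t : ℝ≥0) =>
        DeepQ.interpolate γ (fun m => θ m ω) (DeepQ.stepTime γ (φ n) + t) - Θ (φ n) t)
        (fun _ => 0) atTop (Iic T) :=
      fun U hU => hφ.tendsto_atTop.eventually (htrack T U hU)
    have h2 := h1.add (DeepQ.tendstoUniformlyOn_Iic_of_tendsto hϑ T)
    refine (h2.congr_right fun t _ => ?_).congr (Eventually.of_forall fun n t _ => ?_)
    · simp
    · simp
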